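/- Let $n\ge 1$ and let $T\subset\mathbb{R}^n$ be a nondegenerate open simplex with vertex set $\mathcal V_T$, diameter $h_T$, volume $|T|$ and outward unit normal $n_T$. For a vertex $z$ let $\eta_z$ be the affine function with $\eta_z(z')=\delta_{z,z'}$ for $z'\in\mathcal V_T$. For a face $F\in\mathcal F_T$ let $\mathcal V_F$ be its vertices, $z_F$ the vertex opposite to $F$, $n_F=n_T|_F$, and set $$\nu_F=\sum_{z\in\mathcal V_F}\eta_z-(n-1)\eta_{z_F},\qquad \psi_F(x)=\frac{x-z_F}{\operatorname{dist}(z_F,F^*)},\qquad \boldsymbol\eta_F=\Big(\prod_{z\in\mathcal V_F}\eta_z\Big)n_F,$$ where $F^*$ is the hyperplane containing $F$, so that $\psi_F$ is the Raviart–Thomas basis function with $\psi_F\cdot n_T|_{F'}=\delta_{F,F'}$. Fix a vertex $z_*$ and let $\mathcal E_*$ be the set of the $n$ edges at $z_*$. For $E\in\mathcal E_*$ with endpoints $z_*,z'$ put $t_E=z'-z_*$ and $\boldsymbol\eta_E=\eta_{z_*}\eta_{z'}t_E$, and let $\sigma_E\in\mathbb{R}^n$ be the constant vectors with $\sigma_E\cdot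 t_{E'}=\delta_{E,E'}$ for $E,E'\in\mathcal E_*$. Let $H(\mathrm{div};T)$ be the space of $\tau\in L^2(T)^n$ with weak divergence in $L^2(T)$; $(\cdot,\cdot)_T$ and $\|\cdot\|_T$ are the $L^2(T)$ inner product and norm, and $\langle\tau\cdot n_T,v\rangle_{\partial T}=(\mathrm{div}\,\tau,v)_T+(\tau,\nabla v)_T$ for $\tau\in H(\mathrm{div};T)$, $v\in H^1(T)$, which depends on $v$ only through its trace on $\partial T$. Let $P^q(T)$ and $\boldsymbol P^q(T)$ be the scalar and vector polynomials of degree at most $q$, $\Pi_T^q$ the $L^2(T)$-orthogonal projection on them, $P_c^1(\mathcal F_T)$ the continuous functions on $\partial T$ that are affine on each face, and $RT^0(T)=\{x\mapsto a+\beta x: a\in\mathbb{R}^n,\ \beta\in\mathbb{R}\}$. Set $\widetilde V^1=RT^0(T)$, $\widetilde V^2=\boldsymbol P^0(T)+\operatorname{span}\{\boldsymbol\eta_F: F\in\mathcal F_T\}$ and $V^j=\widetilde V^j+\operatorname{span}\{\boldsymbol\eta_E: E\in\mathcal E_*\}$. For $\tau\in H(\mathrm{div};T)$ define $$\widetilde\Pi^{1}\tau=\sum_{F}\frac{\langle\tau\cdot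 n_T,\nu_F\rangle_{\partial T}}{\langle\psi_F\cdot n_T,\nu_F\rangle_{\partial T}}\,\psi_F,\qquad \widetilde\Pi^{2}\tau=\Pi_T^0\tau+\sum_{F}\frac{\langle(\tau-\Pi_T^0\tau)\cdot n_T,\nu_F\rangle_{\partial T}}{\langle\boldsymbol\eta_F\cdot n_T,\nu_F\rangle_{\partial T}}\,\boldsymbol\eta_F,$$ $$\Pi^{j}\tau=\widetilde\Pi^{j}\tau+\sum_{E\in\mathcal E_*}\frac{(\sigma_E,\tau-\widetilde\Pi^{j}\tau)_T}{(\sigma_E,\boldsymbol\eta_E)_T}\,\boldsymbol\eta_E,\qquad j=1,2.$$ Theorem. For $j=1,2$ and every $\tau\in H(\mathrm{div};T)$ we have $\Pi^j\tau\in V^j\cap H(\mathrm{div};T)$ and $$\langle(\tau-\Pi^j\tau)\cdot n_T,u\rangle_{\partial T}=0\quad\forall u\in P_c^1(\mathcal F_T),\qquad (\sigma,\tau-\Pi^j\tau)_T=0\quad\forall\sigma\in\boldsymbol P^0(T).$$ For every $\kappa>0$ there is a constant $C>0$ depending only on $n$ and $\kappa$ such that for every simplex $T$ that contains a ball of some radius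 $r>0$ with $h_T\le\kappa r$, every choice of $z_*$, $j=1,2$ and every $\tau\in H(\mathrm{div};T)$, $$\|\Pi^j\tau\|_T\le C\big(\|\tau\|_T+h_T\|\mathrm{div}\,\tau\|_T\big),\qquad \|\mathrm{div}\,\Pi^j\tau\|_T\le C\,\|\mathrm{div}\,\tau\|_T.$$ Moreover $\mathrm{div}\,\Pi^{1}\tau=\Pi_T^1\,\mathrm{div}\,\tau$ for all $\tau\in H(\mathrm{div};T)$; $\Pi^{1}\tau=\tau$ for all $\tau\in RT^0(T)$ (so $\Pi^1$ is idempotent on $RT^0(T)$), and $\Pi^{2}\tau=\tau$ for all $\tau\in\boldsymbol P^0(T)$ (so $\Pi^2$ is idempotent on $\boldsymbol P^0(T)$). -/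

import Mathlib

open MeasureTheory

noncomputable section

/-- Euclidean space `ℝⁿ`. -/
abbrev EucN (n : ℕ) : Type := EuclideanSpace ℝ (Fin n)

/-! ## Sobolev notions on an open set `T ⊆ ℝⁿ` -/

/-- `φ ∈ C_c^∞(T)`. -/
def IsTestFun {n : ℕ} (T : Set (EucN n)) (φ : EucN n → ℝ) : Prop :=
  ContDiff ℝ (⊤ : ℕ∞) φ ∧ HasCompactSupport φ ∧ tsupport φ ⊆ T

/-- `d ∈ L²(T)` is the distributional divergence of `τ` on `T`. -/
def HasWeakDiv {n : ℕ} (T : Set (EucN n)) (τ : EucN n → EucN n) (d : EucN n → ℝ) : Prop :=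
  MemLp d 2 (volume.restrict T) ∧
    ∀ φ, IsTestFun T φ →
      ∫ x in T, inner ℝ (τ x) (gradient φ x) = - ∫ x in T, d x * φ x

/-- `g ∈ L²(T; ℝⁿ)` is the distributional gradient of `v` on `T`. -/
def HasWeakGrad {n : ℕ} (T : Set (EucN n)) (v : EucN n → ℝ) (g : EucN n → EucN n) : Prop :=
  MemLp g 2 (volume.restrict T) ∧
    ∀ φ, IsTestFun T φ →
      ∫ x in T, v x • gradient φ x = - ∫ x in T, φ x • g x

/-- `τ ∈ H(div; T)`. -/
def MemHDiv {n : ℕ} (T : Set (EucN n)) (τ : EucN n → EucN n) : Prop :=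
  MemLp τ 2 (volume.restrict T) ∧ ∃ d, HasWeakDiv T τ d

/-- `v ∈ H¹(T)`. -/
def MemH1 {n : ℕ} (T : Set (EucN n)) (v : EucN n → ℝ) : Prop :=
  MemLp v 2 (volume.restrict T) ∧ ∃ g, HasWeakGrad T v g

open Classical in
/-- The weak divergence `div τ ∈ L²(T)` (a representative; unique almost everywhere on `T`). -/
def weakDiv {n : ℕ} (T : Set (EucN n)) (τ : EucN n → EucN n) : EucN n → ℝ :=
  if h : ∃ d, HasWeakDiv T τ d then h.choose else 0

open Classical in
/-- The weak gradient `∇ v ∈ L²(T; ℝⁿ)` (a representative; unique almost everywhere on `T`). -/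
def weakGrad {n : ℕ} (T : Set (EucN n)) (v : EucN n → ℝ) : EucN n → EucN n :=
  if h : ∃ g, HasWeakGrad T v g then h.choose else 0

theorem MemHDiv.hasWeakDiv {n : ℕ} {T : Set (EucN n)} {τ : EucN n → EucN n}
    (h : MemHDiv T τ) : HasWeakDiv T τ (weakDiv T τ) := by
  unfold weakDiv
  rw [dif_pos h.2]
  exact h.2.choose_spec

theorem MemH1.hasWeakGrad {n : ℕ} {T : Set (EucN n)} {v : EucN n → ℝ}
    (h : MemH1 T v) : HasWeakGrad T v (weakGrad T v) := by
  unfold weakGrad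
  rw [dif_pos h.2]
  exact h.2.choose_spec

/-- The `L²(T)` norm. -/
def l2Norm {n : ℕ} {F : Type*} [NormedAddCommGroup F] (T : Set (EucN n)) (f : EucN n → F) : ℝ :=
  Real.sqrt (∫ x in T, ‖f x‖ ^ 2)

/-- The duality `⟨τ · n_T, v⟩_{∂T} = (div τ, v)_T + (τ, ∇ v)_T` between the normal trace of
`τ ∈ H(div; T)` and the trace of `v ∈ H¹(T)`. -/
def normalPairing {n : ℕ} (T : Set (EucN n)) (τ : EucN n → EucN n) (v : EucN n → ℝ) : ℝ :=
  (∫ x in T, weakDiv T τ x * v x) + ∫ x in T, inner ℝ (τ x) (weakGrad T v x)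

/-- `v ∈ H¹(T) ∩ C(closure T)` has the boundary values `u` (its trace is then `u`). -/
def IsH1Lift {n : ℕ} (T : Set (EucN n)) (u v : EucN n → ℝ) : Prop :=
  MemH1 T v ∧ ContinuousOn v (closure T) ∧ ∀ x ∈ frontier T, v x = u x

/-- `⟨τ · n_T, u⟩_{∂T} = c` for a function `u` on `∂T`: there are `H¹(T)`-functions with the
boundary values `u`, and each of them gives the value `c` of the duality. -/
def HasNormalPairing {n : ℕ} (T : Set (EucN n)) (τ : EucN n → EucN n) (u : EucN n → ℝ)
    (c : ℝ) : Prop :=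
  (∃ v, IsH1Lift T u v) ∧ ∀ v, IsH1Lift T u v → normalPairing T τ v = c

/-! ## Polynomial spaces and `L²(T)`-projections

Polynomials are taken as functions on `ℝⁿ`; on an open nonempty `T` they are determined by their
restrictions. -/

/-- `P^q`: real polynomial functions of total degree at most `q`. -/
def polySpace (n q : ℕ) : Submodule ℝ (EucN n → ℝ) where
  carrier := {f | ∃ p : MvPolynomial (Fin n) ℝ, p.totalDegree ≤ q ∧
    ∀ x, f x = MvPolynomial.eval (fun i => x i) p}
  add_mem' := by
    rintro f g ⟨p, hp, hf⟩ ⟨r, hr, hg⟩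
    exact ⟨p + r, (MvPolynomial.totalDegree_add p r).trans (max_le hp hr),
      fun x => by simp [hf x, hg x]⟩
  zero_mem' := ⟨0, by simp, fun x => by simp⟩
  smul_mem' := by
    rintro c f ⟨p, hp, hf⟩
    exact ⟨c • p, (MvPolynomial.totalDegree_smul_le c p).trans hp,
      fun x => by simp [hf x, MvPolynomial.smul_eval]⟩

/-- Vector fields all of whose components belong to `P^q`. -/
def polyVecSpace (n q : ℕ) : Submodule ℝ (EucN n → EucN n) where
  carrier := {f | ∀ i, (fun x => f x i) ∈ polySpace n q}
  add_mem' := fun hf hg i => (polySpace n q).add_mem (hf i) (hg i)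
  zero_mem' := fun _ => (polySpace n q).zero_mem
  smul_mem' := fun c _ hf i => (polySpace n q).smul_mem c (hf i)

/-- The lowest-order Raviart–Thomas space `{x ↦ a + β x}`. -/
def rtSpace (n : ℕ) : Submodule ℝ (EucN n → EucN n) where
  carrier := {f | ∃ (a : EucN n) (β : ℝ), ∀ x, f x = a + β • x}
  add_mem' := by
    rintro f g ⟨a, β, hf⟩ ⟨a', β', hg⟩
    exact ⟨a + a', β + β', fun x => by simp only [Pi.add_apply, hf x, hg x]; module⟩
  zero_mem' := ⟨0, 0, fun x => by simp⟩
  smul_mem' := by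
    rintro c f ⟨a, β, hf⟩
    exact ⟨c • a, c * β, fun x => by simp only [Pi.smul_apply, hf x]; module⟩

/-- `p` is the `L²(T)`-orthogonal projection of `f` on the space `V`. -/
def IsL2Proj {n : ℕ} {F : Type*} [NormedAddCommGroup F] [InnerProductSpace ℝ F]
    (T : Set (EucN n)) (V : Submodule ℝ (EucN n → F)) (f p : EucN n → F) : Prop :=
  p ∈ V ∧ ∀ r ∈ V, ∫ x in T, inner ℝ (r x) (f x - p x) = 0

open Classical in
/-- The `L²(T)`-orthogonal projection on `V`. -/
def l2Proj {n : ℕ} {F : Type*} [NormedAddCommGroup F] [InnerProductSpace ℝ F]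
    (T : Set (EucN n)) (V : Submodule ℝ (EucN n → F)) (f : EucN n → F) : EucN n → F :=
  if h : ∃ p, IsL2Proj T V f p then h.choose else 0

/-! ## Simplices

A nondegenerate simplex in `ℝⁿ` is given by its `n + 1` vertices `b 0, …, b n`, an affine basis.
`b.coord i` is the affine function `η_z` of the vertex `z = b i`; the face opposite to `b i` is
labelled by `i`. -/

/-- The open simplex `T` with vertices `b i`. -/
def openSimplex {n : ℕ} (b : AffineBasis (Fin (n + 1)) ℝ (EucN n)) : Set (EucN n) :=
  interior (convexHull ℝ (Set.range b))

/-- The (closed) face of `T` opposite to the vertex `b i`. -/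
def faceSet {n : ℕ} (b : AffineBasis (Fin (n + 1)) ℝ (EucN n)) (i : Fin (n + 1)) :
    Set (EucN n) :=
  convexHull ℝ (b '' {j | j ≠ i})

/-- `P_c^q` on the boundary: continuous functions on `∂T` that are polynomials of degree at most
`q` on each face. -/
def IsContFacePoly {n : ℕ} (b : AffineBasis (Fin (n + 1)) ℝ (EucN n)) (q : ℕ)
    (u : EucN n → ℝ) : Prop :=
  ContinuousOn u (frontier (openSimplex b)) ∧
    ∀ i, ∃ p ∈ polySpace n q, ∀ x ∈ faceSet b i, u x = p x

/-- Shape regularity with constant `κ`: `T` contains a ball of radius `r` with `h_T ≤ κ r`. -/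
def ShapeRegular {n : ℕ} (κ : ℝ) (b : AffineBasis (Fin (n + 1)) ℝ (EucN n)) : Prop :=
  ∃ (c : EucN n) (r : ℝ), 0 < r ∧ Metric.ball c r ⊆ openSimplex b ∧
    Metric.diam (openSimplex b) ≤ κ * r

/-- The constant gradient of the affine function `b.coord i`. -/
def coordGrad {n : ℕ} (b : AffineBasis (Fin (n + 1)) ℝ (EucN n)) (i : Fin (n + 1)) : EucN n :=
  (InnerProductSpace.toDual ℝ (EucN n)).symm (LinearMap.toContinuousLinearMap (b.coord i).linear)

theorem inner_coordGrad {n : ℕ} (b : AffineBasis (Fin (n + 1)) ℝ (EucN n)) (i : Fin (n + 1))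
    (x y : EucN n) : inner ℝ (coordGrad b i) (x - y) = b.coord i x - b.coord i y := by
  have h : inner ℝ (coordGrad b i) (x - y) = (b.coord i).linear (x - y) := by
    unfold coordGrad
    rw [InnerProductSpace.toDual_symm_apply]
    rfl
  have h2 := (b.coord i).linearMap_vsub x y
  simp only [vsub_eq_sub] at h2
  rw [h, h2]

theorem coordGrad_ne_zero {n : ℕ} (hn : 1 ≤ n) (b : AffineBasis (Fin (n + 1)) ℝ (EucN n))
    (i : Fin (n + 1)) : coordGrad b i ≠ 0 := by
  intro h
  have : Nontrivial (Fin (n + 1)) := Fin.nontrivial_iff_two_le.2 (by omega)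
  obtain ⟨j, hj⟩ := exists_ne i
  have h1 := inner_coordGrad b i (b i) (b j)
  rw [h, inner_zero_left, b.coord_apply_eq, b.coord_apply_ne hj.symm] at h1
  norm_num at h1

/-- The outward unit normal `n_F` on the face opposite to `b i`. -/
def faceNormal {n : ℕ} (b : AffineBasis (Fin (n + 1)) ℝ (EucN n)) (i : Fin (n + 1)) : EucN n :=
  -(‖coordGrad b i‖⁻¹ • coordGrad b i)

/-! ## Basis functions -/

/-- `ν_F = ∑_{z ∈ V_F} η_z - (n - 1) η_{z_F}`. -/
def nuFun {n : ℕ} (b : AffineBasis (Fin (n + 1)) ℝ (EucN n)) (i : Fin (n + 1))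
    (x : EucN n) : ℝ :=
  (∑ j ∈ Finset.univ.erase i, b.coord j x) - ((n : ℝ) - 1) * b.coord i x

/-- The Raviart–Thomas basis function `ψ_F(x) = (x - z_F) / dist(z_F, F)`; the height of `T` over
`F` is `1 / ‖∇ η_{z_F}‖ = n |T| / |F|`. -/
def rtFun {n : ℕ} (b : AffineBasis (Fin (n + 1)) ℝ (EucN n)) (i : Fin (n + 1))
    (x : EucN n) : EucN n :=
  ‖coordGrad b i‖ • (x - b i)

/-- The Bernardi–Raugel function: the face bubble `∏_{z ∈ V_F} η_z` times `n_F`. -/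
def brFun {n : ℕ} (b : AffineBasis (Fin (n + 1)) ℝ (EucN n)) (i : Fin (n + 1))
    (x : EucN n) : EucN n :=
  (∏ j ∈ Finset.univ.erase i, b.coord j x) • faceNormal b i

/-- The tangential edge function `η_{z_*} η_{z'} t_E` of the edge `E` from `z_* = b s` to
`z' = b k`, with `t_E = z' - z_*`. -/
def edgeFun {n : ℕ} (b : AffineBasis (Fin (n + 1)) ℝ (EucN n)) (s k : Fin (n + 1))
    (x : EucN n) : EucN n :=
  (b.coord s x * b.coord k x) • (b k - b s)

/-- The constant fields `σ_E` dual to the edge vectors at a vertex. For the edge from `b s` to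
`b k` this is `∇ η_{b k}`, whatever `s ≠ k` is (see `inner_edgeSigma`). -/
def edgeSigma {n : ℕ} (b : AffineBasis (Fin (n + 1)) ℝ (EucN n)) (k : Fin (n + 1)) : EucN n :=
  coordGrad b k

/-- The vectors `n_F` are unit vectors. -/
theorem norm_faceNormal {n : ℕ} (hn : 1 ≤ n) (b : AffineBasis (Fin (n + 1)) ℝ (EucN n))
    (i : Fin (n + 1)) : ‖faceNormal b i‖ = 1 := by
  have h := norm_ne_zero_iff.2 (coordGrad_ne_zero hn b i)
  rw [faceNormal, norm_neg, norm_smul, norm_inv, norm_norm, inv_mul_cancel₀ h]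

/-- `n_F` is orthogonal to the plane of the face `F`, and `F` lies on the outer side of `z_F`. -/
theorem inner_faceNormal {n : ℕ} (b : AffineBasis (Fin (n + 1)) ℝ (EucN n))
    (i : Fin (n + 1)) (x y : EucN n) :
    inner ℝ (faceNormal b i) (x - y) = ‖coordGrad b i‖⁻¹ * (b.coord i y - b.coord i x) := by
  rw [faceNormal, inner_neg_left, real_inner_smul_left, inner_coordGrad]
  ring

/-- `ψ_F · n_{F'} = δ_{F,F'}` on `F'`. -/
theorem inner_rtFun_faceNormal {n : ℕ} (hn : 1 ≤ n)
    (b : AffineBasis (Fin (n + 1)) ℝ (EucN n)) (i j : Fin (n + 1)) (x : EucN n)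
    (hx : b.coord j x = 0) :
    inner ℝ (rtFun b i x) (faceNormal b j) = if i = j then 1 else 0 := by
  have h := norm_ne_zero_iff.2 (coordGrad_ne_zero hn b j)
  rw [rtFun, real_inner_smul_left, real_inner_comm, inner_faceNormal, hx]
  by_cases hij : i = j
  · subst hij
    simp [h]
  · rw [b.coord_apply_ne (Ne.symm hij)]
    simp [hij]

/-- `σ_E · t_{E'} = δ_{E,E'}` for the edges at the vertex `b s`. -/
theorem inner_edgeSigma {n : ℕ} (b : AffineBasis (Fin (n + 1)) ℝ (EucN n))
    (s k l : Fin (n + 1)) (hk : k ≠ s) :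
    inner ℝ (edgeSigma b k) (b l - b s) = if k = l then 1 else 0 := by
  rw [edgeSigma, inner_coordGrad, b.coord_apply_ne hk, b.coord_apply, sub_zero]

/-! ## The spaces and operators -/

/-- The two variants of the construction: `rt` (`j = 1`) and `br` (`j = 2`). -/
inductive FortinVariant
  | rt
  | br

/-- `RT⁰(T)` for `rt`, and `P⁰(T) + span {η_F n_F}` for `br`. -/
def preSpace {n : ℕ} (b : AffineBasis (Fin (n + 1)) ℝ (EucN n)) :
    FortinVariant → Submodule ℝ (EucN n → EucN n)
  | .rt => rtSpace n
  | .br => polyVecSpace n 0 ⊔ Submodule.span ℝ (Set.range (brFun b))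

/-- `V_h`: the previous space enriched by the edge functions of the edges at `z_* = b s`. -/
def fortinSpace {n : ℕ} (b : AffineBasis (Fin (n + 1)) ℝ (EucN n)) (s : Fin (n + 1))
    (j : FortinVariant) : Submodule ℝ (EucN n → EucN n) :=
  preSpace b j ⊔ Submodule.span ℝ (edgeFun b s '' {k | k ≠ s})

/-- The preliminary operators, without edge correction. -/
def preFortin {n : ℕ} (b : AffineBasis (Fin (n + 1)) ℝ (EucN n)) :
    FortinVariant → (EucN n → EucN n) → EucN n → EucN n
  | .rt, τ =>
      ∑ i, (normalPairing (openSimplex b) τ (nuFun b i) /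
        normalPairing (openSimplex b) (rtFun b i) (nuFun b i)) • rtFun b i
  | .br, τ =>
      l2Proj (openSimplex b) (polyVecSpace n 0) τ +
        ∑ i, (normalPairing (openSimplex b)
              (τ - l2Proj (openSimplex b) (polyVecSpace n 0) τ) (nuFun b i) /
            normalPairing (openSimplex b) (brFun b i) (nuFun b i)) • brFun b i

/-- The Fortin operators. -/
def fortinOp {n : ℕ} (b : AffineBasis (Fin (n + 1)) ℝ (EucN n)) (s : Fin (n + 1))
    (j : FortinVariant) (τ : EucN n → EucN n) : EucN n → EucN n :=
  preFortin b j τ +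
    ∑ k ∈ Finset.univ.erase s,
      ((∫ x in openSimplex b, inner ℝ (edgeSigma b k) (τ x - preFortin b j τ x)) /
        (∫ x in openSimplex b, inner ℝ (edgeSigma b k) (edgeFun b s k x))) • edgeFun b s k

end

/-! ### Translations and mollification in L² -/

noncomputable section

open Filter Topology Set Metric
open scoped ENNReal Convolution ContDiff

/-! Everything on the boundary reduces to the n + 1 numbers ⟨τ·n_T, η_k⟩, since the traces of the
barycentric coordinates span P_c^1 (`IsContFacePoly.eq_sum_coord`). As ∑ η_k = 1, one has ν_F = 1 -
n η_{z_F}, so a pairing with ν_F is ∫ div τ minus n times a coordinate pairing. If all pairings with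
the ν_F vanish, each coordinate pairing is (1/n) ∫ div τ; the n + 1 of them add up to ∫ div τ, so
all are zero (`normalPairing_coord_eq_zero`). A face function pairs to 0 with the coordinate of its
opposite vertex and to one common weight with every other coordinate. It is therefore biorthogonal
to the ν_F (`normalPairing_faceFun_nuFun`), and the preliminary operators preserve all coordinate
pairings. The edge functions have no normal component on ∂T and are dual to the constants σ_E, so
the last correction repairs the constant moments without disturbing the pairings.

For e = τ - Π¹τ, the product (div e, η_j) equals ⟨e·n_T, η_j⟩ - (∇η_j, e) = 0, and div Π¹τ is
affine; hence it is the L² projection of div τ, and its norm bound is the contraction property.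
Stability rests on 1/h_T ≤ |∇η_k| ≤ 1/r and on η_k ≥ 1/(2κ) in a half ball, which bounds every
denominator below by a multiple of |T|. For div Π²τ, the mean-free part τ - Π⁰τ makes the face
coefficients depend on div τ only, with a factor h_T that absorbs the 1/r from differentiating a
bubble.

No surface measure is used, so two facts replace boundary integrals. First, the duality depends on a
lift v only through its boundary values (`integral_mul_add_integral_inner_eq_zero`): a lift with
zero values is approximated by the test functions N⁻¹ Γ(N w), where w mollifies v and the truncation
Γ vanishes near 0. Second, a field tangential on ∂T has a divergence of mean zero
(`integral_div_eq_zero`); this gives all integrals of the basis functions that are needed. -/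

theorem eLpNorm_two_sq {α F : Type*} [MeasurableSpace α] [NormedAddCommGroup F]
    {μ : Measure α} (f : α → F) : eLpNorm f 2 μ ^ 2 = ∫⁻ x, ‖f x‖ₑ ^ 2 ∂μ := by
  have h := eLpNorm_nnreal_pow_eq_lintegral (μ := μ) (f := f) (p := 2) (by norm_num)
  simpa using h

/-- The maps x ↦ x - t preserve the measure and depend continuously on t in the compact-open
topology, and composition with such maps is continuous into L². -/
theorem exists_eLpNorm_translate_sub_le {n : ℕ} {F : Type*} [NormedAddCommGroup F]
    {f : EucN n → F} (hf : MemLp f 2 volume) {ε : ℝ≥0∞} (hε : ε ≠ 0) :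
    ∃ δ > 0, ∀ t, ‖t‖ < δ → eLpNorm (fun x => f (x - t) - f x) 2 volume ≤ ε := by
  have hmp : ∀ t : EucN n, MeasurePreserving (fun x : EucN n => x - t) volume volume :=
    fun t => measurePreserving_sub_right volume t
  let g : C(EucN n, C(EucN n, EucN n)) :=
    (ContinuousMap.mk (fun p : EucN n × EucN n => p.2 - p.1)
      (continuous_snd.sub continuous_fst)).curry
  have hc : Continuous fun t => Lp.compMeasurePreserving (g t) (hmp t) (hf.toLp f) :=
    (continuous_const (y := hf.toLp f)).compMeasurePreservingLp g.continuous hmp (by norm_num)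
  have h0 := EMetric.tendsto_nhds.1 (hc.tendsto 0) ε (pos_iff_ne_zero.2 hε)
  obtain ⟨δ, hδ, h⟩ := Metric.eventually_nhds_iff.1 h0
  refine ⟨δ, hδ, fun t ht => ?_⟩
  have h1 := (h (y := t) (by simpa using ht)).le
  rw [Lp.edist_def] at h1
  refine le_trans (le_of_eq (eLpNorm_congr_ae ?_)) h1
  have e1 := Lp.coeFn_compMeasurePreserving (hf.toLp f) (hmp t)
  have e2 := Lp.coeFn_compMeasurePreserving (hf.toLp f) (hmp 0)
  have e3 := hf.coeFn_toLp
  have e4 := (hmp t).quasiMeasurePreserving.ae_eq_comp e3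
  filter_upwards [e1, e2, e3, e4] with x h1 h2 h3 h4
  rw [Pi.sub_apply]
  erw [h1, h2]
  simp only [Function.comp_apply, sub_zero] at h4 ⊢
  rw [h4, h3]

/-- The kernel is a probability density, so ρ ⋆ f - f is an average of translation differences.
Monotonicity of L^p norms on a probability space (L¹ below L²) serves as Jensen's inequality
pointwise in x, and Tonelli moves the average outside the L² norm. -/
theorem eLpNorm_normed_convolution_sub_le {n : ℕ} {F : Type*} [NormedAddCommGroup F]
    [NormedSpace ℝ F] [CompleteSpace F] (φ : ContDiffBump (0 : EucN n))
    {f : EucN n → F} (hfm : StronglyMeasurable f) (hf : MemLp f 2 volume) {ε : ℝ≥0∞}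
    (hε : ∀ t, ‖t‖ < φ.rOut → eLpNorm (fun x => f (x - t) - f x) 2 volume ≤ ε) :
    eLpNorm (fun x => (φ.normed volume ⋆[ContinuousLinearMap.lsmul ℝ ℝ, volume] f) x - f x) 2
      volume ≤ ε := by
  set ρ := φ.normed (volume : Measure (EucN n)) with hρ
  have hρm : Measurable fun t => ENNReal.ofReal (ρ t) :=
    (φ.continuous_normed (μ := volume)).measurable.ennreal_ofReal
  have hρ1 : ∫⁻ t, ENNReal.ofReal (ρ t) = 1 := by
    rw [← ofReal_integral_eq_lintegral_ofReal φ.integrable_normed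
      (Eventually.of_forall φ.nonneg_normed), φ.integral_normed, ENNReal.ofReal_one]
  let μ : Measure (EucN n) := volume.withDensity fun t => ENNReal.ofReal (ρ t)
  have : IsProbabilityMeasure μ := ⟨by simp [μ, hρ1]⟩
  have hloc : LocallyIntegrable f volume :=
    hf.locallyIntegrable (by norm_num)
  have hm2 : StronglyMeasurable fun p : EucN n × EucN n => f (p.1 - p.2) - f p.1 :=
    (hfm.comp_measurable (measurable_fst.sub measurable_snd)).sub
      (hfm.comp_measurable measurable_fst)
  have hpt : ∀ x, ‖(ρ ⋆[ContinuousLinearMap.lsmul ℝ ℝ, volume] f) x - f x‖ₑ ^ 2 ≤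
      ∫⁻ t, ENNReal.ofReal (ρ t) * ‖f (x - t) - f x‖ₑ ^ 2 := by
    intro x
    have hmx : StronglyMeasurable fun t => f (x - t) - f x :=
      hm2.comp_measurable measurable_prodMk_left
    have hce : Integrable fun t => ρ t • f (x - t) :=
      (HasCompactSupport.convolutionExists_left (ContinuousLinearMap.lsmul ℝ ℝ)
        φ.hasCompactSupport_normed φ.continuous_normed hloc x)
    have e : (ρ ⋆[ContinuousLinearMap.lsmul ℝ ℝ, volume] f) x - f x =
        ∫ t, ρ t • (f (x - t) - f x) := by
      simp_rw [smul_sub]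
      rw [integral_sub hce (φ.integrable_normed.smul_const _), φ.integral_normed_smul,
        convolution_lsmul]
    have h1 : ‖(ρ ⋆[ContinuousLinearMap.lsmul ℝ ℝ, volume] f) x - f x‖ₑ ≤
        eLpNorm (fun t => f (x - t) - f x) 1 μ := by
      rw [e, eLpNorm_one_eq_lintegral_enorm,
        lintegral_withDensity_eq_lintegral_mul _ hρm hmx.enorm]
      refine (enorm_integral_le_lintegral_enorm _).trans (le_of_eq ?_)
      refine lintegral_congr fun t => ?_
      rw [enorm_smul, Pi.mul_apply, Real.enorm_of_nonneg (φ.nonneg_normed t)]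
    have h2 := h1.trans (eLpNorm_le_eLpNorm_of_exponent_le (by norm_num : (1 : ℝ≥0∞) ≤ 2)
      hmx.aestronglyMeasurable)
    calc _ ≤ eLpNorm (fun t => f (x - t) - f x) 2 μ ^ 2 := by gcongr
      _ = _ := by
        rw [eLpNorm_two_sq, lintegral_withDensity_eq_lintegral_mul _ hρm (hmx.enorm.pow_const 2)]
        rfl
  have hsq : eLpNorm (fun x => (ρ ⋆[ContinuousLinearMap.lsmul ℝ ℝ, volume] f) x - f x) 2
      volume ^ 2 ≤ ε ^ 2 := by
    rw [eLpNorm_two_sq]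
    calc _ ≤ ∫⁻ x, ∫⁻ t, ENNReal.ofReal (ρ t) * ‖f (x - t) - f x‖ₑ ^ 2 := lintegral_mono hpt
      _ = ∫⁻ t, ∫⁻ x, ENNReal.ofReal (ρ t) * ‖f (x - t) - f x‖ₑ ^ 2 :=
        lintegral_lintegral_swap
          ((hρm.comp measurable_snd).mul (hm2.enorm.pow_const 2)).aemeasurable
      _ ≤ ∫⁻ t, ENNReal.ofReal (ρ t) * ε ^ 2 := by
        refine lintegral_mono fun t => ?_
        have hmt : Measurable fun x => ‖f (x - t) - f x‖ₑ ^ 2 :=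
          (hm2.enorm.pow_const 2).comp measurable_prodMk_right
        simp only
        rw [lintegral_const_mul _ hmt, ← eLpNorm_two_sq]
        by_cases ht : ‖t‖ < φ.rOut
        · gcongr
          exact hε t ht
        · have : ρ t = 0 := by
            have : t ∉ Function.support ρ := by
              rw [hρ, φ.support_normed_eq]; simpa using ht
            simpa using this
          simp [this]
      _ = ε ^ 2 := by rw [lintegral_mul_const _ hρm, hρ1, one_mul]
  exact (ENNReal.pow_le_pow_left_iff two_ne_zero).1 hsq

end

/-! ### Smooth truncation and gradients of mollified functions -/

noncomputable section

open Filter Topology Set Metric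
open scoped ENNReal Convolution ContDiff

theorem continuous_gradient {n : ℕ} {f : EucN n → ℝ} (hf : ContDiff ℝ 1 f) :
    Continuous (gradient f) := by
  unfold gradient
  exact (LinearIsometryEquiv.continuous _).comp (hf.continuous_fderiv one_ne_zero)

theorem gradient_eq_of_fderiv {n : ℕ} {f : EucN n → ℝ} {x g : EucN n}
    (h : ∀ v, fderiv ℝ f x v = inner ℝ g v) : gradient f x = g :=
  ext_inner_right ℝ fun v => by rw [inner_gradient_left, h]

theorem integrable_inner_of_memLp {α F : Type*} [MeasurableSpace α] [NormedAddCommGroup F]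
    [InnerProductSpace ℝ F] {μ : Measure α} {f g : α → F} (hf : MemLp f 2 μ) (hg : MemLp g 2 μ) :
    Integrable (fun x => inner ℝ (f x) (g x)) μ :=
  (L2.integrable_inner (𝕜 := ℝ) (hf.toLp f) (hg.toLp g)).congr (by
    filter_upwards [hf.coeFn_toLp, hg.coeFn_toLp] with x h1 h2
    rw [h1, h2])

theorem abs_integral_inner_le {α F : Type*} [MeasurableSpace α] [NormedAddCommGroup F]
    [InnerProductSpace ℝ F] {μ : Measure α} {f g : α → F} (hf : MemLp f 2 μ) (hg : MemLp g 2 μ) :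
    |∫ x, inner ℝ (f x) (g x) ∂μ| ≤ (eLpNorm f 2 μ).toReal * (eLpNorm g 2 μ).toReal := by
  have e : ∫ x, inner ℝ (f x) (g x) ∂μ = inner ℝ (hf.toLp f) (hg.toLp g) := by
    rw [L2.inner_def]
    refine integral_congr_ae ?_
    filter_upwards [hf.coeFn_toLp, hg.coeFn_toLp] with x h1 h2
    rw [h1, h2]
  rw [e]
  refine (abs_real_inner_le_norm _ _).trans ?_
  rw [Lp.norm_toLp, Lp.norm_toLp]

/-- Γ(t) = t (1 - θ(t)) with a bump θ that is 1 on |t| ≤ 1 and 0 for |t| ≥ 2. As N → ∞, N⁻¹ Γ(N t)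
tends to t while its derivative stays bounded and tends to the indicator of t ≠ 0. -/
theorem exists_smooth_truncation : ∃ (Γ : ℝ → ℝ) (M : ℝ), ContDiff ℝ ∞ Γ ∧
    (∀ t, |deriv Γ t| ≤ M) ∧ (∀ t, |t| < 1 → Γ t = 0) ∧ (∀ t, 2 < |t| → Γ t = t) ∧
    (∀ t, |Γ t| ≤ |t|) ∧ (∀ t, |t| < 1 → deriv Γ t = 0) ∧ (∀ t, 2 < |t| → deriv Γ t = 1) := by
  let θ : ContDiffBump (0 : ℝ) := ⟨1, 2, by norm_num, by norm_num⟩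
  have hθ : ContDiff ℝ ∞ θ := θ.contDiff
  have hc : ContDiff ℝ ∞ fun t : ℝ => t * θ t := contDiff_id.mul hθ
  have hs : HasCompactSupport fun t : ℝ => t * θ t := θ.hasCompactSupport.mul_left
  obtain ⟨C, hC⟩ := hs.deriv.exists_bound_of_continuous (hc.continuous_deriv (by simp))
  have h0 : ∀ t : ℝ, |t| < 1 → t - t * θ t = 0 := fun t ht => by
    rw [θ.one_of_mem_closedBall (by simpa using ht.le)]; ring
  have h1 : ∀ t : ℝ, 2 < |t| → t - t * θ t = t := fun t ht => by
    rw [θ.zero_of_le_dist (by simpa using ht.le)]; ring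
  refine ⟨fun t => t - t * θ t, 1 + C, contDiff_id.sub hc, fun t => ?_, h0, h1, fun t => ?_,
    fun t ht => ?_, fun t ht => ?_⟩
  · have : deriv (fun t : ℝ => t - t * θ t) t = 1 - deriv (fun t : ℝ => t * θ t) t := by
      rw [deriv_fun_sub differentiableAt_fun_id (hc.differentiable (by simp) t)]
      simp
    rw [this]
    refine (abs_sub _ _).trans ?_
    rw [abs_one]
    gcongr
    exact hC t
  · have : t - t * θ t = t * (1 - θ t) := by ring
    simp only
    have h2 : 0 ≤ 1 - θ t := by linarith [θ.le_one (x := t)]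
    rw [this, abs_mul, abs_of_nonneg h2]
    exact mul_le_of_le_one_right (abs_nonneg _) (by linarith [θ.nonneg (x := t)])
  · have : (fun t : ℝ => t - t * θ t) =ᶠ[𝓝 t] fun _ => 0 := by
      filter_upwards [(isOpen_lt continuous_abs continuous_const).mem_nhds ht] with s hs
      exact h0 s hs
    rw [this.deriv_eq, deriv_const]
  · have : (fun t : ℝ => t - t * θ t) =ᶠ[𝓝 t] fun t => t := by
      filter_upwards [(isOpen_lt continuous_const continuous_abs).mem_nhds ht] with s hs
      exact h1 s hs
    rw [this.deriv_eq]
    exact deriv_id t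

theorem isTestFun_normed_comp_sub {n : ℕ} {T : Set (EucN n)} (φ : ContDiffBump (0 : EucN n))
    {x : EucN n} (hx : closedBall x φ.rOut ⊆ T) :
    IsTestFun T fun y => φ.normed volume (x - y) := by
  have hsupp : tsupport (fun y => φ.normed volume (x - y)) ⊆ closedBall x φ.rOut := by
    refine closure_minimal (fun y hy => ?_) isClosed_closedBall
    have : x - y ∈ Function.support (φ.normed volume) := hy
    rw [φ.support_normed_eq, mem_ball, dist_zero_right] at this
    rw [mem_closedBall, dist_comm, dist_eq_norm]
    exact this.le
  exact ⟨φ.contDiff_normed.comp (contDiff_const.sub contDiff_id),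
    HasCompactSupport.of_support_subset_isCompact (isCompact_closedBall x φ.rOut)
      ((subset_tsupport _).trans hsupp), hsupp.trans hx⟩

theorem gradient_comp_sub {n : ℕ} {f : EucN n → ℝ} (hf : Differentiable ℝ f) (x y : EucN n) :
    gradient (fun y => f (x - y)) y = -gradient f (x - y) := by
  refine gradient_eq_of_fderiv fun w => ?_
  have h1 : HasFDerivAt f (fderiv ℝ f (x - y)) (x - y) := (hf _).hasFDerivAt
  have h2 : HasFDerivAt (fun y : EucN n => x - y) (-ContinuousLinearMap.id ℝ (EucN n)) y :=
    (hasFDerivAt_id y).const_sub x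
  have h3 : HasFDerivAt (fun y => f (x - y)) _ y := h1.comp y h2
  rw [h3.fderiv, inner_neg_left, inner_gradient_left]
  simp

theorem fderiv_convolution_lsmul {n : ℕ} {ρ w : EucN n → ℝ} (hρc : ContDiff ℝ 1 ρ)
    (hρs : HasCompactSupport ρ) (hw : LocallyIntegrable w volume) (x e : EucN n) :
    fderiv ℝ (ρ ⋆[ContinuousLinearMap.lsmul ℝ ℝ, volume] w) x e =
      ∫ y, fderiv ℝ ρ (x - y) e * w y := by
  have hd := hρs.hasFDerivAt_convolution_left (ContinuousLinearMap.lsmul ℝ ℝ) hρc hw x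
  have hex := (hρs.fderiv ℝ).convolutionExists_left
      ((ContinuousLinearMap.lsmul ℝ ℝ : ℝ →L[ℝ] ℝ →L[ℝ] ℝ).precompL (EucN n))
      (hρc.continuous_fderiv (by simp)) hw x
  have e1 : ∀ t, ((ContinuousLinearMap.lsmul ℝ ℝ : ℝ →L[ℝ] ℝ →L[ℝ] ℝ).precompL (EucN n)
      (fderiv ℝ ρ t) (w (x - t))) e = fderiv ℝ ρ t e * w (x - t) := by
    intro t
    simp [ContinuousLinearMap.precompL_apply]
  rw [hd.fderiv, convolution_def, ContinuousLinearMap.integral_apply hex]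
  simp_rw [e1]
  rw [← integral_sub_left_eq_self (fun t => fderiv ℝ ρ t e * w (x - t)) volume x]
  simp only [sub_sub_cancel]

/-- When the ball about x lies in T, y ↦ ρ(x - y) is an admissible test function. The minus sign in
the definition of the weak gradient cancels the one from differentiating in y instead of x. -/
theorem gradient_normed_convolution {n : ℕ} {T : Set (EucN n)} (hT : IsOpen T)
    {v : EucN n → ℝ} {g : EucN n → EucN n}
    (hloc : LocallyIntegrable (T.indicator v) volume)
    (hvg : HasWeakGrad T v g) (φ : ContDiffBump (0 : EucN n)) {x : EucN n}
    (hx : closedBall x φ.rOut ⊆ T) :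
    gradient (φ.normed volume ⋆[ContinuousLinearMap.lsmul ℝ ℝ, volume] (T.indicator v)) x =
      (φ.normed volume ⋆[ContinuousLinearMap.lsmul ℝ ℝ, volume] (T.indicator g)) x := by
  set ρ := φ.normed (volume : Measure (EucN n)) with hρ
  have hρc : ContDiff ℝ ∞ ρ := φ.contDiff_normed
  have hρs : HasCompactSupport ρ := φ.hasCompactSupport_normed
  have hψt : IsTestFun T fun y => ρ (x - y) := isTestFun_normed_comp_sub φ hx
  have hfd : ∀ y, gradient (fun y => ρ (x - y)) y = -gradient ρ (x - y) :=
    gradient_comp_sub (hρc.differentiable (by simp)) x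
  refine gradient_eq_of_fderiv fun e => ?_
  have hvint : Integrable (fun y => v y • gradient (fun y => ρ (x - y)) y) (volume.restrict T) := by
    have h1 : Integrable (fun y => T.indicator v y • gradient (fun y => ρ (x - y)) y) volume := by
      refine hloc.integrable_smul_right_of_hasCompactSupport (continuous_gradient
        (hψt.1.of_le (by simp))) ?_
      exact (hψt.2.1.fderiv ℝ).comp_left (map_zero _)
    refine (h1.restrict (s := T)).congr ?_
    filter_upwards [ae_restrict_mem hT.measurableSet] with y hy
    rw [indicator_of_mem hy]
  rw [fderiv_convolution_lsmul (hρc.of_le (by simp)) hρs hloc, convolution_eq_swap]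
  have e2 : ∀ y, fderiv ℝ ρ (x - y) e * T.indicator v y =
      T.indicator (fun y => inner ℝ e (-(v y • gradient (fun y => ρ (x - y)) y))) y := by
    intro y
    by_cases hy : y ∈ T
    · rw [indicator_of_mem hy, indicator_of_mem hy, hfd, smul_neg, neg_neg, inner_smul_right,
        inner_gradient_right, conj_trivial, mul_comm]
    · rw [indicator_of_notMem hy, indicator_of_notMem hy, mul_zero]
  have e3 : ∀ y, (ContinuousLinearMap.lsmul ℝ ℝ) (ρ (x - y)) (T.indicator g y) =
      T.indicator (fun y => ρ (x - y) • g y) y := by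
    intro y
    by_cases hy : y ∈ T
    · simp [indicator_of_mem hy]
    · simp [indicator_of_notMem hy]
  simp_rw [e2, e3]
  simp_rw [inner_neg_right]
  rw [integral_indicator hT.measurableSet, integral_indicator hT.measurableSet, integral_neg,
    integral_inner hvint, hvg.2 _ hψt, inner_neg_right, neg_neg, real_inner_comm]

end

/-! ### Integration by parts against a lift with zero boundary values -/

noncomputable section

open Filter Topology Set Metric
open scoped ENNReal Convolution ContDiff

/-- The zero extension u of v is continuous, so it is small near ∂T; truncating its mollification w
at height 1/N gives a function with compact support in T, without any regularity of ∂T. On that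
support w has the gradient G, the mollification of the weak gradient. -/
theorem exists_testFun_approx {n : ℕ} {T : Set (EucN n)} (hT : IsOpen T)
    (hTb : Bornology.IsBounded T) {v : EucN n → ℝ} {g : EucN n → EucN n}
    (hvc : ContinuousOn v (closure T)) (hv0 : ∀ x ∈ frontier T, v x = 0)
    (hvg : HasWeakGrad T v g) (hgm : StronglyMeasurable g) {Γ : ℝ → ℝ} (hΓ : ContDiff ℝ ∞ Γ)
    (hΓ0 : ∀ t, |t| < 1 → Γ t = 0) (hΓ0' : ∀ t, |t| < 1 → deriv Γ t = 0)
    {N : ℝ} (hN : 0 < N) {ε : ℝ≥0∞} (hε : ε ≠ 0)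
    (hεt : ε ≠ ⊤) :
    ∃ (w : EucN n → ℝ) (G : EucN n → EucN n), Continuous w ∧ MemLp G 2 volume ∧
      IsTestFun T (fun x => N⁻¹ * Γ (N * w x)) ∧
      (∀ x, gradient (fun x => N⁻¹ * Γ (N * w x)) x = deriv Γ (N * w x) • G x) ∧
      (∀ x, |w x - T.indicator v x| ≤ 1 / (4 * N)) ∧
      eLpNorm (fun x => G x - T.indicator g x) 2 volume ≤ ε := by
  set u := T.indicator v with hu
  have huc : Continuous u := continuous_indicator hv0 hvc
  have hus : HasCompactSupport u :=
    HasCompactSupport.intro hTb.isCompact_closure fun x hx =>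
      indicator_of_notMem (fun h => hx (subset_closure h)) _
  have huloc : LocallyIntegrable u volume := huc.locallyIntegrable
  obtain ⟨δ₁, hδ₁, h1⟩ := Metric.uniformContinuous_iff.1
    (hus.uniformContinuous_of_continuous huc) (1 / (4 * N)) (by positivity)
  let K : Set (EucN n) := {x | 1 / (2 * N) ≤ |u x|}
  have hKT : K ⊆ T := fun x hx => by
    by_contra h
    have h2 : 1 / (2 * N) ≤ |u x| := hx
    rw [hu, indicator_of_notMem h, abs_zero] at h2
    have : 0 < 1 / (2 * N) := by positivity
    linarith
  have hKc : IsCompact K := by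
    refine hus.isCompact.of_isClosed_subset (isClosed_le continuous_const huc.abs) ?_
    intro x hx
    refine subset_tsupport _ fun h => ?_
    have h2 : 1 / (2 * N) ≤ |u x| := hx
    rw [h, abs_zero] at h2
    have : 0 < 1 / (2 * N) := by positivity
    linarith
  obtain ⟨δ₂, hδ₂, h2⟩ := hKc.exists_cthickening_subset_open hT hKT
  have hgL : MemLp (T.indicator g) 2 volume := (memLp_indicator_iff_restrict hT.measurableSet).2 hvg.1
  obtain ⟨δ₃, hδ₃, h3⟩ := exists_eLpNorm_translate_sub_le hgL hε
  let δ := min δ₁ (min δ₂ δ₃)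
  have hδ : 0 < δ := lt_min hδ₁ (lt_min hδ₂ hδ₃)
  let φ : ContDiffBump (0 : EucN n) := ⟨δ / 2, δ, half_pos hδ, half_lt_self hδ⟩
  set w := (φ.normed volume ⋆[ContinuousLinearMap.lsmul ℝ ℝ, volume] u) with hw
  set G := (φ.normed volume ⋆[ContinuousLinearMap.lsmul ℝ ℝ, volume] (T.indicator g)) with hG
  have hwd : ContDiff ℝ ∞ w :=
    φ.hasCompactSupport_normed.contDiff_convolution_left _ φ.contDiff_normed huloc
  have hGc : Continuous G :=
    φ.hasCompactSupport_normed.continuous_convolution_left _ φ.continuous_normed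
      (hgL.locallyIntegrable (by norm_num))
  have hGs : eLpNorm (fun x => G x - T.indicator g x) 2 volume ≤ ε :=
    eLpNorm_normed_convolution_sub_le φ (hgm.indicator hT.measurableSet) hgL fun t ht =>
      h3 t (ht.trans_le ((min_le_right _ _).trans (min_le_right _ _)))
  have hwu : ∀ x, |w x - u x| ≤ 1 / (4 * N) := fun x => by
    rw [← Real.dist_eq]
    refine φ.dist_normed_convolution_le huc.aestronglyMeasurable fun y hy => ?_
    exact (h1 (lt_of_lt_of_le (mem_ball.1 hy) (min_le_left _ _))).le
  -- With |w - u| ≤ 1/(4N), the bound N|w| ≥ 1 leaves N|u| ≥ 3/4, above the threshold 1/2 of K.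
  have hK : ∀ x, 1 ≤ |N * w x| → x ∈ K := fun x hx => by
    have e : N * (1 / (4 * N)) = 1 / 4 := by field_simp
    have e' : N * (1 / (2 * N)) = 1 / 2 := by field_simp
    rw [abs_mul, abs_of_pos hN] at hx
    have h5 : N * |w x - u x| ≤ 1 / 4 := e ▸ mul_le_mul_of_nonneg_left (hwu x) hN.le
    have h6 : |w x| ≤ |w x - u x| + |u x| := by
      have := abs_add_le (w x - u x) (u x)
      simpa using this
    have h7 := mul_le_mul_of_nonneg_left h6 hN.le
    refine le_of_mul_le_mul_left ?_ hN
    rw [e']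
    linarith
  have hφd : ContDiff ℝ ∞ fun x => N⁻¹ * Γ (N * w x) :=
    contDiff_const.mul (hΓ.comp (contDiff_const.mul hwd))
  have hsupp : Function.support (fun x => N⁻¹ * Γ (N * w x)) ⊆ K := fun x hx => by
    refine hK x (not_lt.1 fun h => hx ?_)
    simp [hΓ0 _ h]
  refine ⟨w, G, hwd.continuous, ?_, ⟨hφd, ?_, ?_⟩, fun x => ?_, hwu, hGs⟩
  · have : MemLp (fun x => G x - T.indicator g x) 2 volume :=
      ⟨hGc.aestronglyMeasurable.sub hgL.1, lt_of_le_of_lt hGs (lt_top_iff_ne_top.2 hεt)⟩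
    exact (this.add hgL).congr_norm hGc.aestronglyMeasurable (Eventually.of_forall fun x => by simp)
  · exact HasCompactSupport.of_support_subset_isCompact hKc hsupp
  · exact (closure_minimal hsupp hKc.isClosed).trans hKT
  · have hfd : HasFDerivAt (fun x => N⁻¹ * Γ (N * w x))
        (N⁻¹ • (deriv Γ (N * w x) • (N • fderiv ℝ w x))) x :=
      (((hΓ.differentiable (by simp) _).hasDerivAt).comp_hasFDerivAt x
        (((hwd.differentiable (by simp) x).hasFDerivAt).const_mul N)).const_mul N⁻¹
    refine gradient_eq_of_fderiv fun e => ?_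
    rw [hfd.fderiv]
    -- Near ∂T, G need not be the gradient of w, but there Γ' vanishes; elsewhere x lies in K, and
    -- the mollification radius is smaller than the distance that keeps balls inside T.
    by_cases hx : |N * w x| < 1
    · simp [hΓ0' _ hx]
    · have hxK := hK x (not_lt.1 hx)
      have hball : closedBall x φ.rOut ⊆ T :=
        (closedBall_subset_closedBall ((min_le_right _ _).trans (min_le_left _ _))).trans
          ((closedBall_subset_cthickening hxK δ₂).trans h2)
      rw [hG, ← gradient_normed_convolution hT huloc hvg φ hball, inner_smul_left,
        inner_gradient_left]
      simp only [FunLike.coe_smul, Pi.smul_apply, smul_eq_mul, conj_trivial]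
      rw [← hu, ← hw]
      field_simp

/-- Pass to the limit in the definition of the weak divergence with the truncated mollifications.
The indicator of v ≠ 0 is the limit of Γ'((k + 1) w_k). -/
theorem integral_mul_add_integral_inner_indicator {n : ℕ} {T : Set (EucN n)} (hT : IsOpen T)
    (hTb : Bornology.IsBounded T) {τ : EucN n → EucN n} {d : EucN n → ℝ}
    (hτ : MemLp τ 2 (volume.restrict T)) (hd : HasWeakDiv T τ d)
    {v : EucN n → ℝ} {g : EucN n → EucN n}
    (hvc : ContinuousOn v (closure T)) (hv0 : ∀ x ∈ frontier T, v x = 0)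
    (hvg : HasWeakGrad T v g) (hgm : StronglyMeasurable g) :
    (∫ x in T, d x * v x) + ∫ x in T, inner ℝ (τ x) ({y | v y ≠ 0}.indicator g x) = 0 := by
  obtain ⟨Γ, M, hΓ, hM, hΓ0, hΓ1, hΓle, hΓ0', hΓ1'⟩ := exists_smooth_truncation
  have hfin : IsFiniteMeasure (volume.restrict T) := ⟨by simpa using hTb.measure_lt_top⟩
  have hN : ∀ k : ℕ, (0 : ℝ) < k + 1 := fun k => by positivity
  choose w G hwc hGL htest hgrad hwv hGg using fun k : ℕ =>
    exists_testFun_approx hT hTb hvc hv0 hvg hgm hΓ hΓ0 hΓ0' (hN k)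
      (ε := ((k : ℝ≥0∞) + 1)⁻¹) (by simp) (by simp)
  have hM0 : 0 ≤ M := (abs_nonneg _).trans (hM 0)
  obtain ⟨B, hB⟩ := hTb.isCompact_closure.exists_bound_of_continuousOn hvc
  have hwT : ∀ k, ∀ x ∈ T, |w k x - v x| ≤ 1 / (4 * ((k : ℝ) + 1)) := fun k x hx => by
    have := hwv k x
    rwa [indicator_of_mem hx] at this
  have hq : ∀ k : ℕ, 1 / (4 * ((k : ℝ) + 1)) ≤ 1 := fun k => by
    rw [div_le_one (by positivity)]
    have : (0 : ℝ) ≤ k := by positivity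
    linarith
  have hsmall : ∀ (k : ℕ), ∀ x ∈ T, v x = 0 → |((k : ℝ) + 1) * w k x| < 1 := fun k x hx h0 => by
    have h := hwT k x hx
    rw [h0, sub_zero, le_div_iff₀ (by have := hN k; positivity)] at h
    rw [abs_mul, abs_of_pos (hN k)]
    linarith
  have hlarge : ∀ x ∈ T, v x ≠ 0 → ∀ᶠ k : ℕ in atTop, 2 < |((k : ℝ) + 1) * w k x| := by
    intro x hx h0
    have hv : 0 < |v x| := abs_pos.2 h0
    -- Then (k + 1)|w| ≥ (k + 1)|v| - 1/4 ≥ 3 - 1/4, which exceeds the height 2 beyond which Γ is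
    -- the identity.
    filter_upwards [tendsto_natCast_atTop_atTop.eventually_ge_atTop (3 / |v x|)] with k hk
    have h := hwT k x hx
    rw [le_div_iff₀ (by have := hN k; positivity)] at h
    rw [div_le_iff₀ hv] at hk
    rw [abs_mul, abs_of_pos (hN k)]
    have h6 : |v x| ≤ |w k x - v x| + |w k x| := by
      have := abs_sub (w k x) (w k x - v x)
      rw [sub_sub_cancel] at this
      linarith
    have := mul_le_mul_of_nonneg_left h6 (hN k).le
    nlinarith
  have hΓm : ∀ k : ℕ, Continuous fun x => deriv Γ (((k : ℝ) + 1) * w k x) := fun k =>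
    (hΓ.continuous_deriv (by simp)).comp (continuous_const.mul (hwc k))
  have hdint : Integrable d (volume.restrict T) := hd.1.integrable (by norm_num)
  have L1 : Tendsto (fun k : ℕ => ∫ x in T, d x * (((k : ℝ) + 1)⁻¹ * Γ (((k : ℝ) + 1) * w k x)))
      atTop (𝓝 (∫ x in T, d x * v x)) := by
    refine tendsto_integral_of_dominated_convergence (fun x => |d x| * (B + 1)) (fun k => ?_)
      (hdint.abs.mul_const _) (fun k => ?_) ?_
    · exact hd.1.1.mul (continuous_const.mul (hΓ.continuous.comp
        (continuous_const.mul (hwc k)))).aestronglyMeasurable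
    · filter_upwards [ae_restrict_mem hT.measurableSet] with x hx
      rw [Real.norm_eq_abs, abs_mul]
      gcongr
      rw [abs_mul, abs_inv, abs_of_pos (hN k)]
      have h1 := hΓle (((k : ℝ) + 1) * w k x)
      rw [abs_mul, abs_of_pos (hN k)] at h1
      rw [inv_mul_le_iff₀ (hN k)]
      refine h1.trans (mul_le_mul_of_nonneg_left ?_ (hN k).le)
      have h2 := hB x (subset_closure hx)
      rw [Real.norm_eq_abs] at h2
      have h3 := (hwT k x hx).trans (hq k)
      have := abs_add_le (w k x - v x) (v x)
      rw [sub_add_cancel] at this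
      linarith
    · filter_upwards [ae_restrict_mem hT.measurableSet] with x hx
      refine Tendsto.const_mul _ ?_
      by_cases h0 : v x = 0
      · rw [h0]
        refine tendsto_const_nhds.congr fun k => ?_
        rw [hΓ0 _ (hsmall k x hx h0), mul_zero]
      · have hlim : Tendsto (fun k => w k x) atTop (𝓝 (v x)) := by
          rw [tendsto_iff_norm_sub_tendsto_zero]
          refine squeeze_zero (fun _ => norm_nonneg _) (fun k => hwT k x hx) ?_
          have := (tendsto_one_div_add_atTop_nhds_zero_nat (𝕜 := ℝ)).const_mul (1 / 4)
          rw [mul_zero] at this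
          refine this.congr fun k => ?_
          have := hN k
          field_simp
        refine hlim.congr' ?_
        filter_upwards [hlarge x hx h0] with k hk
        rw [hΓ1 _ hk, inv_mul_cancel_left₀ (hN k).ne']
  have hτg : Integrable (fun x => ‖τ x‖ * ‖g x‖) (volume.restrict T) := hτ.norm.integrable_mul hvg.1.norm
  have hFm : ∀ k : ℕ, AEStronglyMeasurable
      (fun x => inner ℝ (τ x) (deriv Γ (((k : ℝ) + 1) * w k x) • g x)) (volume.restrict T) :=
    fun k => hτ.1.inner ((hΓm k).aestronglyMeasurable.smul hgm.aestronglyMeasurable)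
  have hFb : ∀ (k : ℕ) x, ‖(inner ℝ (τ x) (deriv Γ (((k : ℝ) + 1) * w k x) • g x) : ℝ)‖ ≤
      M * (‖τ x‖ * ‖g x‖) := fun k x => by
    refine (norm_inner_le_norm _ _).trans ?_
    rw [norm_smul]
    calc _ ≤ ‖τ x‖ * (M * ‖g x‖) := by gcongr; exact hM _
      _ = _ := by ring
  have L2 : Tendsto (fun k : ℕ => ∫ x in T, inner ℝ (τ x)
      (deriv Γ (((k : ℝ) + 1) * w k x) • g x)) atTop
      (𝓝 (∫ x in T, inner ℝ (τ x) ({y | v y ≠ 0}.indicator g x))) := by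
    refine tendsto_integral_of_dominated_convergence _ hFm (hτg.const_mul M)
      (fun k => Eventually.of_forall (hFb k)) ?_
    filter_upwards [ae_restrict_mem hT.measurableSet] with x hx
    by_cases h0 : v x = 0
    · rw [indicator_of_notMem (by simpa using h0)]
      refine tendsto_const_nhds.congr fun k => ?_
      rw [hΓ0' _ (hsmall k x hx h0), zero_smul]
    · rw [indicator_of_mem (by simpa using h0)]
      refine tendsto_const_nhds.congr' ?_
      filter_upwards [hlarge x hx h0] with k hk
      rw [hΓ1' _ hk, one_smul]
  have hdL : ∀ k, MemLp (fun x => G k x - g x) 2 (volume.restrict T) := fun k =>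
    ((hGL k).restrict T).sub hvg.1
  -- The error from replacing G by g is at most M ‖τ‖ ‖G - g‖ by Cauchy–Schwarz, and G was chosen
  -- within 1/(k + 1) of g.
  have L3 : Tendsto (fun k : ℕ => ∫ x in T, inner ℝ (τ x)
      (deriv Γ (((k : ℝ) + 1) * w k x) • (G k x - g x))) atTop (𝓝 0) := by
    rw [tendsto_zero_iff_norm_tendsto_zero]
    have hlim : Tendsto (fun k : ℕ => M * ((eLpNorm τ 2 (volume.restrict T)).toReal *
        (1 / ((k : ℝ) + 1)))) atTop (𝓝 0) := by
      have := ((tendsto_one_div_add_atTop_nhds_zero_nat (𝕜 := ℝ)).const_mul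
        (eLpNorm τ 2 (volume.restrict T)).toReal).const_mul M
      simpa using this
    refine squeeze_zero (fun _ => norm_nonneg _) (fun k => ?_) hlim
    have h1 : ‖∫ x in T, inner ℝ (τ x) (deriv Γ (((k : ℝ) + 1) * w k x) • (G k x - g x))‖ ≤
        ∫ x in T, M * (inner ℝ ‖τ x‖ ‖G k x - g x‖ : ℝ) := by
      refine norm_integral_le_of_norm_le
        ((integrable_inner_of_memLp hτ.norm (hdL k).norm).const_mul M)
        (Eventually.of_forall fun x => ?_)
      refine (norm_inner_le_norm _ _).trans ?_
      rw [norm_smul]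
      calc _ ≤ ‖τ x‖ * (M * ‖G k x - g x‖) := by gcongr; exact hM _
        _ = _ := by simp; ring
    refine h1.trans ?_
    rw [integral_const_mul]
    gcongr
    refine ((le_abs_self _).trans (abs_integral_inner_le hτ.norm (hdL k).norm)).trans ?_
    rw [eLpNorm_norm, eLpNorm_norm]
    gcongr
    have h2 : eLpNorm (fun x => G k x - g x) 2 (volume.restrict T) ≤ ((k : ℝ≥0∞) + 1)⁻¹ := by
      refine le_trans ?_ ((eLpNorm_restrict_le _ _ _ T).trans (hGg k))
      refine le_of_eq (eLpNorm_congr_ae ?_)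
      filter_upwards [ae_restrict_mem hT.measurableSet] with x hx
      rw [indicator_of_mem hx]
    refine (ENNReal.toReal_mono (by simp) h2).trans (le_of_eq ?_)
    rw [ENNReal.toReal_inv, ENNReal.toReal_add (by simp) (by simp)]
    simp
  have key : ∀ k : ℕ, (∫ x in T, inner ℝ (τ x) (deriv Γ (((k : ℝ) + 1) * w k x) • g x)) +
      ∫ x in T, inner ℝ (τ x) (deriv Γ (((k : ℝ) + 1) * w k x) • (G k x - g x)) =
      -∫ x in T, d x * (((k : ℝ) + 1)⁻¹ * Γ (((k : ℝ) + 1) * w k x)) := fun k => by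
    rw [← hd.2 _ (htest k), ← integral_add]
    · refine integral_congr_ae (Eventually.of_forall fun x => ?_)
      simp only
      rw [hgrad, ← inner_add_right, ← smul_add, add_sub_cancel]
    · exact (hτg.const_mul M).mono' (hFm k) (Eventually.of_forall (hFb k))
    · refine integrable_inner_of_memLp hτ ?_
      refine MemLp.of_le_mul (c := M) (hdL k)
        ((hΓm k).aestronglyMeasurable.smul (hdL k).1) (Eventually.of_forall fun x => ?_)
      rw [norm_smul]
      gcongr
      exact hM _
  have := tendsto_nhds_unique ((L2.add L3).congr key) L1.neg
  linarith

end

/-! ### Calculus of weak derivatives and independence of the lift -/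

noncomputable section

open Filter Topology Set Metric
open scoped ENNReal Convolution ContDiff

theorem integrable_smul_of_memLp {α F : Type*} [MeasurableSpace α] [NormedAddCommGroup F]
    [NormedSpace ℝ F] {μ : Measure α} {φ : α → ℝ} {f : α → F} (hφ : MemLp φ 2 μ)
    (hf : MemLp f 2 μ) : Integrable (fun x => φ x • f x) μ :=
  memLp_one_iff_integrable.1 (hf.smul hφ)

theorem integrable_mul_of_memLp {α : Type*} [MeasurableSpace α] {μ : Measure α} {f g : α → ℝ}
    (hf : MemLp f 2 μ) (hg : MemLp g 2 μ) : Integrable (fun x => f x * g x) μ :=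
  hf.integrable_mul hg

theorem isFiniteMeasure_restrict_of_isBounded {n : ℕ} {T : Set (EucN n)}
    (hTb : Bornology.IsBounded T) : IsFiniteMeasure (volume.restrict T) :=
  ⟨by simpa using hTb.measure_lt_top⟩

theorem ae_eq_of_forall_isTestFun {n : ℕ} {T : Set (EucN n)} (hT : IsOpen T)
    (hTb : Bornology.IsBounded T) {F : Type*} [NormedAddCommGroup F] [NormedSpace ℝ F]
    [CompleteSpace F] {f g : EucN n → F} (hf : MemLp f 2 (volume.restrict T))
    (hg : MemLp g 2 (volume.restrict T))
    (h : ∀ φ, IsTestFun T φ → ∫ x in T, φ x • f x = ∫ x in T, φ x • g x) :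
    f =ᵐ[volume.restrict T] g := by
  have := isFiniteMeasure_restrict_of_isBounded hTb
  have hfi := hf.integrable (by norm_num)
  have hgi := hg.integrable (by norm_num)
  have hz := hT.ae_eq_zero_of_integral_contDiff_smul_eq_zero (μ := volume) (f := f - g)
    (IntegrableOn.locallyIntegrableOn (hfi.sub hgi)) (fun φ h1 h2 h3 => by
      have hb := h φ ⟨h1, h2, h3⟩
      obtain ⟨C, hC⟩ := h2.exists_bound_of_continuous h1.continuous
      rw [← setIntegral_eq_integral_of_forall_compl_eq_zero (s := T)]
      · simp only [Pi.sub_apply, smul_sub]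
        rw [integral_sub, hb, sub_self]
        · exact hfi.bdd_smul C h1.continuous.aestronglyMeasurable (Eventually.of_forall hC)
        · exact hgi.bdd_smul C h1.continuous.aestronglyMeasurable (Eventually.of_forall hC)
      · intro x hx
        rw [image_eq_zero_of_notMem_tsupport (fun h => hx (h3 h)), zero_smul])
  rw [Filter.EventuallyEq, ae_restrict_iff' hT.measurableSet]
  filter_upwards [hz] with x hx hxT
  exact sub_eq_zero.1 (hx hxT)

theorem HasWeakDiv.ae_unique {n : ℕ} {T : Set (EucN n)} (hT : IsOpen T)
    (hTb : Bornology.IsBounded T) {τ : EucN n → EucN n} {d e : EucN n → ℝ}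
    (hd : HasWeakDiv T τ d) (he : HasWeakDiv T τ e) : d =ᵐ[volume.restrict T] e :=
  ae_eq_of_forall_isTestFun hT hTb hd.1 he.1 fun φ hφ => by
    have h := (hd.2 φ hφ).symm.trans (he.2 φ hφ)
    simpa [mul_comm] using h

theorem HasWeakGrad.ae_unique {n : ℕ} {T : Set (EucN n)} (hT : IsOpen T)
    (hTb : Bornology.IsBounded T) {v : EucN n → ℝ} {d e : EucN n → EucN n}
    (hd : HasWeakGrad T v d) (he : HasWeakGrad T v e) : d =ᵐ[volume.restrict T] e :=
  ae_eq_of_forall_isTestFun hT hTb hd.1 he.1 fun φ hφ => by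
    have h := (hd.2 φ hφ).symm.trans (he.2 φ hφ)
    simpa using h

theorem HasWeakGrad.congr {n : ℕ} {T : Set (EucN n)} {v : EucN n → ℝ} {d e : EucN n → EucN n}
    (hd : HasWeakGrad T v d) (h : d =ᵐ[volume.restrict T] e) : HasWeakGrad T v e :=
  ⟨(memLp_congr_ae h).1 hd.1, fun φ hφ => by
    rw [hd.2 φ hφ]
    refine congrArg _ (integral_congr_ae ?_)
    filter_upwards [h] with x hx
    rw [hx]⟩

theorem IsTestFun.memLp_gradient {n : ℕ} {T : Set (EucN n)} {φ : EucN n → ℝ}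
    (h : IsTestFun T φ) : MemLp (gradient φ) 2 volume := by
  refine (continuous_gradient (h.1.of_le (by simp))).memLp_of_hasCompactSupport ?_
  exact (h.2.1.fderiv ℝ).comp_left (map_zero _)

theorem IsTestFun.memLp {n : ℕ} {T : Set (EucN n)} {φ : EucN n → ℝ}
    (h : IsTestFun T φ) : MemLp φ 2 volume :=
  h.1.continuous.memLp_of_hasCompactSupport h.2.1

theorem integral_mul_isTestFun {n : ℕ} {T : Set (EucN n)} {φ : EucN n → ℝ} (h : IsTestFun T φ)
    {f : EucN n → ℝ} (hf : ContDiff ℝ 1 f) (e : EucN n) :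
    ∫ x in T, f x * fderiv ℝ φ x e = -∫ x in T, fderiv ℝ f x e * φ x := by
  have hφd : ∀ x ∉ T, fderiv ℝ φ x e = 0 := fun x hx => by
    rw [image_eq_zero_of_notMem_tsupport
      (fun h' => hx (h.2.2 (tsupport_fderiv_subset ℝ h'))), zero_apply]
  have hφ0 : ∀ x ∉ T, φ x = 0 := fun x hx =>
    image_eq_zero_of_notMem_tsupport (fun h' => hx (h.2.2 h'))
  have hφ1 : ContDiff ℝ 1 φ := h.1.of_le (by simp)
  have hc1 : Continuous fun x => fderiv ℝ φ x e :=
    (hφ1.continuous_fderiv one_ne_zero).clm_apply continuous_const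
  have hc2 : Continuous fun x => fderiv ℝ f x e :=
    (hf.continuous_fderiv one_ne_zero).clm_apply continuous_const
  have hs1 : HasCompactSupport fun x => fderiv ℝ φ x e := h.2.1.fderiv_apply ℝ e
  rw [setIntegral_eq_integral_of_forall_compl_eq_zero (fun x hx => by rw [hφd x hx, mul_zero]),
    setIntegral_eq_integral_of_forall_compl_eq_zero (fun x hx => by rw [hφ0 x hx, mul_zero])]
  refine integral_mul_fderiv_eq_neg_fderiv_mul_of_integrable ?_ ?_ ?_ (fun x _ => hf.differentiable one_ne_zero x)
    (fun x _ => hφ1.differentiable one_ne_zero x)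
  · exact (hc2.mul h.1.continuous).integrable_of_hasCompactSupport h.2.1.mul_left
  · exact (hf.continuous.mul hc1).integrable_of_hasCompactSupport hs1.mul_left
  · exact (hf.continuous.mul h.1.continuous).integrable_of_hasCompactSupport h.2.1.mul_left

theorem memLp_of_continuous_of_isBounded {n : ℕ} {T : Set (EucN n)}
    (hTb : Bornology.IsBounded T) {F : Type*} [NormedAddCommGroup F]
    {f : EucN n → F} (hf : Continuous f) :
    MemLp f 2 (volume.restrict T) := by
  have := isFiniteMeasure_restrict_of_isBounded hTb
  obtain ⟨C, hC⟩ := hTb.isCompact_closure.exists_bound_of_continuousOn hf.continuousOn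
  have h : ∀ᵐ x ∂(volume.restrict T), ‖f x‖ ≤ C := by
    have h1 : ∀ᵐ x ∂(volume.restrict (closure T)), ‖f x‖ ≤ C := by
      filter_upwards [ae_restrict_mem isClosed_closure.measurableSet] with x hx using hC x hx
    exact ae_mono (Measure.restrict_mono_set _ subset_closure) h1
  exact MemLp.of_bound hf.aestronglyMeasurable C h

theorem hasWeakDiv_smul_const {n : ℕ} {T : Set (EucN n)} (hTb : Bornology.IsBounded T)
    {f : EucN n → ℝ} (hf : ContDiff ℝ 1 f) (c : EucN n) :
    HasWeakDiv T (fun x => f x • c) (fun x => fderiv ℝ f x c) := by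
  refine ⟨memLp_of_continuous_of_isBounded hTb
    ((hf.continuous_fderiv one_ne_zero).clm_apply continuous_const), fun φ hφ => ?_⟩
  rw [← integral_mul_isTestFun hφ hf c]
  simp_rw [inner_smul_left, inner_gradient_right, conj_trivial]

theorem hasWeakGrad_of_contDiff {n : ℕ} {T : Set (EucN n)} (hTb : Bornology.IsBounded T)
    {f : EucN n → ℝ} (hf : ContDiff ℝ 1 f) : HasWeakGrad T f (gradient f) := by
  have hg := memLp_of_continuous_of_isBounded hTb (continuous_gradient hf)
  refine ⟨hg, fun φ hφ => ext_inner_left ℝ fun e => ?_⟩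
  have hf2 := memLp_of_continuous_of_isBounded hTb hf.continuous
  rw [inner_neg_right, ← integral_inner, ← integral_inner]
  · simp_rw [inner_smul_right, inner_gradient_right, conj_trivial]
    rw [integral_mul_isTestFun hφ hf e]
    simp_rw [mul_comm]
  · exact (integrable_smul_of_memLp (hφ.memLp.restrict T) hg)
  · exact (integrable_smul_of_memLp hf2 (hφ.memLp_gradient.restrict T))

theorem memH1_of_contDiff {n : ℕ} {T : Set (EucN n)} (hTb : Bornology.IsBounded T)
    {f : EucN n → ℝ} (hf : ContDiff ℝ 1 f) : MemH1 T f :=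
  ⟨memLp_of_continuous_of_isBounded hTb hf.continuous, _, hasWeakGrad_of_contDiff hTb hf⟩

/-- It remains to remove the indicator of v ≠ 0, that is, to see that the weak gradient vanishes
almost everywhere on v = 0. The version with the indicator already implies this, by duality. -/
theorem integral_mul_add_integral_inner_eq_zero {n : ℕ} {T : Set (EucN n)} (hT : IsOpen T)
    (hTb : Bornology.IsBounded T) {τ : EucN n → EucN n} {d : EucN n → ℝ}
    (hτ : MemLp τ 2 (volume.restrict T)) (hd : HasWeakDiv T τ d)
    {v : EucN n → ℝ} {g : EucN n → EucN n}
    (hvc : ContinuousOn v (closure T)) (hv0 : ∀ x ∈ frontier T, v x = 0)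
    (hvg : HasWeakGrad T v g) :
    (∫ x in T, d x * v x) + ∫ x in T, inner ℝ (τ x) (g x) = 0 := by
  have hmk := hvg.1.1.ae_eq_mk
  set g' := hvg.1.1.mk g with hg'
  have hgm : StronglyMeasurable g' := hvg.1.1.stronglyMeasurable_mk
  have hvg' := hvg.congr hmk
  have hV : MeasurableSet (T ∩ {y | v y ≠ 0}) := by
    have hu := continuous_indicator hv0 hvc
    have : T ∩ {y | v y ≠ 0} = {y | T.indicator v y ≠ 0} := by
      ext y
      simp
    rw [this]
    exact (isOpen_ne_fun hu continuous_const).measurableSet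
  have hind : ({y | v y ≠ 0}.indicator g') =ᵐ[volume.restrict T]
      ((T ∩ {y | v y ≠ 0}).indicator g') := by
    filter_upwards [ae_restrict_mem hT.measurableSet] with x hx
    by_cases h0 : v x = 0 <;> simp [h0, hx]
  have hindL : MemLp ({y | v y ≠ 0}.indicator g') 2 (volume.restrict T) :=
    (memLp_congr_ae hind).2 (hvg'.1.indicator hV)
  have hae : ({y | v y ≠ 0}.indicator g') =ᵐ[volume.restrict T] g' := by
    -- For the field φ e the indicator version gives ∫ v ∂_e φ = -∫ φ e · (1_{v ≠ 0} ∇v), while the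
    -- weak gradient gives the same left side with ∇v itself.
    refine ae_eq_of_forall_isTestFun hT hTb hindL hvg'.1 fun φ hφ => ext_inner_left ℝ fun e => ?_
    have hφ1 : ContDiff ℝ 1 φ := hφ.1.of_le (by simp)
    have h1 := integral_mul_add_integral_inner_indicator hT hTb (τ := fun x => φ x • e)
      (memLp_of_continuous_of_isBounded hTb (hφ1.continuous.smul continuous_const))
      (hasWeakDiv_smul_const hTb hφ1 e) hvc hv0 hvg' hgm
    have h2 := congrArg (fun z => inner ℝ e z) (hvg'.2 φ hφ)
    have hv2 : MemLp v 2 (volume.restrict T) := by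
      have hu := memLp_of_continuous_of_isBounded hTb (continuous_indicator hv0 hvc)
      refine (memLp_congr_ae ?_).1 hu
      filter_upwards [ae_restrict_mem hT.measurableSet] with x hx
      rw [indicator_of_mem hx]
    rw [inner_neg_right, ← integral_inner (integrable_smul_of_memLp hv2 (hφ.memLp_gradient.restrict T)),
      ← integral_inner (integrable_smul_of_memLp (hφ.memLp.restrict T) hvg'.1)] at h2
    rw [← integral_inner (integrable_smul_of_memLp (hφ.memLp.restrict T) hindL),
      ← integral_inner (integrable_smul_of_memLp (hφ.memLp.restrict T) hvg'.1)]
    simp only [inner_smul_right, inner_smul_left, inner_gradient_right, conj_trivial] at h1 h2 ⊢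
    have h3 : ∫ x in T, v x * fderiv ℝ φ x e = ∫ x in T, fderiv ℝ φ x e * v x := by
      simp_rw [mul_comm]
    linarith
  rw [← integral_mul_add_integral_inner_indicator hT hTb hτ hd hvc hv0 hvg' hgm]
  congr 1
  refine integral_congr_ae ?_
  filter_upwards [hae, hmk] with x h1 h2
  rw [h1, h2]

/-- The pairing is defined with chosen representatives of the weak derivatives; uniqueness almost
everywhere allows any other representatives. -/
theorem normalPairing_eq {n : ℕ} {T : Set (EucN n)} (hT : IsOpen T)
    (hTb : Bornology.IsBounded T) {τ : EucN n → EucN n} {d : EucN n → ℝ}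
    (hd : HasWeakDiv T τ d) (hτ : MemLp τ 2 (volume.restrict T)) {v : EucN n → ℝ} {g : EucN n → EucN n}
    (hvg : HasWeakGrad T v g) :
    normalPairing T τ v = (∫ x in T, d x * v x) + ∫ x in T, inner ℝ (τ x) (g x) := by
  have h1 : MemHDiv T τ := ⟨hτ, d, hd⟩
  have h2 : HasWeakGrad T v (weakGrad T v) := by
    unfold weakGrad
    rw [dif_pos ⟨g, hvg⟩]
    exact Exists.choose_spec ⟨g, hvg⟩
  unfold normalPairing
  congr 1
  · refine integral_congr_ae ?_
    filter_upwards [h1.hasWeakDiv.ae_unique hT hTb hd] with x hx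
    rw [hx]
  · refine integral_congr_ae ?_
    filter_upwards [h2.ae_unique hT hTb hvg] with x hx
    rw [hx]

theorem HasWeakGrad.sub {n : ℕ} {T : Set (EucN n)} {v w : EucN n → ℝ} {g h : EucN n → EucN n}
    (hv : HasWeakGrad T v g) (hw : HasWeakGrad T w h) (hv2 : MemLp v 2 (volume.restrict T))
    (hw2 : MemLp w 2 (volume.restrict T)) : HasWeakGrad T (v - w) (g - h) := by
  refine ⟨hv.1.sub hw.1, fun φ hφ => ?_⟩
  have hφ2 := hφ.memLp.restrict T
  have hg2 := hφ.memLp_gradient.restrict T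
  simp only [Pi.sub_apply, sub_smul, smul_sub]
  rw [integral_sub (integrable_smul_of_memLp hv2 hg2) (integrable_smul_of_memLp hw2 hg2), hv.2 φ hφ, hw.2 φ hφ,
    integral_sub (integrable_smul_of_memLp hφ2 hv.1) (integrable_smul_of_memLp hφ2 hw.1)]
  abel

theorem HasWeakDiv.add {n : ℕ} {T : Set (EucN n)} {τ σ : EucN n → EucN n} {d e : EucN n → ℝ}
    (hd : HasWeakDiv T τ d) (he : HasWeakDiv T σ e) (hτ : MemLp τ 2 (volume.restrict T))
    (hσ : MemLp σ 2 (volume.restrict T)) : HasWeakDiv T (τ + σ) (d + e) := by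
  refine ⟨hd.1.add he.1, fun φ hφ => ?_⟩
  have hφ2 := hφ.memLp.restrict T
  have hg2 := hφ.memLp_gradient.restrict T
  simp only [Pi.add_apply, inner_add_left, add_mul]
  rw [integral_add (integrable_inner_of_memLp hτ hg2) (integrable_inner_of_memLp hσ hg2),
    hd.2 φ hφ, he.2 φ hφ, integral_add (integrable_mul_of_memLp hd.1 hφ2) (integrable_mul_of_memLp he.1 hφ2), neg_add]

theorem HasWeakDiv.const_smul {n : ℕ} {T : Set (EucN n)} {τ : EucN n → EucN n} {d : EucN n → ℝ}
    (hd : HasWeakDiv T τ d) (c : ℝ) : HasWeakDiv T (c • τ) (c • d) := by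
  refine ⟨hd.1.const_smul c, fun φ hφ => ?_⟩
  simp only [Pi.smul_apply, inner_smul_left, smul_eq_mul, conj_trivial, mul_assoc]
  rw [integral_const_mul, integral_const_mul, hd.2 φ hφ, mul_neg]

theorem HasWeakDiv.sub {n : ℕ} {T : Set (EucN n)} {τ σ : EucN n → EucN n} {d e : EucN n → ℝ}
    (hd : HasWeakDiv T τ d) (he : HasWeakDiv T σ e) (hτ : MemLp τ 2 (volume.restrict T))
    (hσ : MemLp σ 2 (volume.restrict T)) : HasWeakDiv T (τ - σ) (d - e) := by
  have := hd.add (he.const_smul (-1)) hτ (hσ.const_smul (-1))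
  simpa [sub_eq_add_neg] using this

theorem hasWeakDiv_zero {n : ℕ} {T : Set (EucN n)} :
    HasWeakDiv T (0 : EucN n → EucN n) 0 :=
  ⟨MemLp.zero, fun φ hφ => by simp⟩

theorem HasWeakDiv.finset_sum {n : ℕ} {T : Set (EucN n)} {ι : Type*} (s : Finset ι)
    {τ : ι → EucN n → EucN n} {d : ι → EucN n → ℝ}
    (hd : ∀ i ∈ s, HasWeakDiv T (τ i) (d i)) (hτ : ∀ i ∈ s, MemLp (τ i) 2 (volume.restrict T)) :
    HasWeakDiv T (∑ i ∈ s, τ i) (∑ i ∈ s, d i) := by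
  classical
  induction s using Finset.induction_on with
  | empty => simpa using! hasWeakDiv_zero
  | insert a s ha ih =>
    rw [Finset.sum_insert ha, Finset.sum_insert ha]
    refine (hd a (Finset.mem_insert_self _ _)).add
      (ih (fun i hi => hd i (Finset.mem_insert_of_mem hi))
        fun i hi => hτ i (Finset.mem_insert_of_mem hi))
      (hτ a (Finset.mem_insert_self _ _)) ?_
    exact memLp_finsetSum' s fun i hi => hτ i (Finset.mem_insert_of_mem hi)

/-- Any other lift differs from v by an H¹ function, continuous up to the boundary, with zero
boundary values, on which the duality vanishes. One smooth lift therefore computes the pairing. -/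
theorem hasNormalPairing_of_contDiff {n : ℕ} {T : Set (EucN n)} (hT : IsOpen T)
    (hTb : Bornology.IsBounded T) {τ : EucN n → EucN n} (hτ : MemHDiv T τ)
    {u v : EucN n → ℝ} (hv : ContDiff ℝ 1 v) (huv : ∀ x ∈ frontier T, v x = u x) :
    HasNormalPairing T τ u (normalPairing T τ v) := by
  obtain ⟨hτ2, d, hd⟩ := hτ
  have hvg := hasWeakGrad_of_contDiff hTb hv
  have hv2 := memLp_of_continuous_of_isBounded hTb hv.continuous
  refine ⟨⟨v, memH1_of_contDiff hTb hv, hv.continuous.continuousOn, huv⟩, fun w hw => ?_⟩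
  obtain ⟨⟨hw2, g, hwg⟩, hwc, hwu⟩ := hw
  have hz := integral_mul_add_integral_inner_eq_zero hT hTb hτ2 hd
    (hwc.sub hv.continuous.continuousOn) (fun x hx => by simp [hwu x hx, huv x hx])
    (hwg.sub hvg hw2 hv2)
  rw [normalPairing_eq hT hTb hd hτ2 hwg, normalPairing_eq hT hTb hd hτ2 hvg]
  simp only [Pi.sub_apply, mul_sub, inner_sub_right] at hz
  rw [integral_sub (integrable_mul_of_memLp hd.1 hw2) (integrable_mul_of_memLp hd.1 hv2),
    integral_sub (integrable_inner_of_memLp hτ2 hwg.1) (integrable_inner_of_memLp hτ2 hvg.1)] at hz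
  linarith

end

/-! ### Barycentric coordinates and a divergence theorem for tangential fields -/

noncomputable section

open Filter Topology Set Metric
open scoped ENNReal ContDiff

variable {n : ℕ} (b : AffineBasis (Fin (n + 1)) ℝ (EucN n))

theorem mem_openSimplex {x : EucN n} : x ∈ openSimplex b ↔ ∀ i, 0 < b.coord i x := by
  rw [openSimplex, b.interior_convexHull]; rfl

theorem isOpen_openSimplex : IsOpen (openSimplex b) := isOpen_interior

theorem isBounded_openSimplex : Bornology.IsBounded (openSimplex b) :=
  ((isBounded_convexHull).2 (finite_range b).isBounded).subset interior_subset

theorem nonempty_openSimplex : (openSimplex b).Nonempty :=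
  ⟨_, b.centroid_mem_interior_convexHull⟩

theorem measureReal_openSimplex_pos : 0 < volume.real (openSimplex b) :=
  ENNReal.toReal_pos ((isOpen_openSimplex b).measure_pos _ (nonempty_openSimplex b)).ne'
    (isBounded_openSimplex b).measure_lt_top.ne

theorem coord_eq_add_inner (i : Fin (n + 1)) (x y : EucN n) :
    b.coord i x = b.coord i y + inner ℝ (coordGrad b i) (x - y) := by
  rw [inner_coordGrad]; ring

theorem contDiff_coord (i : Fin (n + 1)) {k : ℕ∞} : ContDiff ℝ k (fun x => b.coord i x) := by
  have : (fun x => b.coord i x) = fun x => b.coord i 0 + inner ℝ (coordGrad b i) (x - 0) :=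
    funext fun x => coord_eq_add_inner b i x 0
  rw [this]
  exact contDiff_const.add (contDiff_const.inner ℝ (contDiff_id.sub contDiff_const))

theorem continuous_coord (i : Fin (n + 1)) : Continuous fun x => b.coord i x :=
  (contDiff_coord b i (k := 1)).continuous

theorem hasFDerivAt_coord (i : Fin (n + 1)) (x : EucN n) :
    HasFDerivAt (fun x => b.coord i x) (innerSL ℝ (coordGrad b i)) x := by
  have : (fun x => b.coord i x) = fun x => b.coord i 0 + innerSL ℝ (coordGrad b i) x :=
    funext fun x => by simpa using coord_eq_add_inner b i x 0
  rw [this]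
  exact (innerSL ℝ (coordGrad b i)).hasFDerivAt.const_add _

theorem fderiv_coord (i : Fin (n + 1)) (x e : EucN n) :
    fderiv ℝ (fun x => b.coord i x) x e = inner ℝ (coordGrad b i) e := by
  rw [(hasFDerivAt_coord b i x).fderiv]; rfl

theorem gradient_coord (i : Fin (n + 1)) (x : EucN n) :
    gradient (fun x => b.coord i x) x = coordGrad b i :=
  gradient_eq_of_fderiv fun e => fderiv_coord b i x e

theorem inner_coordGrad_sub_vertex (i j k : Fin (n + 1)) :
    inner ℝ (coordGrad b i) (b j - b k) =
      (if i = j then 1 else 0) - (if i = k then 1 else 0 : ℝ) := by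
  rw [inner_coordGrad, b.coord_apply, b.coord_apply]

theorem sum_coordGrad : ∑ i, coordGrad b i = 0 := by
  refine ext_inner_right ℝ fun v => ?_
  rw [sum_inner, inner_zero_left]
  have h := b.sum_coord_apply_eq_one v
  have h0 := b.sum_coord_apply_eq_one (0 : EucN n)
  have : ∀ i, inner ℝ (coordGrad b i) v = b.coord i v - b.coord i 0 := fun i => by
    rw [← inner_coordGrad, sub_zero]
  simp_rw [this, Finset.sum_sub_distrib, h, h0, sub_self]

/-- The gradients ∇η_k, k ≠ s, are dual to the edge vectors at b_s: subtract the barycentric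
expansions of v and of 0. Hence testing against the σ_E is testing against all constants. -/
theorem sum_inner_coordGrad_smul (s : Fin (n + 1)) (v : EucN n) :
    ∑ k ∈ Finset.univ.erase s, inner ℝ (coordGrad b k) v • (b k - b s) = v := by
  have h1 : ∑ k, b.coord k v • b k = v := b.linear_combination_coord_eq_self v
  have h0 : ∑ k, b.coord k (0 : EucN n) • b k = 0 := b.linear_combination_coord_eq_self 0
  have hk : ∀ i, inner ℝ (coordGrad b i) v = b.coord i v - b.coord i 0 := fun i => by
    rw [← inner_coordGrad, sub_zero]
  have hs : ∑ k, inner ℝ (coordGrad b k) v = 0 := by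
    rw [← sum_inner, sum_coordGrad, inner_zero_left]
  rw [Finset.sum_erase _ (by simp)]
  simp_rw [smul_sub, Finset.sum_sub_distrib, ← Finset.sum_smul, hs, zero_smul, sub_zero, hk,
    sub_smul, Finset.sum_sub_distrib, h1, h0, sub_zero]

theorem coord_le_one {x : EucN n} (hx : x ∈ openSimplex b) (i : Fin (n + 1)) :
    b.coord i x ≤ 1 := by
  rw [← b.sum_coord_apply_eq_one x]
  exact Finset.single_le_sum (fun j _ => ((mem_openSimplex b).1 hx j).le) (Finset.mem_univ i)

theorem coord_nonneg_of_mem_closure {x : EucN n} (hx : x ∈ closure (openSimplex b))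
    (i : Fin (n + 1)) : 0 ≤ b.coord i x := by
  have hc : IsClosed {x | 0 ≤ b.coord i x} := isClosed_le continuous_const (continuous_coord b i)
  exact closure_minimal (fun y hy => ((mem_openSimplex b).1 hy i).le) hc hx

theorem exists_coord_eq_zero_of_mem_frontier {x : EucN n} (hx : x ∈ frontier (openSimplex b)) :
    ∃ i, b.coord i x = 0 ∧ x ∈ faceSet b i := by
  rw [(isOpen_openSimplex b).frontier_eq] at hx
  have h0 := coord_nonneg_of_mem_closure b hx.1
  obtain ⟨i, hi⟩ : ∃ i, b.coord i x ≤ 0 := by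
    by_contra! h
    exact hx.2 ((mem_openSimplex b).2 h)
  have hi0 := le_antisymm hi (h0 i)
  refine ⟨i, hi0, ?_⟩
  have h1 : ∑ k, b.coord k x • b k = x := b.linear_combination_coord_eq_self x
  rw [← Finset.sum_erase (a := i) _ (by rw [hi0, zero_smul])] at h1
  rw [← h1]
  refine (convex_convexHull ℝ _).sum_mem (fun j _ => h0 j) ?_ fun j hj =>
    subset_convexHull ℝ _ ⟨j, Finset.ne_of_mem_erase hj, rfl⟩
  rw [Finset.sum_erase (f := fun j => b.coord j x) _ hi0, b.sum_coord_apply_eq_one]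

theorem hasFDerivAt_prod_coord (s : Finset (Fin (n + 1))) (x : EucN n) :
    HasFDerivAt (fun x => ∏ j ∈ s, b.coord j x)
      (∑ j ∈ s, (∏ l ∈ s.erase j, b.coord l x) • innerSL ℝ (coordGrad b j)) x :=
  HasFDerivAt.finsetProd fun j _ => hasFDerivAt_coord b j x

theorem contDiff_prod_coord (s : Finset (Fin (n + 1))) {k : ℕ∞} :
    ContDiff ℝ k (fun x => ∏ j ∈ s, b.coord j x) :=
  contDiff_prod fun j _ => contDiff_coord b j

theorem fderiv_prod_coord (s : Finset (Fin (n + 1))) (x e : EucN n) :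
    fderiv ℝ (fun x => ∏ j ∈ s, b.coord j x) x e =
      ∑ j ∈ s, (∏ l ∈ s.erase j, b.coord l x) * inner ℝ (coordGrad b j) e := by
  rw [(hasFDerivAt_prod_coord b s x).fderiv]
  simp

/-- A field whose normal component vanishes on every face has a divergence of mean zero. -/
theorem integral_div_eq_zero {w : EucN n → EucN n} {d : EucN n → ℝ}
    (hw : MemLp w 2 (volume.restrict (openSimplex b))) (hd : HasWeakDiv (openSimplex b) w d) {C : ℝ}
    (hC : ∀ x ∈ openSimplex b, ∀ j, |inner ℝ (coordGrad b j) (w x)| ≤ C * b.coord j x) :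
    ∫ x in openSimplex b, d x = 0 := by
  set T := openSimplex b with hTdef
  have hT := isOpen_openSimplex b
  have hTb := isBounded_openSimplex b
  have hfin : IsFiniteMeasure (volume.restrict T) := isFiniteMeasure_restrict_of_isBounded hTb
  let B : EucN n → ℝ := fun x => ∏ j, b.coord j x
  have hBd : ContDiff ℝ 1 B := contDiff_prod_coord b _
  have hBpos : ∀ x ∈ T, 0 < B x := fun x hx =>
    Finset.prod_pos fun j _ => (mem_openSimplex b).1 hx j
  -- In ∇B · w the factor lost by differentiating η_j is returned by the bound on ∇η_j · w.
  have hBw : ∀ x ∈ T, |fderiv ℝ B x (w x)| ≤ (n + 1) * C * B x := fun x hx => by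
    rw [fderiv_prod_coord]
    refine (Finset.abs_sum_le_sum_abs _ _).trans ?_
    have : ∀ j ∈ Finset.univ, |(∏ l ∈ Finset.univ.erase j, b.coord l x) *
        inner ℝ (coordGrad b j) (w x)| ≤ C * B x := fun j hj => by
      have hp : 0 < ∏ l ∈ Finset.univ.erase j, b.coord l x :=
        Finset.prod_pos fun j _ => (mem_openSimplex b).1 hx j
      rw [abs_mul, abs_of_pos hp]
      calc _ ≤ (∏ l ∈ Finset.univ.erase j, b.coord l x) * (C * b.coord j x) := by
            gcongr; exact hC x hx j
        _ = C * ((∏ l ∈ Finset.univ.erase j, b.coord l x) * b.coord j x) := by ring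
        _ = _ := by rw [Finset.prod_erase_mul _ _ hj]
    refine (Finset.sum_le_sum this).trans (le_of_eq ?_)
    simp
    ring
  -- The v_k vanish on ∂T and tend to 1 in T, so ∫ d v_k tends to ∫ d. Moreover |w · ∇v_k| ≤ (n + 1)
  -- C · t e^{-t} with t = kB, which is bounded since t e^{-t} ≤ 1 and tends to 0 since t → ∞.
  let v : ℕ → EucN n → ℝ := fun k x => 1 - Real.exp (-((k : ℝ) * B x))
  have hvd : ∀ k, ContDiff ℝ 1 (v k) := fun k =>
    contDiff_const.sub (Real.contDiff_exp.comp (contDiff_const.mul hBd).neg)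
  have hvf : ∀ k x e, fderiv ℝ (v k) x e =
      (k : ℝ) * Real.exp (-((k : ℝ) * B x)) * fderiv ℝ B x e := fun k x e => by
    have h1 : HasFDerivAt B (fderiv ℝ B x) x := (hBd.differentiable one_ne_zero x).hasFDerivAt
    have h2 : HasFDerivAt (v k) _ x := ((h1.const_mul (k : ℝ)).neg.exp).const_sub 1
    rw [h2.fderiv]
    simp
    ring
  have key : ∀ k, (∫ x in T, d x * v k x) + ∫ x in T, inner ℝ (w x) (gradient (v k) x) = 0 :=
    fun k => integral_mul_add_integral_inner_eq_zero hT hTb hw hd (hvd k).continuous.continuousOn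
      (fun x hx => by
        obtain ⟨i, hi, -⟩ := exists_coord_eq_zero_of_mem_frontier b hx
        have : B x = 0 := Finset.prod_eq_zero (Finset.mem_univ i) hi
        simp [v, this]) (hasWeakGrad_of_contDiff hTb (hvd k))
  have hkB : ∀ x ∈ T, Tendsto (fun k : ℕ => (k : ℝ) * B x) atTop atTop := fun x hx =>
    tendsto_natCast_atTop_atTop.atTop_mul_const (hBpos x hx)
  have L1 : Tendsto (fun k => ∫ x in T, d x * v k x) atTop (𝓝 (∫ x in T, d x)) := by
    refine tendsto_integral_of_dominated_convergence (fun x => |d x|)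
      (fun k => hd.1.1.mul (hvd k).continuous.aestronglyMeasurable)
      (hd.1.integrable (by norm_num)).abs (fun k => ?_) ?_
    · filter_upwards [ae_restrict_mem hT.measurableSet] with x hx
      rw [norm_mul]
      refine mul_le_of_le_one_right (norm_nonneg _) ?_
      have h1 : 0 ≤ (k : ℝ) * B x := mul_nonneg (Nat.cast_nonneg k) (hBpos x hx).le
      have h2 : Real.exp (-((k : ℝ) * B x)) ≤ 1 := Real.exp_le_one_iff.2 (by linarith)
      rw [Real.norm_eq_abs, abs_le]
      constructor <;> linarith [Real.exp_pos (-((k : ℝ) * B x))]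
    · filter_upwards [ae_restrict_mem hT.measurableSet] with x hx
      have h1 : Tendsto (fun k : ℕ => Real.exp (-((k : ℝ) * B x))) atTop (𝓝 0) :=
        Real.tendsto_exp_neg_atTop_nhds_zero.comp (hkB x hx)
      have h2 := (h1.const_sub 1).const_mul (d x)
      simpa using! h2
  have L2 : Tendsto (fun k => ∫ x in T, inner ℝ (w x) (gradient (v k) x)) atTop (𝓝 0) := by
    have h0 : (0 : ℝ) = ∫ x in T, (0 : ℝ) := by simp
    rw [h0]
    have hb : ∀ (k : ℕ), ∀ x ∈ T, ‖(inner ℝ (w x) (gradient (v k) x) : ℝ)‖ ≤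
        (n + 1) * C * ((k : ℝ) * B x * Real.exp (-((k : ℝ) * B x))) := fun k x hx => by
      rw [inner_gradient_right, conj_trivial, hvf, norm_mul, Real.norm_eq_abs, Real.norm_eq_abs,
        abs_of_nonneg (by positivity)]
      calc _ ≤ (k : ℝ) * Real.exp (-((k : ℝ) * B x)) * ((n + 1) * C * B x) := by
            gcongr; exact hBw x hx
        _ = _ := by ring
    have hC0 : 0 ≤ C := by
      obtain ⟨x, hx⟩ := nonempty_openSimplex b
      have h1 := (abs_nonneg _).trans (hC x hx 0)
      exact nonneg_of_mul_nonneg_left h1 ((mem_openSimplex b).1 hx 0)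
    refine tendsto_integral_of_dominated_convergence (fun x => (n + 1) * C)
      (fun k => hw.1.inner (continuous_gradient (hvd k)).aestronglyMeasurable)
      (integrable_const _) (fun k => ?_) ?_
    · filter_upwards [ae_restrict_mem hT.measurableSet] with x hx
      refine (hb k x hx).trans (mul_le_of_le_one_right (by positivity) ?_)
      rw [Real.exp_neg, mul_inv_le_iff₀ (Real.exp_pos _), one_mul]
      linarith [Real.add_one_le_exp ((k : ℝ) * B x)]
    · filter_upwards [ae_restrict_mem hT.measurableSet] with x hx
      refine squeeze_zero_norm (fun k => hb k x hx) ?_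
      have h1 := ((Real.tendsto_pow_mul_exp_neg_atTop_nhds_zero 1).comp (hkB x hx)).const_mul
        (((n : ℝ) + 1) * C)
      simpa using! h1
  have := tendsto_nhds_unique ((L1.add L2).congr key) tendsto_const_nhds
  linarith

end

/-! ### Linearity of the normal pairing and its values on the basis functions -/

noncomputable section

open Filter Topology Set Metric
open scoped ENNReal ContDiff

variable {n : ℕ}

section Pairing

variable {T : Set (EucN n)}

theorem MemHDiv.add {τ σ : EucN n → EucN n} (hτ : MemHDiv T τ) (hσ : MemHDiv T σ) :
    MemHDiv T (τ + σ) :=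
  ⟨hτ.1.add hσ.1, _, hτ.hasWeakDiv.add hσ.hasWeakDiv hτ.1 hσ.1⟩

theorem MemHDiv.sub {τ σ : EucN n → EucN n} (hτ : MemHDiv T τ) (hσ : MemHDiv T σ) :
    MemHDiv T (τ - σ) :=
  ⟨hτ.1.sub hσ.1, _, hτ.hasWeakDiv.sub hσ.hasWeakDiv hτ.1 hσ.1⟩

theorem MemHDiv.const_smul {τ : EucN n → EucN n} (hτ : MemHDiv T τ) (c : ℝ) :
    MemHDiv T (c • τ) :=
  ⟨hτ.1.const_smul c, _, hτ.hasWeakDiv.const_smul c⟩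

theorem MemHDiv.finset_sum {ι : Type*} (s : Finset ι) {τ : ι → EucN n → EucN n}
    (h : ∀ i ∈ s, MemHDiv T (τ i)) : MemHDiv T (∑ i ∈ s, τ i) :=
  ⟨memLp_finsetSum' s fun i hi => (h i hi).1, _,
    HasWeakDiv.finset_sum s (fun i hi => (h i hi).hasWeakDiv) fun i hi => (h i hi).1⟩

theorem memHDiv_smul_const (hTb : Bornology.IsBounded T) {f : EucN n → ℝ} (hf : ContDiff ℝ 1 f)
    (c : EucN n) : MemHDiv T (fun x => f x • c) :=
  ⟨memLp_of_continuous_of_isBounded hTb (hf.continuous.smul continuous_const), _,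
    hasWeakDiv_smul_const hTb hf c⟩

theorem normalPairing_of_contDiff (hT : IsOpen T) (hTb : Bornology.IsBounded T)
    {τ : EucN n → EucN n} {d : EucN n → ℝ} (hd : HasWeakDiv T τ d)
    (hτ : MemLp τ 2 (volume.restrict T)) {v : EucN n → ℝ} (hv : ContDiff ℝ 1 v) :
    normalPairing T τ v = (∫ x in T, d x * v x) + ∫ x in T, inner ℝ (τ x) (gradient v x) :=
  normalPairing_eq hT hTb hd hτ (hasWeakGrad_of_contDiff hTb hv)

theorem normalPairing_add (hT : IsOpen T) (hTb : Bornology.IsBounded T)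
    {τ σ : EucN n → EucN n} (hτ : MemHDiv T τ) (hσ : MemHDiv T σ) {v : EucN n → ℝ}
    (hv : ContDiff ℝ 1 v) :
    normalPairing T (τ + σ) v = normalPairing T τ v + normalPairing T σ v := by
  have hv2 := memLp_of_continuous_of_isBounded hTb hv.continuous
  have hg2 := memLp_of_continuous_of_isBounded hTb (continuous_gradient hv)
  rw [normalPairing_of_contDiff hT hTb (hτ.hasWeakDiv.add hσ.hasWeakDiv hτ.1 hσ.1)
    (hτ.1.add hσ.1) hv, normalPairing_of_contDiff hT hTb hτ.hasWeakDiv hτ.1 hv,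
    normalPairing_of_contDiff hT hTb hσ.hasWeakDiv hσ.1 hv]
  simp only [Pi.add_apply, add_mul, inner_add_left]
  rw [integral_add (integrable_mul_of_memLp hτ.hasWeakDiv.1 hv2)
    (integrable_mul_of_memLp hσ.hasWeakDiv.1 hv2),
    integral_add (integrable_inner_of_memLp hτ.1 hg2) (integrable_inner_of_memLp hσ.1 hg2)]
  ring

theorem normalPairing_const_smul (hT : IsOpen T) (hTb : Bornology.IsBounded T)
    {τ : EucN n → EucN n} (hτ : MemHDiv T τ) (c : ℝ) {v : EucN n → ℝ} (hv : ContDiff ℝ 1 v) :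
    normalPairing T (c • τ) v = c * normalPairing T τ v := by
  rw [normalPairing_of_contDiff hT hTb (hτ.hasWeakDiv.const_smul c) (hτ.1.const_smul c) hv,
    normalPairing_of_contDiff hT hTb hτ.hasWeakDiv hτ.1 hv]
  simp only [Pi.smul_apply, smul_eq_mul, inner_smul_left, conj_trivial, mul_assoc]
  rw [integral_const_mul, integral_const_mul, mul_add]

theorem normalPairing_sub (hT : IsOpen T) (hTb : Bornology.IsBounded T)
    {τ σ : EucN n → EucN n} (hτ : MemHDiv T τ) (hσ : MemHDiv T σ) {v : EucN n → ℝ}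
    (hv : ContDiff ℝ 1 v) :
    normalPairing T (τ - σ) v = normalPairing T τ v - normalPairing T σ v := by
  have := normalPairing_add hT hTb (hτ.sub hσ) hσ hv
  rw [sub_add_cancel] at this
  linarith

theorem normalPairing_finset_sum (hT : IsOpen T) (hTb : Bornology.IsBounded T) {ι : Type*}
    (s : Finset ι) {τ : ι → EucN n → EucN n} (h : ∀ i ∈ s, MemHDiv T (τ i)) {v : EucN n → ℝ}
    (hv : ContDiff ℝ 1 v) :
    normalPairing T (∑ i ∈ s, τ i) v = ∑ i ∈ s, normalPairing T (τ i) v := by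
  classical
  induction s using Finset.induction_on with
  | empty =>
    rw [Finset.sum_empty, Finset.sum_empty,
      normalPairing_of_contDiff hT hTb hasWeakDiv_zero MemLp.zero hv]
    simp
  | insert a s ha ih =>
    rw [Finset.sum_insert ha, Finset.sum_insert ha,
      normalPairing_add hT hTb (h a (Finset.mem_insert_self _ _))
        (MemHDiv.finset_sum s fun i hi => h i (Finset.mem_insert_of_mem hi)) hv,
      ih fun i hi => h i (Finset.mem_insert_of_mem hi)]

/-- By the product rule the two terms of the duality combine into the divergence of f v c. Pairings
of bubble fields thus become integrals to which `integral_fderiv_eq_zero` applies. -/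
theorem normalPairing_smul_const (hT : IsOpen T) (hTb : Bornology.IsBounded T) {f v : EucN n → ℝ}
    (hf : ContDiff ℝ 1 f) (hv : ContDiff ℝ 1 v) (c : EucN n) :
    normalPairing T (fun x => f x • c) v = ∫ x in T, fderiv ℝ (fun x => f x * v x) x c := by
  have hv2 := memLp_of_continuous_of_isBounded hTb hv.continuous
  have hg2 := memLp_of_continuous_of_isBounded hTb (continuous_gradient hv)
  have hdv := hasWeakDiv_smul_const hTb hf c
  have hf2 : MemLp (fun x => f x • c) 2 (volume.restrict T) :=
    memLp_of_continuous_of_isBounded hTb (hf.continuous.smul continuous_const)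
  rw [normalPairing_of_contDiff hT hTb hdv hf2 hv, ← integral_add
    (integrable_mul_of_memLp hdv.1 hv2) (integrable_inner_of_memLp hf2 hg2)]
  refine integral_congr_ae (Eventually.of_forall fun x => ?_)
  simp only
  rw [inner_smul_left, inner_gradient_right, conj_trivial, conj_trivial,
    fderiv_fun_mul (hf.differentiable one_ne_zero x) (hv.differentiable one_ne_zero x)]
  simp
  ring

end Pairing

variable (b : AffineBasis (Fin (n + 1)) ℝ (EucN n))

theorem normalPairing_coord {τ : EucN n → EucN n} {d : EucN n → ℝ}
    (hd : HasWeakDiv (openSimplex b) τ d) (hτ : MemLp τ 2 (volume.restrict (openSimplex b)))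
    (k : Fin (n + 1)) :
    normalPairing (openSimplex b) τ (fun x => b.coord k x) =
      (∫ x in openSimplex b, d x * b.coord k x) +
        ∫ x in openSimplex b, inner ℝ (coordGrad b k) (τ x) := by
  rw [normalPairing_of_contDiff (isOpen_openSimplex b) (isBounded_openSimplex b) hd hτ
    (contDiff_coord b k)]
  simp_rw [gradient_coord, real_inner_comm]

theorem memLp_const_openSimplex {F : Type*} [NormedAddCommGroup F] (c : F) :
    MemLp (fun _ : EucN n => c) 2 (volume.restrict (openSimplex b)) :=
  memLp_of_continuous_of_isBounded (isBounded_openSimplex b) continuous_const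

theorem memLp_coord (k : Fin (n + 1)) :
    MemLp (fun x => b.coord k x) 2 (volume.restrict (openSimplex b)) :=
  memLp_of_continuous_of_isBounded (isBounded_openSimplex b) (continuous_coord b k)

/-- Uses ∑ η_k = 1 and ∑ ∇η_k = 0: the sum is the pairing with the constant 1. -/
theorem sum_normalPairing_coord {τ : EucN n → EucN n} {d : EucN n → ℝ}
    (hd : HasWeakDiv (openSimplex b) τ d) (hτ : MemLp τ 2 (volume.restrict (openSimplex b))) :
    ∑ k, normalPairing (openSimplex b) τ (fun x => b.coord k x) = ∫ x in openSimplex b, d x := by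
  simp_rw [normalPairing_coord b hd hτ, Finset.sum_add_distrib]
  rw [← integral_finsetSum _ fun k _ => integrable_mul_of_memLp hd.1 (memLp_coord b k),
    ← integral_finsetSum _ fun k _ =>
      integrable_inner_of_memLp (memLp_const_openSimplex b (coordGrad b k)) hτ]
  simp_rw [← sum_inner, sum_coordGrad, inner_zero_left, ← Finset.mul_sum,
    b.sum_coord_apply_eq_one]
  simp

theorem nuFun_eq (k : Fin (n + 1)) : nuFun b k = fun x => 1 - n * b.coord k x := by
  funext x
  have h := b.sum_coord_apply_eq_one x
  rw [← Finset.sum_erase_add _ _ (Finset.mem_univ k)] at h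
  rw [nuFun]
  linarith

theorem contDiff_nuFun (k : Fin (n + 1)) : ContDiff ℝ 1 (nuFun b k) := by
  rw [nuFun_eq]
  exact contDiff_const.sub (contDiff_const.mul (contDiff_coord b k))

theorem gradient_nuFun (k : Fin (n + 1)) (x : EucN n) :
    gradient (nuFun b k) x = -((n : ℝ) • coordGrad b k) := by
  refine gradient_eq_of_fderiv fun e => ?_
  rw [nuFun_eq]
  have h := ((hasFDerivAt_coord b k x).const_mul (n : ℝ)).const_sub 1
  rw [h.fderiv]
  simp [inner_neg_left, inner_smul_left]

theorem normalPairing_nuFun {τ : EucN n → EucN n} {d : EucN n → ℝ}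
    (hd : HasWeakDiv (openSimplex b) τ d) (hτ : MemLp τ 2 (volume.restrict (openSimplex b)))
    (k : Fin (n + 1)) :
    normalPairing (openSimplex b) τ (nuFun b k) =
      (∫ x in openSimplex b, d x * nuFun b k x) -
        n * ∫ x in openSimplex b, inner ℝ (coordGrad b k) (τ x) := by
  rw [normalPairing_of_contDiff (isOpen_openSimplex b) (isBounded_openSimplex b) hd hτ
    (contDiff_nuFun b k), sub_eq_add_neg, ← integral_const_mul, ← integral_neg]
  simp_rw [gradient_nuFun, inner_neg_right, inner_smul_right, real_inner_comm]

theorem normalPairing_nuFun_eq_sub {τ : EucN n → EucN n} {d : EucN n → ℝ}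
    (hd : HasWeakDiv (openSimplex b) τ d) (hτ : MemLp τ 2 (volume.restrict (openSimplex b)))
    (k : Fin (n + 1)) :
    normalPairing (openSimplex b) τ (nuFun b k) =
      (∫ x in openSimplex b, d x) -
        n * normalPairing (openSimplex b) τ (fun x => b.coord k x) := by
  have hfin := isFiniteMeasure_restrict_of_isBounded (isBounded_openSimplex b)
  rw [normalPairing_nuFun b hd hτ, normalPairing_coord b hd hτ, nuFun_eq, mul_add,
    ← integral_const_mul (n : ℝ) (fun x => d x * b.coord k x), ← sub_sub,
    ← integral_sub (hd.1.integrable (by norm_num))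
      ((integrable_mul_of_memLp hd.1 (memLp_coord b k)).const_mul _)]
  congr 2
  funext x
  ring

theorem integral_fderiv_eq_zero {f : EucN n → ℝ} (hf : ContDiff ℝ 1 f) (c : EucN n) {C : ℝ}
    (hC : ∀ x ∈ openSimplex b, ∀ j, |f x * inner ℝ (coordGrad b j) c| ≤ C * b.coord j x) :
    ∫ x in openSimplex b, fderiv ℝ f x c = 0 :=
  integral_div_eq_zero b (w := fun x => f x • c)
    (memLp_of_continuous_of_isBounded (isBounded_openSimplex b)
      (hf.continuous.smul continuous_const))
    (hasWeakDiv_smul_const (isBounded_openSimplex b) hf c)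
    fun x hx j => by rw [inner_smul_right]; exact hC x hx j

theorem prod_coord_mem_Icc {x : EucN n} (hx : x ∈ openSimplex b) (s : Finset (Fin (n + 1))) :
    (∏ j ∈ s, b.coord j x) ∈ Icc (0 : ℝ) 1 :=
  ⟨Finset.prod_nonneg fun j _ => ((mem_openSimplex b).1 hx j).le,
    Finset.prod_le_one (fun j _ => ((mem_openSimplex b).1 hx j).le)
      fun j _ => coord_le_one b hx j⟩

theorem prod_coord_le {x : EucN n} (hx : x ∈ openSimplex b) {s : Finset (Fin (n + 1))}
    {j : Fin (n + 1)} (hj : j ∈ s) : ∏ l ∈ s, b.coord l x ≤ b.coord j x := by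
  rw [← Finset.mul_prod_erase _ _ hj]
  exact mul_le_of_le_one_right ((mem_openSimplex b).1 hx j).le (prod_coord_mem_Icc b hx _).2

theorem fderiv_coord_mul_coord (k l : Fin (n + 1)) (x e : EucN n) :
    fderiv ℝ (fun x => b.coord k x * b.coord l x) x e =
      b.coord k x * inner ℝ (coordGrad b l) e + b.coord l x * inner ℝ (coordGrad b k) e := by
  have h : HasFDerivAt (fun x => b.coord k x * b.coord l x) _ x :=
    (hasFDerivAt_coord b k x).mul (hasFDerivAt_coord b l x)
  rw [h.fderiv]
  simp

/-- An edge vector is tangential to every face except the two opposite to its endpoints, and on each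
of these one factor of η_s η_k vanishes. -/
theorem abs_coord_mul_inner_edge_le {x : EucN n} (hx : x ∈ openSimplex b) (s k j : Fin (n + 1)) :
    |b.coord s x * b.coord k x * inner ℝ (coordGrad b j) (b k - b s)| ≤ 1 * b.coord j x := by
  have hs := (mem_openSimplex b).1 hx s
  have hk := (mem_openSimplex b).1 hx k
  have hj := (mem_openSimplex b).1 hx j
  have hs1 := coord_le_one b hx s
  have hk1 := coord_le_one b hx k
  rw [inner_coordGrad_sub_vertex]
  by_cases h1 : j = k
  · subst h1
    by_cases h2 : j = s
    · simp [h2, (h2 ▸ hj : 0 < b.coord s x).le]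
    · simp only [if_true, if_neg h2, sub_zero, mul_one, one_mul]
      rw [abs_of_nonneg (by positivity)]
      exact mul_le_of_le_one_left hj.le hs1
  · by_cases h2 : j = s
    · subst h2
      simp only [if_true, if_neg h1, zero_sub, mul_neg, mul_one, one_mul, abs_neg]
      rw [abs_of_nonneg (by positivity)]
      exact mul_le_of_le_one_right hj.le hk1
    · simp [h1, h2, hj.le]

/-- The field η_l η_k (b_k - b_l) is tangential on ∂T and its divergence is η_l - η_k. Together with
∑ η_k = 1 this yields the integrals of the coordinates without an integration formula. -/
theorem integral_coord_eq (k l : Fin (n + 1)) :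
    ∫ x in openSimplex b, b.coord k x = ∫ x in openSimplex b, b.coord l x := by
  have hfin := isFiniteMeasure_restrict_of_isBounded (isBounded_openSimplex b)
  by_cases hkl : k = l
  · rw [hkl]
  have h := integral_fderiv_eq_zero b ((contDiff_coord b l (k := 1)).mul (contDiff_coord b k))
    (b k - b l) fun x hx j => abs_coord_mul_inner_edge_le b hx l k j
  simp_rw [fderiv_coord_mul_coord, inner_coordGrad_sub_vertex] at h
  simp only [if_true, if_neg hkl, if_neg (Ne.symm hkl), sub_zero, zero_sub, mul_one, mul_neg] at h
  simp only [← sub_eq_add_neg] at h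
  rw [integral_sub ((memLp_coord b l).integrable (by norm_num))
    ((memLp_coord b k).integrable (by norm_num))] at h
  linarith

theorem integral_coord (k : Fin (n + 1)) :
    ∫ x in openSimplex b, b.coord k x = volume.real (openSimplex b) / (n + 1) := by
  have hfin := isFiniteMeasure_restrict_of_isBounded (isBounded_openSimplex b)
  have h : ∑ l, ∫ x in openSimplex b, b.coord l x = volume.real (openSimplex b) := by
    rw [← integral_finsetSum _ fun l _ => (memLp_coord b l).integrable (by norm_num)]
    simp_rw [b.sum_coord_apply_eq_one]
    simp
  simp_rw [integral_coord_eq b _ k] at h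
  rw [eq_div_iff (by positivity)]
  simp at h
  linarith

/-- Writes ψ_F as scalar functions times constant vectors, the form in which weak divergences are
computed here. -/
theorem rtFun_eq_sum (i : Fin (n + 1)) :
    rtFun b i = ∑ j, fun x => b.coord j x • (‖coordGrad b i‖ • (b j - b i)) := by
  funext x
  have h1 : ∑ k, b.coord k x • b k = x := b.linear_combination_coord_eq_self x
  have h2 := b.sum_coord_apply_eq_one x
  rw [Finset.sum_apply, rtFun]
  simp_rw [smul_comm _ ‖coordGrad b i‖, ← Finset.smul_sum, smul_sub, Finset.sum_sub_distrib, h1,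
    ← Finset.sum_smul, h2, one_smul, smul_sub]

theorem hasWeakDiv_rtFun (i : Fin (n + 1)) :
    HasWeakDiv (openSimplex b) (rtFun b i) fun _ => n * ‖coordGrad b i‖ := by
  have hTb := isBounded_openSimplex b
  have h := HasWeakDiv.finset_sum Finset.univ
    (fun j _ => hasWeakDiv_smul_const hTb (contDiff_coord b j (k := 1))
      (‖coordGrad b i‖ • (b j - b i)))
    (fun j _ => memLp_of_continuous_of_isBounded hTb
      ((continuous_coord b j).smul continuous_const))
  rw [← rtFun_eq_sum] at h
  convert h using 1
  funext x
  rw [Finset.sum_apply]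
  simp_rw [fderiv_coord, inner_smul_right, inner_coordGrad_sub_vertex, ← Finset.mul_sum]
  simp
  ring

theorem continuous_rtFun (i : Fin (n + 1)) : Continuous (rtFun b i) := by
  unfold rtFun
  fun_prop

theorem memHDiv_rtFun (i : Fin (n + 1)) : MemHDiv (openSimplex b) (rtFun b i) :=
  ⟨memLp_of_continuous_of_isBounded (isBounded_openSimplex b) (continuous_rtFun b i), _,
    hasWeakDiv_rtFun b i⟩

/-- With g = ∇η_i, the divergence term is n‖g‖|T|/(n + 1) and the gradient term is ‖g‖(|T|/(n + 1) -
δ_{ik}|T|). -/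
theorem normalPairing_rtFun_coord (i k : Fin (n + 1)) :
    normalPairing (openSimplex b) (rtFun b i) (fun x => b.coord k x) =
      if i = k then 0 else ‖coordGrad b i‖ * volume.real (openSimplex b) := by
  have hfin := isFiniteMeasure_restrict_of_isBounded (isBounded_openSimplex b)
  rw [normalPairing_coord b (hasWeakDiv_rtFun b i) (memHDiv_rtFun b i).1, integral_const_mul]
  simp_rw [rtFun, inner_smul_right, inner_coordGrad]
  rw [integral_const_mul, integral_sub ((memLp_coord b k).integrable (by norm_num))
    (integrable_const _), integral_coord, b.coord_apply]
  simp only [eq_comm (a := k) (b := i)]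
  have : (n : ℝ) + 1 ≠ 0 := by positivity
  by_cases h : i = k
  · simp [h]
    field_simp
    ring
  · simp [h]
    field_simp

theorem memHDiv_brFun (i : Fin (n + 1)) : MemHDiv (openSimplex b) (brFun b i) :=
  memHDiv_smul_const (isBounded_openSimplex b) (contDiff_prod_coord b _) _

theorem inner_coordGrad_faceNormal_self (i : Fin (n + 1)) :
    inner ℝ (coordGrad b i) (faceNormal b i) = -‖coordGrad b i‖ := by
  rw [faceNormal, inner_neg_right, inner_smul_right, real_inner_self_eq_norm_sq]
  by_cases h : ‖coordGrad b i‖ = 0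
  · simp [h]
  · field_simp

theorem abs_inner_coordGrad_le (j : Fin (n + 1)) (c : EucN n) :
    |inner ℝ (coordGrad b j) c| ≤ (∑ l, ‖coordGrad b l‖) * ‖c‖ := by
  refine (abs_real_inner_le_norm _ _).trans ?_
  gcongr
  exact Finset.single_le_sum (f := fun l => ‖coordGrad b l‖) (fun _ _ => norm_nonneg _)
    (Finset.mem_univ j)

/-- For i = k the product with η_k is the full bubble, zero on all of ∂T. Otherwise n_F is split
into a vector c tangential to F, which contributes nothing because the product vanishes on the other
faces, and a multiple of the edge vector b_k - b_i. Along that edge η_k is the only changing factor;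
it occurs twice, whence the 2. -/
theorem normalPairing_brFun_coord (i k : Fin (n + 1)) :
    normalPairing (openSimplex b) (brFun b i) (fun x => b.coord k x) =
      if i = k then 0 else
        2 * ‖coordGrad b i‖ * ∫ x in openSimplex b, ∏ j ∈ Finset.univ.erase i, b.coord j x := by
  have hTb := isBounded_openSimplex b
  have hβ : ContDiff ℝ 1 fun x => ∏ j ∈ Finset.univ.erase i, b.coord j x :=
    contDiff_prod_coord b _
  have hf : ContDiff ℝ 1 fun x => (∏ j ∈ Finset.univ.erase i, b.coord j x) * b.coord k x :=
    hβ.mul (contDiff_coord b k)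
  have e : normalPairing (openSimplex b) (brFun b i) (fun x => b.coord k x) = _ :=
    normalPairing_smul_const (isOpen_openSimplex b) hTb hβ (contDiff_coord b k) (faceNormal b i)
  rw [e]
  have hbound : ∀ c : EucN n, ∀ x ∈ openSimplex b, ∀ j, j ≠ i ∨ i = k →
      |(∏ j ∈ Finset.univ.erase i, b.coord j x) * b.coord k x * inner ℝ (coordGrad b j) c| ≤
        ((∑ l, ‖coordGrad b l‖) * ‖c‖) * b.coord j x := fun c x hx j hj => by
    have h0 := (mem_openSimplex b).1 hx
    have h1 := prod_coord_mem_Icc b hx (Finset.univ.erase i)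
    rw [abs_mul, abs_of_nonneg (mul_nonneg h1.1 (h0 k).le), mul_comm]
    have hle : (∏ j ∈ Finset.univ.erase i, b.coord j x) * b.coord k x ≤ b.coord j x := by
      by_cases hji : j = i
      · obtain rfl : i = k := hj.resolve_left fun h => h hji
        rw [hji]
        exact mul_le_of_le_one_left (h0 i).le h1.2
      · have := prod_coord_le b hx (Finset.mem_erase.2 ⟨hji, Finset.mem_univ j⟩)
        exact (mul_le_of_le_one_right h1.1 (coord_le_one b hx k)).trans this
    exact mul_le_mul (abs_inner_coordGrad_le b j c) hle (mul_nonneg h1.1 (h0 k).le)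
      (by positivity)
  by_cases hik : i = k
  · rw [if_pos hik]
    exact integral_fderiv_eq_zero b hf _ fun x hx j => hbound _ x hx j (Or.inr hik)
  rw [if_neg hik]
  -- The factor ‖∇η_i‖ makes c tangential to F, because ∇η_i · n_F = -‖∇η_i‖ and ∇η_i · (b_k - b_i)
  -- = -1.
  set c := faceNormal b i - ‖coordGrad b i‖ • (b k - b i) with hc
  have hci : inner ℝ (coordGrad b i) c = 0 := by
    rw [hc, inner_sub_right, inner_smul_right, inner_coordGrad_faceNormal_self,
      inner_coordGrad_sub_vertex, if_neg hik, if_pos rfl]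
    ring
  have h0 := integral_fderiv_eq_zero b hf c (C := (∑ l, ‖coordGrad b l‖) * ‖c‖) fun x hx j => by
    by_cases hji : j = i
    · rw [hji, hci, mul_zero, abs_zero]
      have := ((mem_openSimplex b).1 hx i).le
      positivity
    · exact hbound _ x hx j (Or.inl hji)
  have hd : ∀ x, fderiv ℝ (fun x => (∏ j ∈ Finset.univ.erase i, b.coord j x) * b.coord k x) x
      (b k - b i) = 2 * ∏ j ∈ Finset.univ.erase i, b.coord j x := fun x => by
    have hk : k ∈ Finset.univ.erase i := Finset.mem_erase.2 ⟨Ne.symm hik, Finset.mem_univ k⟩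
    have h : HasFDerivAt (fun x => (∏ j ∈ Finset.univ.erase i, b.coord j x) * b.coord k x) _ x :=
      (hasFDerivAt_prod_coord b (Finset.univ.erase i) x).mul (hasFDerivAt_coord b k x)
    rw [h.fderiv]
    have h2 : ∑ j ∈ Finset.univ.erase i, (∏ l ∈ (Finset.univ.erase i).erase j, b.coord l x) *
        inner ℝ (coordGrad b j) (b k - b i) = ∏ l ∈ (Finset.univ.erase i).erase k, b.coord l x := by
      rw [Finset.sum_eq_single_of_mem k hk]
      · rw [inner_coordGrad_sub_vertex, if_pos rfl, if_neg (Ne.symm hik)]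
        ring
      · intro j hj hjk
        rw [inner_coordGrad_sub_vertex, if_neg hjk, if_neg (Finset.ne_of_mem_erase hj)]
        ring
    have h3 := Finset.mul_prod_erase (Finset.univ.erase i) (fun l => b.coord l x) hk
    have h4 : inner ℝ (coordGrad b k) (b k - b i) = (1 : ℝ) := by
      rw [inner_coordGrad_sub_vertex, if_pos rfl, if_neg (Ne.symm hik), sub_zero]
    simp only [add_apply, FunLike.coe_smul, Pi.smul_apply, sum_apply, smul_eq_mul,
      innerSL_apply_apply, h2, h4]
    rw [h3]
    ring
  have hsplit : ∀ x, fderiv ℝ (fun x => (∏ j ∈ Finset.univ.erase i, b.coord j x) * b.coord k x) x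
      (faceNormal b i) = fderiv ℝ (fun x => (∏ j ∈ Finset.univ.erase i, b.coord j x) *
        b.coord k x) x c + 2 * ‖coordGrad b i‖ * ∏ j ∈ Finset.univ.erase i, b.coord j x := by
    intro x
    rw [hc, map_sub, map_smul, hd, smul_eq_mul]
    ring
  have hfin := isFiniteMeasure_restrict_of_isBounded hTb
  simp_rw [hsplit]
  rw [integral_add, h0, zero_add, integral_const_mul]
  · exact (memLp_of_continuous_of_isBounded hTb ((hf.continuous_fderiv one_ne_zero).clm_apply
      continuous_const)).integrable (by norm_num)
  · exact ((memLp_of_continuous_of_isBounded hTb hβ.continuous).integrable (by norm_num)).const_mul _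

theorem memHDiv_edgeFun (s k : Fin (n + 1)) : MemHDiv (openSimplex b) (edgeFun b s k) :=
  memHDiv_smul_const (isBounded_openSimplex b) ((contDiff_coord b s).mul (contDiff_coord b k)) _

theorem hasWeakDiv_edgeFun {s k : Fin (n + 1)} (hk : k ≠ s) :
    HasWeakDiv (openSimplex b) (edgeFun b s k) fun x => b.coord s x - b.coord k x := by
  have h := hasWeakDiv_smul_const (isBounded_openSimplex b)
    ((contDiff_coord b s (k := 1)).mul (contDiff_coord b k)) (b k - b s)
  have e : (fun x => fderiv ℝ (fun x => b.coord s x * b.coord k x) x (b k - b s)) =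
      fun x => b.coord s x - b.coord k x := by
    funext x
    rw [fderiv_coord_mul_coord, inner_coordGrad_sub_vertex, inner_coordGrad_sub_vertex]
    simp [hk, Ne.symm hk]
    ring
  rw [e] at h
  exact h

/-- The edge function is tangential on ∂T, and multiplying by η_l ≤ 1 keeps it so. -/
theorem normalPairing_edgeFun_coord (s k l : Fin (n + 1)) :
    normalPairing (openSimplex b) (edgeFun b s k) (fun x => b.coord l x) = 0 := by
  have hf : ContDiff ℝ 1 fun x => b.coord s x * b.coord k x :=
    (contDiff_coord b s).mul (contDiff_coord b k)
  have e : normalPairing (openSimplex b) (edgeFun b s k) (fun x => b.coord l x) = _ :=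
    normalPairing_smul_const (isOpen_openSimplex b) (isBounded_openSimplex b) hf
      (contDiff_coord b l) (b k - b s)
  rw [e]
  refine integral_fderiv_eq_zero b (hf.mul (contDiff_coord b l)) _ (C := 1) fun x hx j => ?_
  have h0 := (mem_openSimplex b).1 hx l
  rw [mul_right_comm, abs_mul, abs_of_pos h0]
  exact (mul_le_of_le_one_right (abs_nonneg _) (coord_le_one b hx l)).trans
    (abs_coord_mul_inner_edge_le b hx s k j)

theorem integral_edgeSigma_edgeFun {s k l : Fin (n + 1)} (hk : k ≠ s) :
    ∫ x in openSimplex b, inner ℝ (edgeSigma b k) (edgeFun b s l x) =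
      if k = l then ∫ x in openSimplex b, b.coord s x * b.coord k x else 0 := by
  simp_rw [edgeFun, inner_smul_right, inner_edgeSigma b s k l hk]
  by_cases h : k = l
  · simp [h]
  · simp [h]

end

/-! ### Affine functions, mean values and the Fortin conditions -/

noncomputable section

open Filter Topology Set Metric

theorem mem_polySpace_zero {n : ℕ} {f : EucN n → ℝ} :
    f ∈ polySpace n 0 ↔ ∃ c, ∀ x, f x = c := by
  constructor
  · rintro ⟨p, hp, hf⟩
    have := MvPolynomial.totalDegree_eq_zero_iff_eq_C.1 (Nat.le_zero.1 hp)
    exact ⟨_, fun x => by rw [hf, this, MvPolynomial.eval_C]⟩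
  · rintro ⟨c, hc⟩
    exact ⟨MvPolynomial.C c, by simp, fun x => by simp [hc]⟩

theorem mem_polyVecSpace_zero {n : ℕ} {f : EucN n → EucN n} :
    f ∈ polyVecSpace n 0 ↔ ∃ c, f = fun _ => c := by
  constructor
  · intro hf
    choose c hc using fun i => mem_polySpace_zero.1 (hf i)
    refine ⟨WithLp.toLp 2 c, ?_⟩
    ext x i
    simpa using hc i x
  · rintro ⟨c, rfl⟩ i
    exact mem_polySpace_zero.2 ⟨c i, fun _ => rfl⟩

theorem exists_affine_of_mem_polySpace_one {n : ℕ} {f : EucN n → ℝ} (hf : f ∈ polySpace n 1) :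
    ∃ (c : ℝ) (g : EucN n), ∀ x, f x = c + inner ℝ g x := by
  obtain ⟨p, hp, hf⟩ := hf
  have hmon : ∀ m ∈ p.support, ∃ (c : ℝ) (g : EucN n), ∀ x : EucN n,
      p.coeff m * ∏ i, x i ^ m i = c + inner ℝ g x := by
    intro m hm
    have hdeg : m.degree ≤ 1 := (MvPolynomial.le_totalDegree hm).trans hp
    rcases Nat.le_one_iff_eq_zero_or_eq_one.1 hdeg with h | h
    · have h0 : m = 0 := (Finsupp.degree_eq_zero_iff m).1 h
      exact ⟨p.coeff m, 0, fun x => by simp [h0]⟩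
    · obtain ⟨i, hi⟩ : ∃ i, m = Finsupp.single i 1 := by
        obtain ⟨i, hi⟩ : ∃ i, m i ≠ 0 := by
          by_contra! h0
          simp [show m = 0 from Finsupp.ext h0] at h
        have hle : Finsupp.single i 1 ≤ m :=
          Finsupp.single_le_iff.2 (Nat.one_le_iff_ne_zero.2 hi)
        have hadd := tsub_add_cancel_of_le hle
        have hd := congrArg Finsupp.degree hadd
        rw [map_add, Finsupp.degree_single, h] at hd
        have hz := (Finsupp.degree_eq_zero_iff _).1 (Nat.add_eq_right.1 hd)
        exact ⟨i, by rw [← hadd, hz, zero_add]⟩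
      refine ⟨0, p.coeff m • EuclideanSpace.single i 1, fun x => ?_⟩
      rw [inner_smul_left, EuclideanSpace.inner_single_left, hi,
        Finset.prod_eq_single i (fun j _ hj => by simp [Finsupp.single_eq_of_ne hj]) (by simp)]
      simp
  choose! c g hcg using hmon
  refine ⟨∑ m ∈ p.support, c m, ∑ m ∈ p.support, g m, fun x => ?_⟩
  rw [hf, MvPolynomial.eval_eq', sum_inner, ← Finset.sum_add_distrib]
  exact Finset.sum_congr rfl fun m hm => hcg m hm x

theorem affine_mem_polySpace_one {n : ℕ} (c : ℝ) (g : EucN n) :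
    (fun x => c + inner ℝ g x) ∈ polySpace n 1 := by
  refine ⟨MvPolynomial.C c + ∑ i, MvPolynomial.C (g i) * MvPolynomial.X i, ?_, fun x => ?_⟩
  · refine (MvPolynomial.totalDegree_add _ _).trans (max_le (by simp) ?_)
    refine MvPolynomial.totalDegree_finsetSum_le fun i _ => ?_
    refine (MvPolynomial.totalDegree_mul _ _).trans ?_
    simp
  · simp [PiLp.inner_apply, mul_comm]

section

variable {n : ℕ} (b : AffineBasis (Fin (n + 1)) ℝ (EucN n))

theorem coord_mem_polySpace_one (i : Fin (n + 1)) : (fun x => b.coord i x) ∈ polySpace n 1 := by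
  convert affine_mem_polySpace_one (b.coord i 0) (coordGrad b i) using 2 with x
  simpa using coord_eq_add_inner b i x 0

theorem eq_sum_coord_of_mem_polySpace_one {f : EucN n → ℝ} (hf : f ∈ polySpace n 1) (x : EucN n) :
    f x = ∑ j, f (b j) * b.coord j x := by
  obtain ⟨c, g, h⟩ := exists_affine_of_mem_polySpace_one hf
  have h1 : ∑ k, b.coord k x • b k = x := b.linear_combination_coord_eq_self x
  have h2 := b.sum_coord_apply_eq_one x
  simp_rw [h, add_mul, Finset.sum_add_distrib, ← Finset.mul_sum, h2, mul_one]
  conv_lhs => rw [← h1]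
  rw [inner_sum]
  simp_rw [inner_smul_right, mul_comm]

/-- On each face u is affine, hence fixed by its values at the vertices of that face, and there
η_{z_F} = 0. The affine pieces are thus the restrictions of one affine function on ℝⁿ, a smooth lift
of u. -/
theorem IsContFacePoly.eq_sum_coord {u : EucN n → ℝ} (hu : IsContFacePoly b 1 u) {x : EucN n}
    (hx : x ∈ frontier (openSimplex b)) : ∑ j, u (b j) * b.coord j x = u x := by
  obtain ⟨i, hi, hxi⟩ := exists_coord_eq_zero_of_mem_frontier b hx
  obtain ⟨p, hp, hup⟩ := hu.2 i
  rw [hup x hxi, eq_sum_coord_of_mem_polySpace_one b hp x]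
  refine Finset.sum_congr rfl fun j _ => ?_
  by_cases hj : j = i
  · rw [hj, hi, mul_zero, mul_zero]
  · rw [hup (b j) (subset_convexHull ℝ _ ⟨j, hj, rfl⟩)]

end

theorem l2Proj_spec {n : ℕ} {F : Type*} [NormedAddCommGroup F] [InnerProductSpace ℝ F]
    {T : Set (EucN n)} {V : Submodule ℝ (EucN n → F)} {f p : EucN n → F}
    (h : IsL2Proj T V f p) : IsL2Proj T V f (l2Proj T V f) := by
  have h' : ∃ p, IsL2Proj T V f p := ⟨p, h⟩
  rw [l2Proj, dif_pos h']
  exact h'.choose_spec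

section

variable {n : ℕ} (b : AffineBasis (Fin (n + 1)) ℝ (EucN n))

/-- The mean value witnesses that a projection exists, which the choice in `l2Proj` needs;
afterwards only its orthogonality to constants is used. -/
theorem exists_l2Proj_polyVecSpace_zero {τ : EucN n → EucN n}
    (hτ : MemLp τ 2 (volume.restrict (openSimplex b))) :
    ∃ c, l2Proj (openSimplex b) (polyVecSpace n 0) τ = (fun _ => c) ∧
      ∀ e, ∫ x in openSimplex b, inner ℝ e (τ x - c) = 0 := by
  have hfin := isFiniteMeasure_restrict_of_isBounded (isBounded_openSimplex b)
  have hV := measureReal_openSimplex_pos b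
  have hint : Integrable τ (volume.restrict (openSimplex b)) := hτ.integrable (by norm_num)
  have hp : IsL2Proj (openSimplex b) (polyVecSpace n 0) τ
      fun _ => (volume.real (openSimplex b))⁻¹ • ∫ x in openSimplex b, τ x := by
    refine ⟨mem_polyVecSpace_zero.2 ⟨_, rfl⟩, fun r hr => ?_⟩
    obtain ⟨e, rfl⟩ := mem_polyVecSpace_zero.1 hr
    rw [integral_inner (f := fun x => τ x - _) (hint.sub (integrable_const _)),
      integral_sub hint (integrable_const _), setIntegral_const, smul_smul,
      mul_inv_cancel₀ hV.ne', one_smul, sub_self, inner_zero_right]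
  obtain ⟨h1, h2⟩ := l2Proj_spec hp
  obtain ⟨c, hc⟩ := mem_polyVecSpace_zero.1 h1
  refine ⟨c, hc, fun e => ?_⟩
  have := h2 _ (mem_polyVecSpace_zero.2 ⟨e, rfl⟩)
  rwa [hc] at this

theorem memHDiv_const (c : EucN n) : MemHDiv (openSimplex b) fun _ => c := by
  simpa using memHDiv_smul_const (isBounded_openSimplex b) (contDiff_const (c := (1 : ℝ))) c

theorem hasWeakDiv_const (c : EucN n) : HasWeakDiv (openSimplex b) (fun _ => c) fun _ => 0 := by
  simpa using hasWeakDiv_smul_const (isBounded_openSimplex b) (contDiff_const (c := (1 : ℝ))) c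

/-- The constant part that the preliminary operators reproduce before the face correction. -/
def fortinMean (b : AffineBasis (Fin (n + 1)) ℝ (EucN n)) :
    FortinVariant → (EucN n → EucN n) → EucN n → EucN n
  | .rt, _ => 0
  | .br, τ => l2Proj (openSimplex b) (polyVecSpace n 0) τ

/-- The face basis functions of the two variants. -/
def faceFun (b : AffineBasis (Fin (n + 1)) ℝ (EucN n)) :
    FortinVariant → Fin (n + 1) → EucN n → EucN n
  | .rt, i => rtFun b i
  | .br, i => brFun b i

/-- The pairing of `faceFun b j i` with a vertex function of the face `i`. -/
def faceWeight (b : AffineBasis (Fin (n + 1)) ℝ (EucN n)) : FortinVariant → Fin (n + 1) → ℝ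
  | .rt, i => ‖coordGrad b i‖ * volume.real (openSimplex b)
  | .br, i => 2 * ‖coordGrad b i‖ *
      ∫ x in openSimplex b, ∏ j ∈ Finset.univ.erase i, b.coord j x

/-- The coefficient of `faceFun b j i` in the preliminary operators. -/
def faceCoeff (b : AffineBasis (Fin (n + 1)) ℝ (EucN n)) (j : FortinVariant)
    (τ : EucN n → EucN n) (i : Fin (n + 1)) : ℝ :=
  normalPairing (openSimplex b) (τ - fortinMean b j τ) (nuFun b i) /
    normalPairing (openSimplex b) (faceFun b j i) (nuFun b i)

/-- With zero mean part in the Raviart–Thomas case, both variants take one form: a constant plus a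
combination of face functions. The arguments on the Fortin conditions then run once for both. -/
theorem preFortin_eq (j : FortinVariant) (τ : EucN n → EucN n) :
    preFortin b j τ = fortinMean b j τ + ∑ i, faceCoeff b j τ i • faceFun b j i := by
  cases j
  · simp [preFortin, fortinMean, faceFun, faceCoeff]
  · rfl

theorem exists_fortinMean_eq (j : FortinVariant) {τ : EucN n → EucN n}
    (hτ : MemLp τ 2 (volume.restrict (openSimplex b))) :
    ∃ c, fortinMean b j τ = fun _ => c := by
  cases j
  · exact ⟨0, rfl⟩
  · obtain ⟨c, hc, -⟩ := exists_l2Proj_polyVecSpace_zero b hτ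
    exact ⟨c, hc⟩

theorem memHDiv_fortinMean (j : FortinVariant) {τ : EucN n → EucN n}
    (hτ : MemLp τ 2 (volume.restrict (openSimplex b))) :
    MemHDiv (openSimplex b) (fortinMean b j τ) := by
  obtain ⟨c, hc⟩ := exists_fortinMean_eq b j hτ
  rw [hc]
  exact memHDiv_const b c

theorem memHDiv_faceFun (j : FortinVariant) (i : Fin (n + 1)) :
    MemHDiv (openSimplex b) (faceFun b j i) := by
  cases j
  · exact memHDiv_rtFun b i
  · exact memHDiv_brFun b i

theorem normalPairing_faceFun_coord (j : FortinVariant) (i k : Fin (n + 1)) :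
    normalPairing (openSimplex b) (faceFun b j i) (fun x => b.coord k x) =
      if i = k then 0 else faceWeight b j i := by
  cases j
  · exact normalPairing_rtFun_coord b i k
  · exact normalPairing_brFun_coord b i k

theorem integral_pos_of_pos {f : EucN n → ℝ} (hf : Continuous f)
    (hpos : ∀ x ∈ openSimplex b, 0 < f x) : 0 < ∫ x in openSimplex b, f x := by
  have hfin := isFiniteMeasure_restrict_of_isBounded (isBounded_openSimplex b)
  have hint : Integrable f (volume.restrict (openSimplex b)) :=
    (memLp_of_continuous_of_isBounded (isBounded_openSimplex b) hf).integrable (by norm_num)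
  rw [setIntegral_pos_iff_support_of_nonneg_ae _ hint]
  · refine lt_of_lt_of_le ((isOpen_openSimplex b).measure_pos volume (nonempty_openSimplex b))
      (measure_mono fun x hx => ⟨(hpos x hx).ne', hx⟩)
  · filter_upwards [ae_restrict_mem (isOpen_openSimplex b).measurableSet] with x hx
    exact (hpos x hx).le

theorem norm_coordGrad_pos (hn : 1 ≤ n) (i : Fin (n + 1)) : 0 < ‖coordGrad b i‖ :=
  norm_pos_iff.2 (coordGrad_ne_zero hn b i)

theorem faceWeight_pos (hn : 1 ≤ n) (j : FortinVariant) (i : Fin (n + 1)) :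
    0 < faceWeight b j i := by
  have h := norm_coordGrad_pos b hn i
  cases j
  · exact mul_pos h (measureReal_openSimplex_pos b)
  · refine mul_pos (by positivity) (integral_pos_of_pos b (contDiff_prod_coord b _ (k := 0)).continuous
      fun _ hx => Finset.prod_pos fun l _ => (mem_openSimplex b).1 hx l)

/-- The integral of the divergence is the sum of the coordinate pairings, namely n times the weight;
subtracting n times the pairing with η_k leaves 0 for k ≠ i and everything for k = i. -/
theorem normalPairing_faceFun_nuFun (j : FortinVariant) (i k : Fin (n + 1)) :
    normalPairing (openSimplex b) (faceFun b j i) (nuFun b k) =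
      if i = k then n * faceWeight b j i else 0 := by
  have h := memHDiv_faceFun b j i
  rw [normalPairing_nuFun_eq_sub b h.hasWeakDiv h.1, ← sum_normalPairing_coord b h.hasWeakDiv h.1]
  simp_rw [normalPairing_faceFun_coord]
  have : ∑ l, (if i = l then 0 else faceWeight b j i) = n * faceWeight b j i := by
    rw [← Finset.add_sum_erase _ _ (Finset.mem_univ i), if_pos rfl, zero_add,
      Finset.sum_congr rfl fun l hl => if_neg (Finset.ne_of_mem_erase hl).symm]
    simp
  rw [this]
  split_ifs <;> ring

theorem memHDiv_preFortin (j : FortinVariant) {τ : EucN n → EucN n}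
    (hτ : MemLp τ 2 (volume.restrict (openSimplex b))) :
    MemHDiv (openSimplex b) (preFortin b j τ) := by
  rw [preFortin_eq]
  exact (memHDiv_fortinMean b j hτ).add
    (MemHDiv.finset_sum _ fun i _ => (memHDiv_faceFun b j i).const_smul _)

theorem memHDiv_fortinOp (s : Fin (n + 1)) (j : FortinVariant) {τ : EucN n → EucN n}
    (hτ : MemLp τ 2 (volume.restrict (openSimplex b))) :
    MemHDiv (openSimplex b) (fortinOp b s j τ) :=
  (memHDiv_preFortin b j hτ).add
    (MemHDiv.finset_sum _ fun k _ => (memHDiv_edgeFun b s k).const_smul _)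

theorem normalPairing_sub_preFortin_nuFun (hn : 1 ≤ n) (j : FortinVariant) {τ : EucN n → EucN n}
    (hτ : MemHDiv (openSimplex b) τ) (k : Fin (n + 1)) :
    normalPairing (openSimplex b) (τ - preFortin b j τ) (nuFun b k) = 0 := by
  have hT := isOpen_openSimplex b
  have hTb := isBounded_openSimplex b
  have hm := memHDiv_fortinMean b j hτ.1
  have hf := fun i => (memHDiv_faceFun b j i).const_smul (faceCoeff b j τ i)
  have hne : (n : ℝ) * faceWeight b j k ≠ 0 :=
    mul_ne_zero (by positivity) (faceWeight_pos b hn j k).ne'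
  rw [preFortin_eq, ← sub_sub, normalPairing_sub hT hTb (hτ.sub hm)
    (MemHDiv.finset_sum _ fun i _ => hf i) (contDiff_nuFun b k),
    normalPairing_finset_sum hT hTb _ (fun i _ => hf i) (contDiff_nuFun b k)]
  simp_rw [normalPairing_const_smul hT hTb (memHDiv_faceFun b j _) _ (contDiff_nuFun b k),
    normalPairing_faceFun_nuFun]
  rw [Finset.sum_eq_single k (fun i _ hik => by rw [if_neg hik, mul_zero]) (by simp), if_pos rfl,
    faceCoeff, normalPairing_faceFun_nuFun, if_pos rfl, div_mul_cancel₀ _ hne, sub_self]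

/-- The hypotheses make n times each coordinate pairing equal to m = ∫ div τ. Summing n + 1 of them
gives n m = (n + 1) m, so m = 0. -/
theorem normalPairing_coord_eq_zero (hn : 1 ≤ n) {τ : EucN n → EucN n}
    (hτ : MemHDiv (openSimplex b) τ)
    (h : ∀ k, normalPairing (openSimplex b) τ (nuFun b k) = 0) (k : Fin (n + 1)) :
    normalPairing (openSimplex b) τ (fun x => b.coord k x) = 0 := by
  have hn0 : (n : ℝ) ≠ 0 := by positivity
  have h1 : ∀ k, (n : ℝ) * normalPairing (openSimplex b) τ (fun x => b.coord k x) =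
      ∫ x in openSimplex b, weakDiv (openSimplex b) τ x := fun k => by
    have := normalPairing_nuFun_eq_sub b hτ.hasWeakDiv hτ.1 k
    rw [h k] at this
    linarith
  have h2 := congrArg (fun z => (n : ℝ) * z) (sum_normalPairing_coord b hτ.hasWeakDiv hτ.1)
  simp only [Finset.mul_sum, h1] at h2
  have h3 : ∫ x in openSimplex b, weakDiv (openSimplex b) τ x = 0 := by
    simp at h2
    linarith
  have := h1 k
  rw [h3] at this
  exact (mul_eq_zero.1 this).resolve_left hn0

/-- The face correction matches the pairings with all ν_F, hence those with all coordinates, and the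
edge correction does not change them. -/
theorem normalPairing_sub_fortinOp_coord (hn : 1 ≤ n) (s : Fin (n + 1)) (j : FortinVariant)
    {τ : EucN n → EucN n} (hτ : MemHDiv (openSimplex b) τ) (k : Fin (n + 1)) :
    normalPairing (openSimplex b) (τ - fortinOp b s j τ) (fun x => b.coord k x) = 0 := by
  have hT := isOpen_openSimplex b
  have hTb := isBounded_openSimplex b
  have hp := hτ.sub (memHDiv_preFortin b j hτ.1)
  have he := fun (k : Fin (n + 1)) (c : ℝ) => (memHDiv_edgeFun b s k).const_smul c
  have hk : ContDiff ℝ 1 fun x => b.coord k x := contDiff_coord b k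
  rw [fortinOp, ← sub_sub, normalPairing_sub hT hTb hp (MemHDiv.finset_sum _ fun k _ => he k _) hk,
    normalPairing_coord_eq_zero b hn hp
      (normalPairing_sub_preFortin_nuFun b hn j hτ), normalPairing_finset_sum hT hTb _ (fun k _ => he k _) hk]
  simp_rw [normalPairing_const_smul hT hTb (memHDiv_edgeFun b s _) _ hk,
    normalPairing_edgeFun_coord]
  simp

theorem integral_coord_mul_coord_pos (s k : Fin (n + 1)) :
    0 < ∫ x in openSimplex b, b.coord s x * b.coord k x :=
  integral_pos_of_pos b ((continuous_coord b s).mul (continuous_coord b k)) fun _ hx =>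
    mul_pos ((mem_openSimplex b).1 hx s) ((mem_openSimplex b).1 hx k)

/-- The coefficient of `edgeFun b s k` in the Fortin operators. -/
def edgeCoeff (b : AffineBasis (Fin (n + 1)) ℝ (EucN n)) (s : Fin (n + 1)) (j : FortinVariant)
    (τ : EucN n → EucN n) (k : Fin (n + 1)) : ℝ :=
  (∫ x in openSimplex b, inner ℝ (edgeSigma b k) (τ x - preFortin b j τ x)) /
    ∫ x in openSimplex b, inner ℝ (edgeSigma b k) (edgeFun b s k x)

theorem fortinOp_eq (s : Fin (n + 1)) (j : FortinVariant) (τ : EucN n → EucN n) :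
    fortinOp b s j τ =
      preFortin b j τ + ∑ k ∈ Finset.univ.erase s, edgeCoeff b s j τ k • edgeFun b s k :=
  rfl

theorem integral_edgeSigma_sub_fortinOp {s k : Fin (n + 1)} (hk : k ≠ s) (j : FortinVariant)
    {τ : EucN n → EucN n} (hτ : MemHDiv (openSimplex b) τ) :
    ∫ x in openSimplex b, inner ℝ (edgeSigma b k) (τ x - fortinOp b s j τ x) = 0 := by
  have hc := memLp_const_openSimplex b (edgeSigma b k)
  have hp : MemLp (fun x => τ x - preFortin b j τ x) 2 (volume.restrict (openSimplex b)) :=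
    (hτ.sub (memHDiv_preFortin b j hτ.1)).1
  have he := fun l => integrable_inner_of_memLp hc (memHDiv_edgeFun b s l).1
  have e : ∀ x, inner ℝ (edgeSigma b k) (τ x - fortinOp b s j τ x) =
      inner ℝ (edgeSigma b k) (τ x - preFortin b j τ x) -
        ∑ l ∈ Finset.univ.erase s, edgeCoeff b s j τ l *
          inner ℝ (edgeSigma b k) (edgeFun b s l x) := fun x => by
    simp_rw [← inner_smul_right]
    rw [← inner_sum, ← inner_sub_right, fortinOp_eq, Pi.add_apply, Finset.sum_apply, sub_sub]
    rfl
  simp_rw [e]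
  rw [integral_sub (integrable_inner_of_memLp hc hp)
    (integrable_finsetSum _ fun l _ => (he l).const_mul _),
    integral_finsetSum _ fun l _ => (he l).const_mul _]
  simp_rw [integral_const_mul, integral_edgeSigma_edgeFun b hk]
  rw [Finset.sum_eq_single k (fun l _ hl => by rw [if_neg (Ne.symm hl), mul_zero])
    (fun h => absurd (Finset.mem_erase.2 ⟨hk, Finset.mem_univ k⟩) h), if_pos rfl, edgeCoeff,
    integral_edgeSigma_edgeFun b hk, if_pos rfl,
    div_mul_cancel₀ _ (integral_coord_mul_coord_pos b s k).ne', sub_self]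

/-- The edge coefficients are chosen so that the moments with each σ_E agree, and the σ_E form a
basis of ℝⁿ dual to the edge vectors at b_s. -/
theorem integral_inner_const_sub_fortinOp (s : Fin (n + 1)) (j : FortinVariant)
    {τ : EucN n → EucN n} (hτ : MemHDiv (openSimplex b) τ) (c : EucN n) :
    ∫ x in openSimplex b, inner ℝ c (τ x - fortinOp b s j τ x) = 0 := by
  have hp := hτ.sub (memHDiv_fortinOp b s j hτ.1)
  have e : ∀ v : EucN n, inner ℝ c v =
      ∑ k ∈ Finset.univ.erase s, inner ℝ c (b k - b s) * inner ℝ (edgeSigma b k) v := fun v => by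
    conv_lhs => rw [← sum_inner_coordGrad_smul b s v]
    rw [inner_sum]
    refine Finset.sum_congr rfl fun k _ => ?_
    rw [inner_smul_right, mul_comm]
    rfl
  have hp' : MemLp (fun x => τ x - fortinOp b s j τ x) 2 (volume.restrict (openSimplex b)) := hp.1
  have e' : ∀ x, inner ℝ c (τ x - fortinOp b s j τ x) = _ := fun x => e _
  simp_rw [e']
  rw [integral_finsetSum _ fun k _ =>
    (integrable_inner_of_memLp (memLp_const_openSimplex b (edgeSigma b k)) hp').const_mul _]
  refine Finset.sum_eq_zero fun k hk => ?_
  rw [integral_const_mul, integral_edgeSigma_sub_fortinOp b (Finset.ne_of_mem_erase hk) j hτ, mul_zero]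

theorem hasNormalPairing_sub_fortinOp (hn : 1 ≤ n) (s : Fin (n + 1)) (j : FortinVariant)
    {τ : EucN n → EucN n} (hτ : MemHDiv (openSimplex b) τ) {u : EucN n → ℝ}
    (hu : IsContFacePoly b 1 u) :
    HasNormalPairing (openSimplex b) (τ - fortinOp b s j τ) u 0 := by
  have hT := isOpen_openSimplex b
  have hTb := isBounded_openSimplex b
  have hp := hτ.sub (memHDiv_fortinOp b s j hτ.1)
  have hv : ContDiff ℝ 1 fun x => ∑ i, u (b i) * b.coord i x :=
    ContDiff.sum fun i _ => contDiff_const.mul (contDiff_coord b i)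
  have h := hasNormalPairing_of_contDiff hT hTb hp hv fun x hx => hu.eq_sum_coord b hx
  convert h using 1
  have hd := hp.hasWeakDiv
  have hg : ∀ x, gradient (fun x => ∑ i, u (b i) * b.coord i x) x =
      ∑ i, u (b i) • coordGrad b i := fun x => by
    refine gradient_eq_of_fderiv fun e => ?_
    have h : HasFDerivAt (fun x => ∑ i, u (b i) * b.coord i x) _ x :=
      HasFDerivAt.fun_sum fun i _ => (hasFDerivAt_coord b i x).const_mul (u (b i))
    rw [h.fderiv, sum_inner]
    simp [inner_smul_left]
  -- The pairing is linear in the lift ∑ u(b_i) η_i, so it is a combination of the vanishing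
  -- coordinate pairings.
  rw [normalPairing_of_contDiff hT hTb hd hp.1 hv]
  simp_rw [hg, inner_sum, inner_smul_right, Finset.mul_sum]
  rw [integral_finsetSum _ fun i _ => integrable_mul_of_memLp hd.1 ((memLp_coord b i).const_mul _),
    integral_finsetSum _ fun i _ => (integrable_inner_of_memLp hp.1
      (memLp_const_openSimplex b (coordGrad b i))).const_mul _, ← Finset.sum_add_distrib]
  refine (Finset.sum_eq_zero fun i _ => ?_).symm
  have h0 := normalPairing_sub_fortinOp_coord b hn s j hτ i
  rw [normalPairing_coord b hd hp.1] at h0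
  simp_rw [mul_left_comm _ (u (b i)), real_inner_comm (coordGrad b i)]
  rw [integral_const_mul, integral_const_mul, ← mul_add]
  simp_rw [real_inner_comm _ (coordGrad b i)] at h0 ⊢
  rw [h0, mul_zero]

theorem rtFun_mem_rtSpace (i : Fin (n + 1)) : rtFun b i ∈ rtSpace n :=
  ⟨-(‖coordGrad b i‖ • b i), ‖coordGrad b i‖, fun x => by rw [rtFun]; module⟩

theorem preFortin_mem_preSpace (j : FortinVariant) {τ : EucN n → EucN n}
    (hτ : MemLp τ 2 (volume.restrict (openSimplex b))) : preFortin b j τ ∈ preSpace b j := by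
  rw [preFortin_eq]
  cases j
  · exact add_mem (zero_mem _) (sum_mem fun i _ => Submodule.smul_mem _ _ (rtFun_mem_rtSpace b i))
  · obtain ⟨c, hc⟩ := exists_fortinMean_eq b .br hτ
    refine Submodule.add_mem_sup (mem_polyVecSpace_zero.2 ⟨c, hc⟩)
      (sum_mem fun i _ => Submodule.smul_mem _ _ (Submodule.subset_span ⟨i, rfl⟩))

theorem fortinOp_mem_fortinSpace (s : Fin (n + 1)) (j : FortinVariant) {τ : EucN n → EucN n}
    (hτ : MemLp τ 2 (volume.restrict (openSimplex b))) :
    fortinOp b s j τ ∈ fortinSpace b s j :=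
  Submodule.add_mem_sup (preFortin_mem_preSpace b j hτ) (sum_mem fun k hk =>
    Submodule.smul_mem _ _ (Submodule.subset_span ⟨k, Finset.ne_of_mem_erase hk, rfl⟩))

end

end

/-! ### L² norms, the commuting property and reproduction of the base spaces -/

noncomputable section

open Filter Topology Set Metric

section

variable {n : ℕ} {T : Set (EucN n)} {F : Type*} [NormedAddCommGroup F]

theorem l2Norm_eq_toReal_eLpNorm {f : EucN n → F} (hf : MemLp f 2 (volume.restrict T)) :
    l2Norm T f = (eLpNorm f 2 (volume.restrict T)).toReal := by
  rw [l2Norm, hf.eLpNorm_eq_integral_rpow_norm (by norm_num) (by norm_num),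
    ENNReal.toReal_ofReal (by positivity), Real.sqrt_eq_rpow]
  simp

theorem l2Norm_nonneg (T : Set (EucN n)) (f : EucN n → F) : 0 ≤ l2Norm T f := Real.sqrt_nonneg _

theorem l2Norm_congr_ae {f g : EucN n → F} (h : f =ᵐ[volume.restrict T] g) :
    l2Norm T f = l2Norm T g := by
  rw [l2Norm, l2Norm]
  congr 1
  refine integral_congr_ae ?_
  filter_upwards [h] with x hx
  rw [hx]

theorem l2Norm_add_le {f g : EucN n → F} (hf : MemLp f 2 (volume.restrict T))
    (hg : MemLp g 2 (volume.restrict T)) : l2Norm T (f + g) ≤ l2Norm T f + l2Norm T g := by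
  rw [l2Norm_eq_toReal_eLpNorm hf, l2Norm_eq_toReal_eLpNorm hg,
    l2Norm_eq_toReal_eLpNorm (hf.add hg), ← ENNReal.toReal_add hf.2.ne hg.2.ne]
  exact ENNReal.toReal_mono (ENNReal.add_ne_top.2 ⟨hf.2.ne, hg.2.ne⟩)
    (eLpNorm_add_le hf.1 hg.1 (by norm_num))

theorem l2Norm_sub_le {f g : EucN n → F} (hf : MemLp f 2 (volume.restrict T))
    (hg : MemLp g 2 (volume.restrict T)) : l2Norm T (f - g) ≤ l2Norm T f + l2Norm T g := by
  rw [l2Norm_eq_toReal_eLpNorm hf, l2Norm_eq_toReal_eLpNorm hg,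
    l2Norm_eq_toReal_eLpNorm (hf.sub hg), ← ENNReal.toReal_add hf.2.ne hg.2.ne]
  exact ENNReal.toReal_mono (ENNReal.add_ne_top.2 ⟨hf.2.ne, hg.2.ne⟩)
    (eLpNorm_sub_le hf.1 hg.1 (by norm_num))

theorem l2Norm_const_smul [NormedSpace ℝ F] (c : ℝ) (f : EucN n → F) :
    l2Norm T (c • f) = |c| * l2Norm T f := by
  simp_rw [l2Norm, Pi.smul_apply, norm_smul, mul_pow]
  rw [integral_const_mul, Real.sqrt_mul (by positivity), Real.norm_eq_abs,
    Real.sqrt_sq (abs_nonneg c)]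

theorem l2Norm_sum_le {ι : Type*} (s : Finset ι) {f : ι → EucN n → F}
    (hf : ∀ i ∈ s, MemLp (f i) 2 (volume.restrict T)) {M : ℝ} (hM : ∀ i ∈ s, l2Norm T (f i) ≤ M) :
    l2Norm T (∑ i ∈ s, f i) ≤ s.card * M := by
  classical
  induction s using Finset.induction_on with
  | empty => simp [l2Norm]
  | insert a s ha ih =>
    have h1 := hf a (Finset.mem_insert_self _ _)
    have h2 : ∀ i ∈ s, MemLp (f i) 2 (volume.restrict T) :=
      fun i hi => hf i (Finset.mem_insert_of_mem hi)
    rw [Finset.sum_insert ha, Finset.card_insert_of_notMem ha]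
    refine (l2Norm_add_le h1 (memLp_finsetSum' s h2)).trans ?_
    have h3 := ih h2 fun i hi => hM i (Finset.mem_insert_of_mem hi)
    have h4 := hM a (Finset.mem_insert_self _ _)
    push_cast
    linarith

theorem abs_integral_inner_le_l2Norm [InnerProductSpace ℝ F] {f g : EucN n → F}
    (hf : MemLp f 2 (volume.restrict T)) (hg : MemLp g 2 (volume.restrict T)) :
    |∫ x in T, inner ℝ (f x) (g x)| ≤ l2Norm T f * l2Norm T g := by
  rw [l2Norm_eq_toReal_eLpNorm hf, l2Norm_eq_toReal_eLpNorm hg]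
  exact abs_integral_inner_le hf hg

theorem abs_integral_mul_le_l2Norm {f g : EucN n → ℝ}
    (hf : MemLp f 2 (volume.restrict T)) (hg : MemLp g 2 (volume.restrict T)) :
    |∫ x in T, f x * g x| ≤ l2Norm T f * l2Norm T g := by
  have := abs_integral_inner_le_l2Norm hf hg
  simpa [mul_comm] using this

theorem l2Norm_sq (f : EucN n → F) : l2Norm T f ^ 2 = ∫ x in T, ‖f x‖ ^ 2 :=
  Real.sq_sqrt (by positivity)

theorem l2Norm_le_of_forall_norm_le (hT : MeasurableSet T) (hTb : Bornology.IsBounded T)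
    {f : EucN n → F} {M : ℝ} (hM0 : 0 ≤ M) (hM : ∀ x ∈ T, ‖f x‖ ≤ M) :
    l2Norm T f ≤ M * √(volume.real T) := by
  have hfin := isFiniteMeasure_restrict_of_isBounded hTb
  rw [l2Norm, ← Real.sqrt_sq hM0, ← Real.sqrt_mul (by positivity)]
  refine Real.sqrt_le_sqrt ?_
  have h : ∫ x in T, ‖f x‖ ^ 2 ≤ ∫ x in T, M ^ 2 := by
    refine integral_mono_of_nonneg (Eventually.of_forall fun x => by positivity)
      (integrable_const _) ?_
    filter_upwards [ae_restrict_mem hT] with x hx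
    have := hM x hx
    gcongr
  refine h.trans (le_of_eq ?_)
  rw [setIntegral_const, smul_eq_mul, mul_comm]

theorem l2Norm_le_of_isL2Proj [InnerProductSpace ℝ F] {V : Submodule ℝ (EucN n → F)}
    {f p : EucN n → F} (hf : MemLp f 2 (volume.restrict T)) (hp : MemLp p 2 (volume.restrict T))
    (h : IsL2Proj T V f p) : l2Norm T p ≤ l2Norm T f := by
  have h1 := h.2 p h.1
  simp_rw [inner_sub_right] at h1
  rw [integral_sub (integrable_inner_of_memLp hp hf) (integrable_inner_of_memLp hp hp)] at h1
  simp_rw [real_inner_self_eq_norm_sq] at h1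
  rw [← l2Norm_sq] at h1
  have h2 := (le_abs_self _).trans (abs_integral_inner_le_l2Norm hp hf)
  have h3 := l2Norm_nonneg T p
  by_contra! hlt
  have h4 : 0 < l2Norm T p := (l2Norm_nonneg T f).trans_lt hlt
  nlinarith

theorem IsL2Proj.ae_unique [InnerProductSpace ℝ F] {V : Submodule ℝ (EucN n → F)}
    {f p q : EucN n → F} (hf : MemLp f 2 (volume.restrict T))
    (hV : ∀ r ∈ V, MemLp r 2 (volume.restrict T))
    (hp : IsL2Proj T V f p) (hq : IsL2Proj T V f q) : p =ᵐ[volume.restrict T] q := by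
  have hr := V.sub_mem hp.1 hq.1
  have hrL := hV _ hr
  have h1 := hp.2 _ hr
  have h2 := hq.2 _ hr
  have h3 : ∫ x in T, ‖(p - q) x‖ ^ 2 = 0 := by
    rw [← sub_self (0 : ℝ)]
    nth_rewrite 1 [← h2]
    have hfq : MemLp (fun x => f x - q x) 2 (volume.restrict T) := hf.sub (hV _ hq.1)
    have hfp : MemLp (fun x => f x - p x) 2 (volume.restrict T) := hf.sub (hV _ hp.1)
    rw [← h1, ← integral_sub (integrable_inner_of_memLp hrL hfq)
      (integrable_inner_of_memLp hrL hfp)]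
    refine integral_congr_ae (Eventually.of_forall fun x => ?_)
    simp only [Pi.sub_apply]
    rw [← inner_sub_right, sub_sub_sub_cancel_left, real_inner_self_eq_norm_sq]
  rw [integral_eq_zero_iff_of_nonneg (fun x => by positivity)
    (hrL.norm.integrable_sq)] at h3
  filter_upwards [h3] with x hx
  have : ‖(p - q) x‖ = 0 := by simpa using hx
  rw [norm_eq_zero, Pi.sub_apply, sub_eq_zero] at this
  exact this

end

section

variable {n : ℕ} (b : AffineBasis (Fin (n + 1)) ℝ (EucN n))

theorem continuous_of_mem_polySpace_one {r : EucN n → ℝ} (hr : r ∈ polySpace n 1) :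
    Continuous r := by
  obtain ⟨c, g, h⟩ := exists_affine_of_mem_polySpace_one hr
  rw [show r = fun x => c + inner ℝ g x from funext h]
  fun_prop

theorem const_mem_polySpace_one (c : ℝ) : (fun _ => c) ∈ polySpace n 1 := by
  simpa using affine_mem_polySpace_one c (0 : EucN n)

/-- The divergence of the Fortin operator built on the Raviart–Thomas space. -/
def fortinDivRt (b : AffineBasis (Fin (n + 1)) ℝ (EucN n)) (s : Fin (n + 1))
    (τ : EucN n → EucN n) : EucN n → ℝ :=
  (∑ i, faceCoeff b .rt τ i • fun _ => (n : ℝ) * ‖coordGrad b i‖) +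
    ∑ k ∈ Finset.univ.erase s, edgeCoeff b s .rt τ k • fun x => b.coord s x - b.coord k x

theorem hasWeakDiv_sum_edgeFun (s : Fin (n + 1)) (e : Fin (n + 1) → ℝ) :
    HasWeakDiv (openSimplex b) (∑ k ∈ Finset.univ.erase s, e k • edgeFun b s k)
      (∑ k ∈ Finset.univ.erase s, e k • fun x => b.coord s x - b.coord k x) :=
  HasWeakDiv.finset_sum _
    (fun _ hk => (hasWeakDiv_edgeFun b (Finset.ne_of_mem_erase hk)).const_smul _)
    fun k _ => (memHDiv_edgeFun b s k).1.const_smul _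

theorem hasWeakDiv_fortinOp_rt (s : Fin (n + 1)) (τ : EucN n → EucN n) :
    HasWeakDiv (openSimplex b) (fortinOp b s .rt τ) (fortinDivRt b s τ) := by
  have h1 : HasWeakDiv (openSimplex b) (∑ i, faceCoeff b .rt τ i • rtFun b i)
      (∑ i, faceCoeff b .rt τ i • fun _ => (n : ℝ) * ‖coordGrad b i‖) :=
    HasWeakDiv.finset_sum _ (fun i _ => (hasWeakDiv_rtFun b i).const_smul _)
      fun i _ => (memHDiv_rtFun b i).1.const_smul _
  have h1m : MemLp (∑ i, faceCoeff b .rt τ i • rtFun b i) 2 (volume.restrict (openSimplex b)) :=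
    memLp_finsetSum' _ fun i _ => (memHDiv_rtFun b i).1.const_smul _
  have h := h1.add (hasWeakDiv_sum_edgeFun b s (edgeCoeff b s .rt τ)) h1m
    (memLp_finsetSum' _ fun k _ => (memHDiv_edgeFun b s k).1.const_smul _)
  have e : fortinOp b s .rt τ = (∑ i, faceCoeff b .rt τ i • rtFun b i) +
      ∑ k ∈ Finset.univ.erase s, edgeCoeff b s .rt τ k • edgeFun b s k := by
    rw [fortinOp_eq, preFortin_eq]
    simp [fortinMean, faceFun]
  rw [e]
  exact h

/-- For the error e = τ - Π¹τ, (div e, η_j) is the pairing with η_j minus the moment with the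
constant ∇η_j. Both vanish by the Fortin conditions, and the η_j span P¹. -/
theorem isL2Proj_fortinDivRt (hn : 1 ≤ n) (s : Fin (n + 1)) {τ : EucN n → EucN n}
    (hτ : MemHDiv (openSimplex b) τ) :
    IsL2Proj (openSimplex b) (polySpace n 1) (weakDiv (openSimplex b) τ) (fortinDivRt b s τ) := by
  have hq := hasWeakDiv_fortinOp_rt b s τ
  refine ⟨add_mem (sum_mem fun i _ => Submodule.smul_mem _ _ (const_mem_polySpace_one _))
    (sum_mem fun k _ => Submodule.smul_mem _ _
      (sub_mem (coord_mem_polySpace_one b s) (coord_mem_polySpace_one b k))), fun r hr => ?_⟩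
  have hd := hτ.hasWeakDiv.sub hq hτ.1 (memHDiv_fortinOp b s .rt hτ.1).1
  have hL := (hτ.sub (memHDiv_fortinOp b s .rt hτ.1)).1
  have h0 : ∀ j, ∫ x in openSimplex b,
      (weakDiv (openSimplex b) τ x - fortinDivRt b s τ x) * b.coord j x = 0 := fun j => by
    have h1 := normalPairing_sub_fortinOp_coord b hn s .rt hτ j
    rw [normalPairing_coord b hd hL] at h1
    have h2 := integral_inner_const_sub_fortinOp b s .rt hτ (coordGrad b j)
    simp only [Pi.sub_apply] at h1
    linarith
  have e : ∀ x, inner ℝ (r x) (weakDiv (openSimplex b) τ x - fortinDivRt b s τ x) =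
      ∑ j, r (b j) * ((weakDiv (openSimplex b) τ x - fortinDivRt b s τ x) * b.coord j x) := by
    intro x
    rw [eq_sum_coord_of_mem_polySpace_one b hr x, real_inner_eq_re_inner, RCLike.inner_apply]
    simp only [conj_trivial, RCLike.re_to_real, Finset.mul_sum]
    exact Finset.sum_congr rfl fun j _ => by ring
  simp_rw [e]
  have hd1 : MemLp (fun x => weakDiv (openSimplex b) τ x - fortinDivRt b s τ x) 2
    (volume.restrict (openSimplex b)) := hd.1
  rw [integral_finsetSum _ fun j _ =>
    (integrable_mul_of_memLp hd1 (memLp_coord b j)).const_mul _]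
  refine Finset.sum_eq_zero fun j _ => ?_
  rw [integral_const_mul, h0, mul_zero]

theorem weakDiv_fortinOp_rt_ae_eq (s : Fin (n + 1)) {τ : EucN n → EucN n}
    (hτ : MemHDiv (openSimplex b) τ) :
    weakDiv (openSimplex b) (fortinOp b s .rt τ) =ᵐ[volume.restrict (openSimplex b)]
      fortinDivRt b s τ :=
  (memHDiv_fortinOp b s .rt hτ.1).hasWeakDiv.ae_unique (isOpen_openSimplex b)
    (isBounded_openSimplex b) (hasWeakDiv_fortinOp_rt b s τ)

theorem weakDiv_fortinOp_rt (hn : 1 ≤ n) (s : Fin (n + 1)) {τ : EucN n → EucN n}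
    (hτ : MemHDiv (openSimplex b) τ) :
    weakDiv (openSimplex b) (fortinOp b s .rt τ) =ᵐ[volume.restrict (openSimplex b)]
      l2Proj (openSimplex b) (polySpace n 1) (weakDiv (openSimplex b) τ) := by
  have h := isL2Proj_fortinDivRt b hn s hτ
  exact (weakDiv_fortinOp_rt_ae_eq b s hτ).trans
    (IsL2Proj.ae_unique hτ.hasWeakDiv.1 (fun r hr => memLp_of_continuous_of_isBounded
      (isBounded_openSimplex b) (continuous_of_mem_polySpace_one hr)) h (l2Proj_spec h))

theorem l2Norm_weakDiv_fortinOp_rt_le (hn : 1 ≤ n) (s : Fin (n + 1)) {τ : EucN n → EucN n}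
    (hτ : MemHDiv (openSimplex b) τ) :
    l2Norm (openSimplex b) (weakDiv (openSimplex b) (fortinOp b s .rt τ)) ≤
      l2Norm (openSimplex b) (weakDiv (openSimplex b) τ) := by
  rw [l2Norm_congr_ae (weakDiv_fortinOp_rt_ae_eq b s hτ)]
  exact l2Norm_le_of_isL2Proj hτ.hasWeakDiv.1 (hasWeakDiv_fortinOp_rt b s τ).1
    (isL2Proj_fortinDivRt b hn s hτ)

theorem fortinOp_eq_self_of_preFortin_eq_self (s : Fin (n + 1)) (j : FortinVariant)
    {τ : EucN n → EucN n} (h : preFortin b j τ = τ) : fortinOp b s j τ = τ := by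
  rw [fortinOp_eq, h, add_eq_left]
  refine Finset.sum_eq_zero fun k _ => ?_
  simp [edgeCoeff, h]

theorem exists_sum_rtFun_eq (hn : 1 ≤ n) {τ : EucN n → EucN n} (hτ : τ ∈ rtSpace n) :
    ∃ c : Fin (n + 1) → ℝ, τ = ∑ i, c i • rtFun b i := by
  obtain ⟨a, β, h⟩ := hτ
  have h1 : ∑ k, b.coord k (0 : EucN n) • b k = 0 := b.linear_combination_coord_eq_self 0
  have h2 : ∑ k, b.coord k a • b k = a := b.linear_combination_coord_eq_self a
  have h3 := b.sum_coord_apply_eq_one (0 : EucN n)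
  have h4 := b.sum_coord_apply_eq_one a
  -- To obtain a + βx = ∑ γ_i (x - b_i) one needs ∑ γ_i = β and ∑ γ_i b_i = -a. The barycentric
  -- expansions of 0 and of a give γ_i = β η_i(0) - (η_i(a) - η_i(0)); dividing by ‖∇η_i‖ undoes the
  -- scaling in ψ_F.
  refine ⟨fun i => ‖coordGrad b i‖⁻¹ *
    (β * b.coord i 0 - (b.coord i a - b.coord i 0)), funext fun x => ?_⟩
  have e : ∀ i, ((‖coordGrad b i‖⁻¹ * (β * b.coord i 0 - (b.coord i a - b.coord i 0))) •
      rtFun b i) x = (β * b.coord i 0 - (b.coord i a - b.coord i 0)) • (x - b i) := fun i => by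
    have := (norm_coordGrad_pos b hn i).ne'
    rw [Pi.smul_apply, rtFun, smul_smul]
    congr 1
    field_simp
  rw [h, Finset.sum_apply]
  simp_rw [e, smul_sub, Finset.sum_sub_distrib, sub_smul, mul_smul, Finset.sum_sub_distrib,
    ← Finset.smul_sum, ← Finset.sum_smul, h1, h2, h3, h4]
  module

theorem preFortin_rt_eq_self (hn : 1 ≤ n) {τ : EucN n → EucN n} (hτ : τ ∈ rtSpace n) :
    preFortin b .rt τ = τ := by
  obtain ⟨c, rfl⟩ := exists_sum_rtFun_eq b hn hτ
  have hT := isOpen_openSimplex b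
  have hTb := isBounded_openSimplex b
  rw [preFortin_eq, fortinMean, zero_add]
  refine Finset.sum_congr rfl fun i _ => ?_
  have hne : (n : ℝ) * faceWeight b .rt i ≠ 0 :=
    mul_ne_zero (by positivity) (faceWeight_pos b hn .rt i).ne'
  have hf : ∀ k, normalPairing (openSimplex b) (rtFun b k) (nuFun b i) =
      if k = i then n * faceWeight b .rt k else 0 :=
    fun k => normalPairing_faceFun_nuFun b .rt k i
  rw [faceCoeff, fortinMean, sub_zero, normalPairing_faceFun_nuFun, if_pos rfl,
    normalPairing_finset_sum hT hTb _ (fun k _ => (memHDiv_rtFun b k).const_smul _)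
      (contDiff_nuFun b i)]
  simp_rw [normalPairing_const_smul hT hTb (memHDiv_rtFun b _) _ (contDiff_nuFun b i), hf]
  rw [Finset.sum_eq_single i (fun k _ hk => by rw [if_neg hk, mul_zero]) (by simp), if_pos rfl,
    mul_div_cancel_right₀ _ hne]
  rfl

theorem preFortin_br_eq_self {τ : EucN n → EucN n} (hτ : τ ∈ polyVecSpace n 0) :
    preFortin b .br τ = τ := by
  obtain ⟨a, rfl⟩ := mem_polyVecSpace_zero.1 hτ
  obtain ⟨c, hc, h⟩ := exists_l2Proj_polyVecSpace_zero b (memLp_const_openSimplex b a)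
  have hac : c = a := by
    have h1 := h (a - c)
    rw [setIntegral_const, real_inner_self_eq_norm_sq, smul_eq_mul] at h1
    have h2 := (mul_eq_zero.1 h1).resolve_left (measureReal_openSimplex_pos b).ne'
    exact (sub_eq_zero.1 (norm_eq_zero.1 (pow_eq_zero_iff two_ne_zero |>.1 h2))).symm
  rw [preFortin_eq]
  have hm : fortinMean b .br (fun _ => a) = fun _ => a := by rw [fortinMean, hc, hac]
  rw [hm, add_eq_left]
  refine Finset.sum_eq_zero fun i _ => ?_
  have : normalPairing (openSimplex b) (0 : EucN n → EucN n) (nuFun b i) = 0 := by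
    rw [normalPairing_nuFun b hasWeakDiv_zero MemLp.zero]
    simp
  rw [faceCoeff, hm, sub_self, this, zero_div, zero_smul]

end

end

/-! ### Shape regularity and the L² bound -/

noncomputable section

open Filter Topology Set Metric

section

variable {n : ℕ} (b : AffineBasis (Fin (n + 1)) ℝ (EucN n))

theorem vertex_mem_closure_openSimplex (i : Fin (n + 1)) : b i ∈ closure (openSimplex b) := by
  have hc := convex_convexHull ℝ (range b)
  rw [openSimplex, hc.closure_interior_eq_closure_of_nonempty_interior (nonempty_openSimplex b)]
  exact subset_closure (subset_convexHull ℝ _ (mem_range_self i))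

theorem norm_sub_le_diam {x y : EucN n} (hx : x ∈ closure (openSimplex b))
    (hy : y ∈ closure (openSimplex b)) : ‖x - y‖ ≤ diam (openSimplex b) := by
  rw [← dist_eq_norm, ← Metric.diam_closure]
  exact dist_le_diam_of_mem (isBounded_openSimplex b).closure hx hy

/-- Along an edge at b_i the coordinate η_i changes by 1 over a length of at most h_T. -/
theorem one_le_norm_coordGrad_mul_diam (hn : 1 ≤ n) (i : Fin (n + 1)) :
    1 ≤ ‖coordGrad b i‖ * diam (openSimplex b) := by
  have : Nontrivial (Fin (n + 1)) := Fin.nontrivial_iff_two_le.2 (by omega)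
  obtain ⟨j, hj⟩ := exists_ne i
  have h := inner_coordGrad_sub_vertex b i i j
  rw [if_pos rfl, if_neg hj.symm, sub_zero] at h
  rw [← h]
  refine (real_inner_le_norm _ _).trans ?_
  gcongr
  exact norm_sub_le_diam b (vertex_mem_closure_openSimplex b i) (vertex_mem_closure_openSimplex b j)

/-- Otherwise, walking from the centre against ∇η_i would reach η_i = 0 inside the ball, where all
coordinates are positive. -/
theorem norm_coordGrad_mul_le_coord (hn : 1 ≤ n) {c : EucN n} {r : ℝ} (hr : 0 < r)
    (hball : ball c r ⊆ openSimplex b) (i : Fin (n + 1)) :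
    ‖coordGrad b i‖ * r ≤ b.coord i c := by
  have hg := norm_coordGrad_pos b hn i
  by_contra! hlt
  have hc := (mem_openSimplex b).1 (hball (mem_ball_self hr)) i
  set t := b.coord i c / ‖coordGrad b i‖ with ht
  have ht0 : 0 < t := by positivity
  have htr : t < r := by rw [ht, div_lt_iff₀ hg]; linarith
  set y := c - (t / ‖coordGrad b i‖) • coordGrad b i with hy
  have hyb : y ∈ ball c r := by
    rw [mem_ball, dist_eq_norm, hy, sub_sub_cancel_left, norm_neg, norm_smul, Real.norm_eq_abs,
      abs_of_pos (by positivity), div_mul_cancel₀ _ hg.ne']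
    exact htr
  have hyc := (mem_openSimplex b).1 (hball hyb) i
  rw [coord_eq_add_inner b i y c, hy, sub_sub_cancel_left, inner_neg_right, inner_smul_right,
    real_inner_self_eq_norm_sq] at hyc
  have : t / ‖coordGrad b i‖ * ‖coordGrad b i‖ ^ 2 = b.coord i c := by
    rw [ht]
    field_simp
  linarith

theorem norm_coordGrad_mul_le_one (hn : 1 ≤ n) {c : EucN n} {r : ℝ} (hr : 0 < r)
    (hball : ball c r ⊆ openSimplex b) (i : Fin (n + 1)) : ‖coordGrad b i‖ * r ≤ 1 :=
  (norm_coordGrad_mul_le_coord b hn hr hball i).trans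
    (coord_le_one b (hball (mem_ball_self hr)) i)

/-- Over a distance r/2 the coordinate loses at most half of its lower bound ‖∇η_i‖ r at the centre,
and ‖∇η_i‖ r ≥ r/h_T ≥ 1/κ. -/
theorem inv_two_mul_le_coord (hn : 1 ≤ n) {κ r : ℝ} {c : EucN n} (hr : 0 < r)
    (hκ : 0 < κ) (hball : ball c r ⊆ openSimplex b) (hd : diam (openSimplex b) ≤ κ * r)
    {x : EucN n} (hx : x ∈ ball c (r / 2)) (i : Fin (n + 1)) : (2 * κ)⁻¹ ≤ b.coord i x := by
  have h1 := norm_coordGrad_mul_le_coord b hn hr hball i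
  have h2 := one_le_norm_coordGrad_mul_diam b hn i
  have hg := norm_coordGrad_pos b hn i
  have h3 : |inner ℝ (coordGrad b i) (x - c)| ≤ ‖coordGrad b i‖ * (r / 2) := by
    refine (abs_real_inner_le_norm _ _).trans ?_
    gcongr
    rw [← dist_eq_norm]
    exact (mem_ball.1 hx).le
  have h4 : 1 ≤ ‖coordGrad b i‖ * (κ * r) := h2.trans (by gcongr)
  rw [coord_eq_add_inner b i x c]
  have h5 := (abs_le.1 h3).1
  have h6 : (2 * κ)⁻¹ ≤ ‖coordGrad b i‖ * (r / 2) := by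
    rw [inv_le_iff_one_le_mul₀ (by positivity)]
    linarith
  linarith

theorem measureReal_openSimplex_le {κ r : ℝ} {c : EucN n} (hr : 0 < r)
    (hκ : 0 < κ) (hball : ball c r ⊆ openSimplex b) (hd : diam (openSimplex b) ≤ κ * r) :
    (2 * κ)⁻¹ ^ n * volume.real (openSimplex b) ≤ volume.real (ball c (r / 2)) := by
  have hsub : openSimplex b ⊆ closedBall c (κ * r) := fun x hx => by
    rw [mem_closedBall, dist_eq_norm]
    exact (norm_sub_le_diam b (subset_closure hx)
      (subset_closure (hball (mem_ball_self hr)))).trans hd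
  have h1 : volume.real (openSimplex b) ≤ volume.real (closedBall c (κ * r)) :=
    measureReal_mono hsub measure_closedBall_lt_top.ne
  have h2 : volume.real (closedBall c (κ * r)) =
      (κ * r) ^ n * volume.real (ball (0 : EucN n) 1) := by
    rw [Measure.real, Measure.addHaar_closedBall _ _ (by positivity), ENNReal.toReal_mul,
      ENNReal.toReal_ofReal (by positivity), finrank_euclideanSpace_fin]
    rfl
  have h3 : volume.real (ball c (r / 2)) = (r / 2) ^ n * volume.real (ball (0 : EucN n) 1) := by
    rw [Measure.real, Measure.addHaar_ball_of_pos _ _ (half_pos hr), ENNReal.toReal_mul,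
      ENNReal.toReal_ofReal (by positivity), finrank_euclideanSpace_fin]
    rfl
  have h4 : r / 2 = (2 * κ)⁻¹ * (κ * r) := by field_simp
  rw [h3, h4, mul_pow, mul_assoc, ← h2]
  gcongr

/-- On the half ball each factor is at least 1/(2κ), giving the power n + 1 for at most n + 1
factors. The remaining power n compares the half ball with the ball of radius κ r containing T. One
bound covers the volume (no factors), the face bubbles and the edge bubbles. -/
theorem mul_measureReal_le_integral_prod_coord (hn : 1 ≤ n) {κ r : ℝ} {c : EucN n} (hr : 0 < r)
    (hκ : 0 < κ) (hball : ball c r ⊆ openSimplex b) (hd : diam (openSimplex b) ≤ κ * r)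
    (s : Finset (Fin (n + 1))) :
    (2 * κ)⁻¹ ^ (2 * n + 1) * volume.real (openSimplex b) ≤
      ∫ x in openSimplex b, ∏ j ∈ s, b.coord j x := by
  have hfin := isFiniteMeasure_restrict_of_isBounded (isBounded_openSimplex b)
  have hθ0 : 0 < (2 * κ)⁻¹ := by positivity
  have hb2 : ball c (r / 2) ⊆ openSimplex b := (ball_subset_ball (by linarith)).trans hball
  have hθ1 : (2 * κ)⁻¹ ≤ 1 :=
    (inv_two_mul_le_coord b hn hr hκ hball hd (mem_ball_self (half_pos hr)) 0).trans
      (coord_le_one b (hball (mem_ball_self hr)) 0)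
  have hint : IntegrableOn (fun x => ∏ j ∈ s, b.coord j x) (openSimplex b) :=
    (memLp_of_continuous_of_isBounded (isBounded_openSimplex b)
      (contDiff_prod_coord b s (k := 0)).continuous).integrable (by norm_num)
  have hlow : ∀ x ∈ ball c (r / 2), (2 * κ)⁻¹ ^ (n + 1) ≤ ∏ j ∈ s, b.coord j x := fun x hx => by
    calc (2 * κ)⁻¹ ^ (n + 1) ≤ (2 * κ)⁻¹ ^ s.card := by
          refine pow_le_pow_of_le_one hθ0.le hθ1 ?_
          simpa using s.card_le_univ
      _ = ∏ j ∈ s, (2 * κ)⁻¹ := by simp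
      _ ≤ _ := Finset.prod_le_prod (fun _ _ => hθ0.le)
          fun j _ => inv_two_mul_le_coord b hn hr hκ hball hd hx j
  calc (2 * κ)⁻¹ ^ (2 * n + 1) * volume.real (openSimplex b)
      = (2 * κ)⁻¹ ^ (n + 1) * ((2 * κ)⁻¹ ^ n * volume.real (openSimplex b)) := by ring
    _ ≤ (2 * κ)⁻¹ ^ (n + 1) * volume.real (ball c (r / 2)) := by
        gcongr
        exact measureReal_openSimplex_le b hr hκ hball hd
    _ = ∫ x in ball c (r / 2), (2 * κ)⁻¹ ^ (n + 1) := by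
        rw [setIntegral_const, smul_eq_mul, mul_comm]
    _ ≤ ∫ x in ball c (r / 2), ∏ j ∈ s, b.coord j x :=
        setIntegral_mono_on (integrableOn_const measure_ball_lt_top.ne)
          (hint.mono_set hb2) measurableSet_ball hlow
    _ ≤ _ := by
        refine setIntegral_mono_set hint ?_ (LE.le.eventuallyLE hb2)
        filter_upwards [ae_restrict_mem (isOpen_openSimplex b).measurableSet] with x hx
        exact (prod_coord_mem_Icc b hx s).1

theorem abs_nuFun_le (hn : 1 ≤ n) {x : EucN n} (hx : x ∈ openSimplex b) (i : Fin (n + 1)) :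
    |nuFun b i x| ≤ n := by
  have h0 := (mem_openSimplex b).1 hx i
  have h1 := coord_le_one b hx i
  have hn' : (1 : ℝ) ≤ n := by exact_mod_cast hn
  rw [nuFun_eq, abs_le]
  constructor <;> nlinarith

theorem l2Norm_nuFun_le (hn : 1 ≤ n) (i : Fin (n + 1)) :
    l2Norm (openSimplex b) (nuFun b i) ≤ n * √(volume.real (openSimplex b)) :=
  l2Norm_le_of_forall_norm_le (isOpen_openSimplex b).measurableSet (isBounded_openSimplex b)
    (by positivity) fun _ hx => abs_nuFun_le b hn hx i

theorem l2Norm_const (c : EucN n) :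
    l2Norm (openSimplex b) (fun _ => c) = ‖c‖ * √(volume.real (openSimplex b)) := by
  rw [l2Norm, setIntegral_const, smul_eq_mul, mul_comm, Real.sqrt_mul (by positivity),
    Real.sqrt_sq (norm_nonneg c)]

theorem abs_integral_inner_const_le (c : EucN n) {τ : EucN n → EucN n}
    (hτ : MemLp τ 2 (volume.restrict (openSimplex b))) :
    |∫ x in openSimplex b, inner ℝ c (τ x)| ≤
      ‖c‖ * √(volume.real (openSimplex b)) * l2Norm (openSimplex b) τ := by
  rw [← l2Norm_const]
  exact abs_integral_inner_le_l2Norm (memLp_const_openSimplex b c) hτ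

theorem l2Norm_fortinMean_le (j : FortinVariant) {τ : EucN n → EucN n}
    (hτ : MemLp τ 2 (volume.restrict (openSimplex b))) :
    l2Norm (openSimplex b) (fortinMean b j τ) ≤ l2Norm (openSimplex b) τ := by
  cases j
  · simp [fortinMean, l2Norm]
  · obtain ⟨c, hc, h⟩ := exists_l2Proj_polyVecSpace_zero b hτ
    rw [fortinMean, hc]
    refine l2Norm_le_of_isL2Proj (V := polyVecSpace n 0) hτ (memLp_const_openSimplex b c)
      ⟨mem_polyVecSpace_zero.2 ⟨c, rfl⟩, fun r hr => ?_⟩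
    obtain ⟨e, rfl⟩ := mem_polyVecSpace_zero.1 hr
    exact h e

theorem hasWeakDiv_sub_fortinMean (j : FortinVariant) {τ : EucN n → EucN n}
    (hτ : MemHDiv (openSimplex b) τ) :
    HasWeakDiv (openSimplex b) (τ - fortinMean b j τ) (weakDiv (openSimplex b) τ) := by
  obtain ⟨c, hc⟩ := exists_fortinMean_eq b j hτ.1
  rw [hc]
  have h := hτ.hasWeakDiv.sub (hasWeakDiv_const b c) hτ.1 (memLp_const_openSimplex b c)
  convert h using 1
  funext x
  simp

/-- The constant κ + 1 serves both variants: h_T/r ≤ κ bounds ψ_F, and 1 bounds a bubble times a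
unit normal. -/
theorem norm_faceFun_le (hn : 1 ≤ n) {κ r : ℝ} {c : EucN n} (hr : 0 < r) (hκ : 0 < κ)
    (hball : ball c r ⊆ openSimplex b) (hd : diam (openSimplex b) ≤ κ * r) (j : FortinVariant)
    (i : Fin (n + 1)) {x : EucN n} (hx : x ∈ openSimplex b) : ‖faceFun b j i x‖ ≤ κ + 1 := by
  cases j
  · rw [faceFun, rtFun, norm_smul, norm_norm]
    have h1 := norm_sub_le_diam b (subset_closure hx) (vertex_mem_closure_openSimplex b i)
    have h2 := norm_coordGrad_mul_le_one b hn hr hball i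
    calc _ ≤ ‖coordGrad b i‖ * (κ * r) := by gcongr; exact h1.trans hd
      _ = κ * (‖coordGrad b i‖ * r) := by ring
      _ ≤ κ * 1 := by gcongr
      _ ≤ κ + 1 := by linarith
  · rw [faceFun, brFun, norm_smul, norm_faceNormal hn, mul_one, Real.norm_eq_abs,
      abs_of_nonneg (prod_coord_mem_Icc b hx _).1]
    linarith [(prod_coord_mem_Icc b hx (Finset.univ.erase i)).2]

theorem mul_le_faceWeight (hn : 1 ≤ n) {κ r : ℝ} {c : EucN n} (hr : 0 < r) (hκ : 0 < κ)
    (hball : ball c r ⊆ openSimplex b) (hd : diam (openSimplex b) ≤ κ * r) (j : FortinVariant)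
    (i : Fin (n + 1)) :
    (2 * κ)⁻¹ ^ (2 * n + 1) * (‖coordGrad b i‖ * volume.real (openSimplex b)) ≤
      faceWeight b j i := by
  have hg := norm_coordGrad_pos b hn i
  have hV := measureReal_openSimplex_pos b
  have h := fun s => mul_measureReal_le_integral_prod_coord b hn hr hκ hball hd s
  cases j
  · have h1 := h ∅
    simp only [Finset.prod_empty, setIntegral_const, smul_eq_mul, mul_one] at h1
    calc _ = ‖coordGrad b i‖ * ((2 * κ)⁻¹ ^ (2 * n + 1) * volume.real (openSimplex b)) := by ring
      _ ≤ ‖coordGrad b i‖ * volume.real (openSimplex b) := by gcongr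
  · have h1 := h (Finset.univ.erase i)
    have h2 : 0 ≤ ∫ x in openSimplex b, ∏ j ∈ Finset.univ.erase i, b.coord j x :=
      le_trans (by positivity) h1
    calc _ = ‖coordGrad b i‖ * ((2 * κ)⁻¹ ^ (2 * n + 1) * volume.real (openSimplex b)) := by ring
      _ ≤ ‖coordGrad b i‖ * ∫ x in openSimplex b, ∏ j ∈ Finset.univ.erase i, b.coord j x := by
          gcongr
      _ ≤ _ := by
          rw [faceWeight]
          nlinarith [mul_nonneg hg.le h2]

/-- The factors n and ‖∇η_i‖ cancel against n times the weight, which is at least a multiple of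
‖∇η_i‖ |T|. One root |T|^{1/2} stays on the left because it arises from the sup bounds of the
functions multiplied by the coefficient. -/
theorem abs_faceCoeff_mul_le (hn : 1 ≤ n) {κ r : ℝ} {c : EucN n} (hr : 0 < r) (hκ : 0 < κ)
    (hball : ball c r ⊆ openSimplex b) (hd : diam (openSimplex b) ≤ κ * r) (j : FortinVariant)
    {τ : EucN n → EucN n} (i : Fin (n + 1)) {B : ℝ} (hB : 0 ≤ B)
    (h : |normalPairing (openSimplex b) (τ - fortinMean b j τ) (nuFun b i)| ≤
      n * √(volume.real (openSimplex b)) * (‖coordGrad b i‖ * B)) :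
    |faceCoeff b j τ i| * √(volume.real (openSimplex b)) ≤
      ((2 * κ)⁻¹ ^ (2 * n + 1))⁻¹ * B := by
  have hg := norm_coordGrad_pos b hn i
  have hV := measureReal_openSimplex_pos b
  have hw := mul_le_faceWeight b hn hr hκ hball hd j i
  have hw0 := faceWeight_pos b hn j i
  have hn0 : (0 : ℝ) < n := by positivity
  set S := √(volume.real (openSimplex b)) with hS
  have hS0 : 0 < S := Real.sqrt_pos.2 hV
  have hSV : volume.real (openSimplex b) = S * S := (Real.mul_self_sqrt hV.le).symm
  set ω := (2 * κ)⁻¹ ^ (2 * n + 1) with hω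
  have hω0 : 0 < ω := by positivity
  rw [faceCoeff, normalPairing_faceFun_nuFun, if_pos rfl, abs_div,
    abs_of_pos (mul_pos hn0 hw0), div_mul_eq_mul_div, div_le_iff₀ (mul_pos hn0 hw0)]
  calc _ ≤ n * S * (‖coordGrad b i‖ * B) * S := by gcongr
    _ = ω⁻¹ * B * (n * (ω * (‖coordGrad b i‖ * (S * S)))) := by field_simp
    _ ≤ _ := by
      rw [← hSV]
      gcongr

theorem abs_edgeCoeff_mul_le (hn : 1 ≤ n) {κ r : ℝ} {c : EucN n} (hr : 0 < r) (hκ : 0 < κ)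
    (hball : ball c r ⊆ openSimplex b) (hd : diam (openSimplex b) ≤ κ * r) (j : FortinVariant)
    {τ : EucN n → EucN n} {s k : Fin (n + 1)} (hk : k ≠ s) {B : ℝ} (hB : 0 ≤ B)
    (h : |∫ x in openSimplex b, inner ℝ (edgeSigma b k) (τ x - preFortin b j τ x)| ≤
      √(volume.real (openSimplex b)) * B) :
    |edgeCoeff b s j τ k| * √(volume.real (openSimplex b)) ≤
      ((2 * κ)⁻¹ ^ (2 * n + 1))⁻¹ * B := by
  have hV := measureReal_openSimplex_pos b
  have hw0 := integral_coord_mul_coord_pos b s k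
  have hw := mul_measureReal_le_integral_prod_coord b hn hr hκ hball hd {s, k}
  simp_rw [Finset.prod_pair hk.symm] at hw
  set S := √(volume.real (openSimplex b)) with hS
  have hS0 : 0 < S := Real.sqrt_pos.2 hV
  have hSV : volume.real (openSimplex b) = S * S := (Real.mul_self_sqrt hV.le).symm
  set ω := (2 * κ)⁻¹ ^ (2 * n + 1) with hω
  have hω0 : 0 < ω := by positivity
  rw [edgeCoeff, integral_edgeSigma_edgeFun b hk, if_pos rfl, abs_div, abs_of_pos hw0,
    div_mul_eq_mul_div, div_le_iff₀ hw0]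
  calc _ ≤ S * B * S := by gcongr
    _ = ω⁻¹ * B * (ω * (S * S)) := by field_simp
    _ ≤ _ := by
      rw [← hSV]
      gcongr

theorem norm_edgeFun_le {s k : Fin (n + 1)} {x : EucN n} (hx : x ∈ openSimplex b) :
    ‖edgeFun b s k x‖ ≤ diam (openSimplex b) := by
  have hs := (mem_openSimplex b).1 hx s
  have hk := (mem_openSimplex b).1 hx k
  rw [edgeFun, norm_smul, Real.norm_eq_abs, abs_of_pos (mul_pos hs hk)]
  refine (mul_le_of_le_one_left (norm_nonneg _)
    (mul_le_one₀ (coord_le_one b hx s) hk.le (coord_le_one b hx k))).trans ?_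
  exact norm_sub_le_diam b (vertex_mem_closure_openSimplex b k) (vertex_mem_closure_openSimplex b s)

theorem exists_l2Norm_fortinOp_le (hn : 1 ≤ n) {κ : ℝ} (hκ : 0 < κ) :
    ∃ C : ℝ, 0 < C ∧ ∀ (b : AffineBasis (Fin (n + 1)) ℝ (EucN n)), ShapeRegular κ b →
      ∀ (s : Fin (n + 1)) (j : FortinVariant) (τ : EucN n → EucN n), MemHDiv (openSimplex b) τ →
        l2Norm (openSimplex b) (fortinOp b s j τ) ≤
          C * (l2Norm (openSimplex b) τ + diam (openSimplex b) *
            l2Norm (openSimplex b) (weakDiv (openSimplex b) τ)) := by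
  set ω := (2 * κ)⁻¹ ^ (2 * n + 1) with hω
  have hω0 : 0 < ω := by positivity
  -- C₁ bounds the preliminary operator: 1 for the mean part and n + 1 face terms, the 2 coming from
  -- ‖τ - Π⁰τ‖ ≤ 2‖τ‖.
  set C₁ : ℝ := 1 + (n + 1) * ((κ + 1) * (ω⁻¹ * 2)) with hC₁
  have hC₁0 : 0 < C₁ := by positivity
  refine ⟨C₁ + (n + 1) * (κ * (ω⁻¹ * (1 + C₁))), by positivity, ?_⟩
  rintro b ⟨c, r, hr, hball, hd⟩ s j τ hτ
  have hT := isOpen_openSimplex b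
  have hTb := isBounded_openSimplex b
  set T := openSimplex b with hTdef
  set S := √(volume.real T) with hS
  have hS0 : 0 ≤ S := Real.sqrt_nonneg _
  set h := diam T with hh
  have hh0 : 0 ≤ h := diam_nonneg
  set N := l2Norm T τ with hN
  set D := l2Norm T (weakDiv T τ) with hD
  have hN0 : 0 ≤ N := l2Norm_nonneg _ _
  have hD0 : 0 ≤ D := l2Norm_nonneg _ _
  have hm := memHDiv_fortinMean b j hτ.1
  have hσ := hτ.sub hm
  have hmean := l2Norm_fortinMean_le b j hτ.1
  have hσN : l2Norm T (τ - fortinMean b j τ) ≤ 2 * N := by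
    refine (l2Norm_sub_le hτ.1 hm.1).trans ?_
    linarith
  have hface : ∀ i, l2Norm T (faceCoeff b j τ i • faceFun b j i) ≤
      (κ + 1) * (ω⁻¹ * (2 * (N + h * D))) := fun i => by
    have hgd := one_le_norm_coordGrad_mul_diam b hn i
    have hpair : |normalPairing T (τ - fortinMean b j τ) (nuFun b i)| ≤
        n * S * (‖coordGrad b i‖ * (2 * (N + h * D))) := by
      rw [normalPairing_nuFun b (hasWeakDiv_sub_fortinMean b j hτ) hσ.1]
      refine (abs_sub _ _).trans ?_
      have h1 := (abs_integral_mul_le_l2Norm hτ.hasWeakDiv.1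
        (memLp_of_continuous_of_isBounded hTb (contDiff_nuFun b i).continuous)).trans
        (mul_le_mul_of_nonneg_left (l2Norm_nuFun_le b hn i) hD0)
      have h2 := (abs_integral_inner_const_le b (coordGrad b i) hσ.1).trans
        (mul_le_mul_of_nonneg_left hσN (by positivity))
      rw [abs_mul, Nat.abs_cast]
      -- Since 1 ≤ ‖∇η_i‖ h_T, the divergence term can be given the factor ‖∇η_i‖ needed for
      -- cancellation, at the price of h_T.
      have h3 : D ≤ ‖coordGrad b i‖ * h * D := le_mul_of_one_le_left hD0 hgd
      calc _ ≤ D * (n * S) + n * (‖coordGrad b i‖ * S * (2 * N)) := by gcongr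
        _ ≤ ‖coordGrad b i‖ * h * D * (n * S) + n * (‖coordGrad b i‖ * S * (2 * N)) := by gcongr
        _ ≤ ‖coordGrad b i‖ * h * D * (n * S) + n * (‖coordGrad b i‖ * S * (2 * N)) +
            ‖coordGrad b i‖ * h * D * (n * S) := le_add_of_nonneg_right (by positivity)
        _ = _ := by ring
    have h4 := abs_faceCoeff_mul_le b hn hr hκ hball hd j i (by positivity) hpair
    rw [l2Norm_const_smul]
    calc _ ≤ |faceCoeff b j τ i| * ((κ + 1) * S) := by
          gcongr
          exact l2Norm_le_of_forall_norm_le hT.measurableSet hTb (by positivity)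
            fun x hx => norm_faceFun_le b hn hr hκ hball hd j i hx
      _ = (κ + 1) * (|faceCoeff b j τ i| * S) := by ring
      _ ≤ _ := by gcongr
  have hpm := memHDiv_preFortin b j hτ.1
  have hpre : l2Norm T (preFortin b j τ) ≤ C₁ * (N + h * D) := by
    have hfm : ∀ i ∈ Finset.univ, MemLp (faceCoeff b j τ i • faceFun b j i) 2
        (volume.restrict T) := fun i _ => (memHDiv_faceFun b j i).1.const_smul _
    rw [preFortin_eq]
    refine (l2Norm_add_le hm.1 (memLp_finsetSum' _ hfm)).trans ?_
    have h5 := l2Norm_sum_le Finset.univ hfm fun i _ => hface i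
    rw [Finset.card_univ, Fintype.card_fin] at h5
    push_cast at h5
    have : 0 ≤ h * D := by positivity
    calc _ ≤ (N + h * D) + (n + 1) * ((κ + 1) * (ω⁻¹ * (2 * (N + h * D)))) := by linarith
      _ = _ := by rw [hC₁]; ring
  have hdiff : l2Norm T (τ - preFortin b j τ) ≤ (1 + C₁) * (N + h * D) := by
    refine (l2Norm_sub_le hτ.1 hpm.1).trans ?_
    have : 0 ≤ h * D := by positivity
    linarith
  have hedge : ∀ k ∈ Finset.univ.erase s, l2Norm T (edgeCoeff b s j τ k • edgeFun b s k) ≤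
      κ * (ω⁻¹ * ((1 + C₁) * (N + h * D))) := fun k hk => by
    have h1 := (abs_integral_inner_const_le b (edgeSigma b k) (hτ.sub hpm).1).trans
      (mul_le_mul_of_nonneg_left hdiff (by positivity))
    have h2 := abs_edgeCoeff_mul_le b hn hr hκ hball hd j (Finset.ne_of_mem_erase hk)
      (B := ‖coordGrad b k‖ * ((1 + C₁) * (N + h * D))) (by positivity)
      (h1.trans (le_of_eq (by rw [edgeSigma]; ring)))
    have h3 := norm_coordGrad_mul_le_one b hn hr hball k
    rw [l2Norm_const_smul]
    calc _ ≤ |edgeCoeff b s j τ k| * (h * S) := by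
          gcongr
          exact l2Norm_le_of_forall_norm_le hT.measurableSet hTb hh0
            fun x hx => norm_edgeFun_le b hx
      _ = h * (|edgeCoeff b s j τ k| * S) := by ring
      -- The length of the edge vector, at most κ r, is compensated by ‖σ_E‖ = ‖∇η_k‖ ≤ 1/r.
      _ ≤ (κ * r) * (ω⁻¹ * (‖coordGrad b k‖ * ((1 + C₁) * (N + h * D)))) := by gcongr
      _ = κ * (ω⁻¹ * ((1 + C₁) * (N + h * D))) * (‖coordGrad b k‖ * r) := by ring
      _ ≤ _ := mul_le_of_le_one_right (by positivity) h3
  have hem : ∀ k ∈ Finset.univ.erase s, MemLp (edgeCoeff b s j τ k • edgeFun b s k) 2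
      (volume.restrict T) := fun k _ => (memHDiv_edgeFun b s k).1.const_smul _
  have h6 := l2Norm_sum_le (Finset.univ.erase s) hem hedge
  rw [Finset.card_erase_of_mem (Finset.mem_univ s), Finset.card_univ, Fintype.card_fin,
    Nat.add_sub_cancel] at h6
  rw [fortinOp_eq]
  refine (l2Norm_add_le hpm.1 (memLp_finsetSum' _ hem)).trans ?_
  have h7 : 0 ≤ κ * (ω⁻¹ * ((1 + C₁) * (N + h * D))) := by positivity
  calc _ ≤ C₁ * (N + h * D) + n * (κ * (ω⁻¹ * ((1 + C₁) * (N + h * D)))) := add_le_add hpre h6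
    _ ≤ C₁ * (N + h * D) + n * (κ * (ω⁻¹ * ((1 + C₁) * (N + h * D)))) +
        κ * (ω⁻¹ * ((1 + C₁) * (N + h * D))) := le_add_of_nonneg_right h7
    _ = _ := by ring

end

end

/-! ### The divergence bound for the Bernardi–Raugel variant -/

noncomputable section

open Filter Topology Set Metric

section

variable {n : ℕ} (b : AffineBasis (Fin (n + 1)) ℝ (EucN n))

/-- The divergence of the Bernardi–Raugel function `brFun b i`. -/
def brDiv (b : AffineBasis (Fin (n + 1)) ℝ (EucN n)) (i : Fin (n + 1)) (x : EucN n) : ℝ :=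
  fderiv ℝ (fun x => ∏ j ∈ Finset.univ.erase i, b.coord j x) x (faceNormal b i)

theorem hasWeakDiv_brFun (i : Fin (n + 1)) : HasWeakDiv (openSimplex b) (brFun b i) (brDiv b i) :=
  hasWeakDiv_smul_const (isBounded_openSimplex b) (contDiff_prod_coord b _) _

/-- The product rule gives n terms, each a product of coordinates in [0, 1] times a directional
derivative of size at most ‖∇η_j‖ ≤ 1/r. -/
theorem abs_brDiv_mul_le (hn : 1 ≤ n) {r : ℝ} {c : EucN n} (hr : 0 < r)
    (hball : ball c r ⊆ openSimplex b) (i : Fin (n + 1)) {x : EucN n} (hx : x ∈ openSimplex b) :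
    |brDiv b i x| ≤ n / r := by
  rw [brDiv, fderiv_prod_coord]
  refine (Finset.abs_sum_le_sum_abs _ _).trans ?_
  have h : ∀ j ∈ Finset.univ.erase i,
      |(∏ l ∈ (Finset.univ.erase i).erase j, b.coord l x) *
        inner ℝ (coordGrad b j) (faceNormal b i)| ≤ 1 / r := fun j _ => by
    have h1 := prod_coord_mem_Icc b hx ((Finset.univ.erase i).erase j)
    have h2 := abs_real_inner_le_norm (coordGrad b j) (faceNormal b i)
    rw [norm_faceNormal hn, mul_one] at h2
    rw [abs_mul, abs_of_nonneg h1.1, le_div_iff₀ hr]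
    calc _ ≤ 1 * ‖coordGrad b j‖ * r := by
          gcongr
          exact h1.2
      _ = ‖coordGrad b j‖ * r := by ring
      _ ≤ 1 := norm_coordGrad_mul_le_one b hn hr hball j
  refine (Finset.sum_le_sum h).trans (le_of_eq ?_)
  rw [Finset.sum_const, Finset.card_erase_of_mem (Finset.mem_univ i), Finset.card_univ,
    Fintype.card_fin, Nat.add_sub_cancel, nsmul_eq_mul, mul_one_div]

theorem hasWeakDiv_fortinOp_br (s : Fin (n + 1)) {τ : EucN n → EucN n}
    (hτ : MemLp τ 2 (volume.restrict (openSimplex b))) :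
    HasWeakDiv (openSimplex b) (fortinOp b s .br τ)
      ((∑ i, faceCoeff b .br τ i • brDiv b i) +
        ∑ k ∈ Finset.univ.erase s, edgeCoeff b s .br τ k •
          fun x => b.coord s x - b.coord k x) := by
  have hm := memHDiv_fortinMean b .br hτ
  have h1 : HasWeakDiv (openSimplex b) (∑ i, faceCoeff b .br τ i • brFun b i)
      (∑ i, faceCoeff b .br τ i • brDiv b i) :=
    HasWeakDiv.finset_sum _ (fun i _ => (hasWeakDiv_brFun b i).const_smul _)
      fun i _ => (memHDiv_brFun b i).1.const_smul _
  have h1m : MemLp (∑ i, faceCoeff b .br τ i • brFun b i) 2 (volume.restrict (openSimplex b)) :=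
    memLp_finsetSum' _ fun i _ => (memHDiv_brFun b i).1.const_smul _
  have h0 : HasWeakDiv (openSimplex b) (fortinMean b .br τ) 0 := by
    obtain ⟨c, hc⟩ := exists_fortinMean_eq b .br hτ
    rw [hc]
    exact hasWeakDiv_const b c
  have h := (h0.add h1 hm.1 h1m).add (hasWeakDiv_sum_edgeFun b s (edgeCoeff b s .br τ))
    (hm.1.add h1m) (memLp_finsetSum' _ fun k _ => (memHDiv_edgeFun b s k).1.const_smul _)
  rw [zero_add] at h
  rw [fortinOp_eq, preFortin_eq]
  exact h

theorem integral_inner_sub_fortinMean_br {τ : EucN n → EucN n}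
    (hτ : MemLp τ 2 (volume.restrict (openSimplex b))) (e : EucN n) :
    ∫ x in openSimplex b, inner ℝ e ((τ - fortinMean b .br τ) x) = 0 := by
  obtain ⟨c, hc, h⟩ := exists_l2Proj_polyVecSpace_zero b hτ
  have := h e
  rwa [fortinMean, hc]

theorem inner_sub_preFortin_br (τ : EucN n → EucN n) (e x : EucN n) :
    inner ℝ e (τ x - preFortin b .br τ x) = inner ℝ e ((τ - fortinMean b .br τ) x) -
      ∑ i, faceCoeff b .br τ i * inner ℝ e (brFun b i x) := by
  have h : τ x - preFortin b .br τ x = (τ - fortinMean b .br τ) x -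
      ∑ i, faceCoeff b .br τ i • brFun b i x := by
    rw [preFortin_eq, Pi.add_apply, Finset.sum_apply, Pi.sub_apply, ← sub_sub]
    rfl
  rw [h, inner_sub_right, inner_sum]
  simp_rw [inner_smul_right]

theorem norm_coordGrad_mul_diam_le (hn : 1 ≤ n) {κ r : ℝ} {c : EucN n} (hr : 0 < r) (hκ : 0 < κ)
    (hball : ball c r ⊆ openSimplex b) (hd : diam (openSimplex b) ≤ κ * r) (k : Fin (n + 1)) :
    ‖coordGrad b k‖ * diam (openSimplex b) ≤ κ := by
  have h3 := norm_coordGrad_mul_le_one b hn hr hball k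
  calc _ ≤ ‖coordGrad b k‖ * (κ * r) := by gcongr
    _ = κ * (‖coordGrad b k‖ * r) := by ring
    _ ≤ κ * 1 := by gcongr
    _ = κ := mul_one κ

/-- The gradient of ν_F is constant and τ - Π⁰τ has mean zero, so only the divergence term of the
pairing survives. This removes ‖τ‖ from the bound and gains a factor h_T. -/
theorem abs_faceCoeff_br_mul_le (hn : 1 ≤ n) {κ r : ℝ} {c : EucN n} (hr : 0 < r) (hκ : 0 < κ)
    (hball : ball c r ⊆ openSimplex b) (hd : diam (openSimplex b) ≤ κ * r)
    {τ : EucN n → EucN n} (hτ : MemHDiv (openSimplex b) τ) (i : Fin (n + 1)) :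
    |faceCoeff b .br τ i| * √(volume.real (openSimplex b)) ≤
      ((2 * κ)⁻¹ ^ (2 * n + 1))⁻¹ *
        (diam (openSimplex b) * l2Norm (openSimplex b) (weakDiv (openSimplex b) τ)) := by
  have hh0 : 0 ≤ diam (openSimplex b) := diam_nonneg
  have hD0 := l2Norm_nonneg (openSimplex b) (weakDiv (openSimplex b) τ)
  have hσ := hτ.sub (memHDiv_fortinMean b .br hτ.1)
  have hgd := one_le_norm_coordGrad_mul_diam b hn i
  refine abs_faceCoeff_mul_le b hn hr hκ hball hd .br i (by positivity) ?_
  rw [normalPairing_nuFun b (hasWeakDiv_sub_fortinMean b .br hτ) hσ.1,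
    integral_inner_sub_fortinMean_br b hτ.1, mul_zero, sub_zero]
  refine ((abs_integral_mul_le_l2Norm hτ.hasWeakDiv.1
    (memLp_of_continuous_of_isBounded (isBounded_openSimplex b)
      (contDiff_nuFun b i).continuous)).trans
    (mul_le_mul_of_nonneg_left (l2Norm_nuFun_le b hn i) hD0)).trans ?_
  generalize l2Norm (openSimplex b) (weakDiv (openSimplex b) τ) = D at hD0 ⊢
  have hS0 := Real.sqrt_nonneg (volume.real (openSimplex b))
  generalize √(volume.real (openSimplex b)) = S at hS0 ⊢
  generalize diam (openSimplex b) = h at hh0 hgd ⊢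
  calc D * (n * S) = n * S * (1 * D) := by ring
    _ ≤ n * S * ((‖coordGrad b i‖ * h) * D) := by gcongr
    _ = n * S * (‖coordGrad b i‖ * (h * D)) := by ring

theorem l2Norm_faceCoeff_smul_brDiv_le (hn : 1 ≤ n) {κ r : ℝ} {c : EucN n} (hr : 0 < r)
    (hκ : 0 < κ) (hball : ball c r ⊆ openSimplex b) (hd : diam (openSimplex b) ≤ κ * r)
    {τ : EucN n → EucN n} (hτ : MemHDiv (openSimplex b) τ) (i : Fin (n + 1)) :
    l2Norm (openSimplex b) (faceCoeff b .br τ i • brDiv b i) ≤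
      ((2 * κ)⁻¹ ^ (2 * n + 1))⁻¹ * (n * κ) *
        l2Norm (openSimplex b) (weakDiv (openSimplex b) τ) := by
  have hcoef := abs_faceCoeff_br_mul_le b hn hr hκ hball hd hτ i
  have hD0 := l2Norm_nonneg (openSimplex b) (weakDiv (openSimplex b) τ)
  have hb : l2Norm (openSimplex b) (brDiv b i) ≤ n / r * √(volume.real (openSimplex b)) :=
    l2Norm_le_of_forall_norm_le (isOpen_openSimplex b).measurableSet (isBounded_openSimplex b)
      (by positivity) fun x hx => abs_brDiv_mul_le b hn hr hball i hx
  have hhr : diam (openSimplex b) / r ≤ κ := (div_le_iff₀ hr).2 hd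
  have hω0 : 0 < ((2 * κ)⁻¹ ^ (2 * n + 1))⁻¹ := by positivity
  rw [l2Norm_const_smul]
  generalize ((2 * κ)⁻¹ ^ (2 * n + 1))⁻¹ = ω at *
  generalize l2Norm (openSimplex b) (weakDiv (openSimplex b) τ) = D at *
  generalize √(volume.real (openSimplex b)) = S at *
  generalize diam (openSimplex b) = h at *
  calc _ ≤ |faceCoeff b .br τ i| * (n / r * S) := mul_le_mul_of_nonneg_left hb (abs_nonneg _)
    _ = n / r * (|faceCoeff b .br τ i| * S) := by ring
    _ ≤ n / r * (ω * (h * D)) := mul_le_mul_of_nonneg_left hcoef (by positivity)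
    _ = ω * (n * (h / r)) * D := by ring
    _ ≤ _ := by gcongr

theorem l2Norm_brFun_le (hn : 1 ≤ n) (i : Fin (n + 1)) :
    l2Norm (openSimplex b) (brFun b i) ≤ √(volume.real (openSimplex b)) := by
  refine (l2Norm_le_of_forall_norm_le (isOpen_openSimplex b).measurableSet
    (isBounded_openSimplex b) zero_le_one fun x hx => ?_).trans_eq (one_mul _)
  rw [brFun, norm_smul, norm_faceNormal hn, mul_one, Real.norm_eq_abs,
    abs_of_nonneg (prod_coord_mem_Icc b hx _).1]
  exact (prod_coord_mem_Icc b hx _).2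

theorem l2Norm_coord_sub_coord_le (s k : Fin (n + 1)) :
    l2Norm (openSimplex b) (fun x => b.coord s x - b.coord k x) ≤
      √(volume.real (openSimplex b)) := by
  refine (l2Norm_le_of_forall_norm_le (isOpen_openSimplex b).measurableSet
    (isBounded_openSimplex b) zero_le_one fun x hx => ?_).trans_eq (one_mul _)
  have hs0 := (mem_openSimplex b).1 hx s
  have hk0 := (mem_openSimplex b).1 hx k
  have hs1 := coord_le_one b hx s
  have hk1 := coord_le_one b hx k
  rw [Real.norm_eq_abs, abs_le]
  constructor <;> linarith

/-- The mean-free part has no constant moment, so only the n + 1 face terms remain; the h_T in their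
coefficients is absorbed by ‖σ_E‖ h_T ≤ κ. Hence the edge coefficients, too, are controlled by div τ
alone. -/
theorem abs_integral_inner_sub_preFortin_br_le (hn : 1 ≤ n) {κ r : ℝ} {c : EucN n} (hr : 0 < r)
    (hκ : 0 < κ) (hball : ball c r ⊆ openSimplex b) (hd : diam (openSimplex b) ≤ κ * r)
    {τ : EucN n → EucN n} (hτ : MemHDiv (openSimplex b) τ) (k : Fin (n + 1)) :
    |∫ x in openSimplex b, inner ℝ (edgeSigma b k) (τ x - preFortin b .br τ x)| ≤
      √(volume.real (openSimplex b)) * ((n + 1) * (((2 * κ)⁻¹ ^ (2 * n + 1))⁻¹ * κ) *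
        l2Norm (openSimplex b) (weakDiv (openSimplex b) τ)) := by
  have hc := memLp_const_openSimplex b (edgeSigma b k)
  have hσ := hτ.sub (memHDiv_fortinMean b .br hτ.1)
  have hint : ∀ i ∈ Finset.univ, Integrable
      (fun x => faceCoeff b .br τ i * inner ℝ (edgeSigma b k) (brFun b i x))
      (volume.restrict (openSimplex b)) := fun i _ =>
    (integrable_inner_of_memLp hc (memHDiv_brFun b i).1).const_mul _
  have hb : ∀ i, |faceCoeff b .br τ i *
      ∫ x in openSimplex b, inner ℝ (edgeSigma b k) (brFun b i x)| ≤
      √(volume.real (openSimplex b)) * (((2 * κ)⁻¹ ^ (2 * n + 1))⁻¹ * κ *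
        l2Norm (openSimplex b) (weakDiv (openSimplex b) τ)) := fun i => by
    have h2 := (abs_integral_inner_const_le b (edgeSigma b k) (memHDiv_brFun b i).1).trans
      (mul_le_mul_of_nonneg_left (l2Norm_brFun_le b hn i) (by positivity))
    have hcoef := abs_faceCoeff_br_mul_le b hn hr hκ hball hd hτ i
    have hkh := norm_coordGrad_mul_diam_le b hn hr hκ hball hd k
    have hω0 : 0 < ((2 * κ)⁻¹ ^ (2 * n + 1))⁻¹ := by positivity
    have hD0 := l2Norm_nonneg (openSimplex b) (weakDiv (openSimplex b) τ)
    have hS0 := Real.sqrt_nonneg (volume.real (openSimplex b))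
    rw [abs_mul]
    refine (mul_le_mul_of_nonneg_left h2 (abs_nonneg _)).trans ?_
    rw [edgeSigma]
    generalize ((2 * κ)⁻¹ ^ (2 * n + 1))⁻¹ = ω at *
    generalize l2Norm (openSimplex b) (weakDiv (openSimplex b) τ) = D at *
    generalize √(volume.real (openSimplex b)) = S at *
    generalize diam (openSimplex b) = h at *
    calc _ = ‖coordGrad b k‖ * S * (|faceCoeff b .br τ i| * S) := by ring
      _ ≤ ‖coordGrad b k‖ * S * (ω * (h * D)) :=
          mul_le_mul_of_nonneg_left hcoef (by positivity)
      _ = S * (ω * (‖coordGrad b k‖ * h) * D) := by ring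
      _ ≤ _ := by gcongr
  simp_rw [inner_sub_preFortin_br]
  rw [integral_sub (integrable_inner_of_memLp hc hσ.1) (integrable_finsetSum _ hint),
    integral_inner_sub_fortinMean_br b hτ.1, zero_sub, abs_neg, integral_finsetSum _ hint]
  simp_rw [integral_const_mul]
  refine (Finset.abs_sum_le_sum_abs _ _).trans ((Finset.sum_le_sum fun i _ => hb i).trans_eq ?_)
  rw [Finset.sum_const, Finset.card_univ, Fintype.card_fin, nsmul_eq_mul]
  push_cast
  ring

/-- The divergence η_s - η_k of an edge function is at most 1 in modulus, so no inverse power of r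
arises. -/
theorem l2Norm_edgeCoeff_smul_le (hn : 1 ≤ n) {κ r : ℝ} {c : EucN n} (hr : 0 < r)
    (hκ : 0 < κ) (hball : ball c r ⊆ openSimplex b) (hd : diam (openSimplex b) ≤ κ * r)
    {τ : EucN n → EucN n} (hτ : MemHDiv (openSimplex b) τ) {s k : Fin (n + 1)} (hks : k ≠ s) :
    l2Norm (openSimplex b) (edgeCoeff b s .br τ k • fun x => b.coord s x - b.coord k x) ≤
      ((2 * κ)⁻¹ ^ (2 * n + 1))⁻¹ * ((n + 1) * (((2 * κ)⁻¹ ^ (2 * n + 1))⁻¹ * κ)) *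
        l2Norm (openSimplex b) (weakDiv (openSimplex b) τ) := by
  have hD0 := l2Norm_nonneg (openSimplex b) (weakDiv (openSimplex b) τ)
  have h2 := abs_edgeCoeff_mul_le b hn hr hκ hball hd .br hks (by positivity)
    (abs_integral_inner_sub_preFortin_br_le b hn hr hκ hball hd hτ k)
  rw [l2Norm_const_smul]
  refine (mul_le_mul_of_nonneg_left (l2Norm_coord_sub_coord_le b s k) (abs_nonneg _)).trans
    (h2.trans_eq ?_)
  rw [← mul_assoc]

theorem l2Norm_weakDiv_fortinOp_br_le (hn : 1 ≤ n) {κ r : ℝ} {c : EucN n} (hr : 0 < r)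
    (hκ : 0 < κ) (hball : ball c r ⊆ openSimplex b) (hd : diam (openSimplex b) ≤ κ * r)
    {τ : EucN n → EucN n} (hτ : MemHDiv (openSimplex b) τ) (s : Fin (n + 1)) :
    l2Norm (openSimplex b) (weakDiv (openSimplex b) (fortinOp b s .br τ)) ≤
      ((n + 1 : ℕ) : ℝ) * (((2 * κ)⁻¹ ^ (2 * n + 1))⁻¹ * (n * κ) *
        l2Norm (openSimplex b) (weakDiv (openSimplex b) τ)) +
      n * (((2 * κ)⁻¹ ^ (2 * n + 1))⁻¹ * ((n + 1) * (((2 * κ)⁻¹ ^ (2 * n + 1))⁻¹ * κ)) *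
        l2Norm (openSimplex b) (weakDiv (openSimplex b) τ)) := by
  have hfm : ∀ i ∈ Finset.univ, MemLp (faceCoeff b .br τ i • brDiv b i) 2
      (volume.restrict (openSimplex b)) := fun i _ => (hasWeakDiv_brFun b i).1.const_smul _
  have hem : ∀ k ∈ Finset.univ.erase s,
      MemLp (edgeCoeff b s .br τ k • fun x => b.coord s x - b.coord k x) 2
        (volume.restrict (openSimplex b)) := fun k _ =>
    ((memLp_coord b s).sub (memLp_coord b k)).const_smul _
  have h5 := l2Norm_sum_le Finset.univ hfm fun i _ =>
    l2Norm_faceCoeff_smul_brDiv_le b hn hr hκ hball hd hτ i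
  have h6 := l2Norm_sum_le (Finset.univ.erase s) hem fun k hk =>
    l2Norm_edgeCoeff_smul_le b hn hr hκ hball hd hτ (Finset.ne_of_mem_erase hk)
  rw [Finset.card_univ, Fintype.card_fin] at h5
  rw [Finset.card_erase_of_mem (Finset.mem_univ s), Finset.card_univ, Fintype.card_fin,
    Nat.add_sub_cancel] at h6
  rw [l2Norm_congr_ae ((memHDiv_fortinOp b s .br hτ.1).hasWeakDiv.ae_unique
    (isOpen_openSimplex b) (isBounded_openSimplex b) (hasWeakDiv_fortinOp_br b s hτ.1))]
  have hfs : MemLp (∑ i, faceCoeff b .br τ i • brDiv b i) 2 (volume.restrict (openSimplex b)) :=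
    memLp_finsetSum' _ hfm
  have hes : MemLp (∑ k ∈ Finset.univ.erase s,
      edgeCoeff b s .br τ k • fun x => b.coord s x - b.coord k x) 2
        (volume.restrict (openSimplex b)) := memLp_finsetSum' _ hem
  exact (l2Norm_add_le hfs hes).trans (add_le_add h5 h6)

theorem exists_l2Norm_weakDiv_fortinOp_br_le (hn : 1 ≤ n) {κ : ℝ} (hκ : 0 < κ) :
    ∃ C : ℝ, 0 < C ∧ ∀ (b : AffineBasis (Fin (n + 1)) ℝ (EucN n)), ShapeRegular κ b →
      ∀ (s : Fin (n + 1)) (τ : EucN n → EucN n), MemHDiv (openSimplex b) τ →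
        l2Norm (openSimplex b) (weakDiv (openSimplex b) (fortinOp b s .br τ)) ≤
          C * l2Norm (openSimplex b) (weakDiv (openSimplex b) τ) := by
  have hω0 : 0 < ((2 * κ)⁻¹ ^ (2 * n + 1))⁻¹ := by positivity
  have hn0 : (0 : ℝ) < n := by exact_mod_cast hn
  refine ⟨((n + 1 : ℕ) : ℝ) * (((2 * κ)⁻¹ ^ (2 * n + 1))⁻¹ * (n * κ)) +
    n * (((2 * κ)⁻¹ ^ (2 * n + 1))⁻¹ * ((n + 1) * (((2 * κ)⁻¹ ^ (2 * n + 1))⁻¹ * κ))),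
    by positivity, ?_⟩
  rintro b ⟨c, r, hr, hball, hd⟩ s τ hτ
  refine (l2Norm_weakDiv_fortinOp_br_le b hn hr hκ hball hd hτ s).trans_eq ?_
  generalize ((2 * κ)⁻¹ ^ (2 * n + 1))⁻¹ = ω
  ring

end

end

theorem theorem4p7 (n : ℕ) (hn : 1 ≤ n) :
    -- range of the operators and the two Fortin conditions
    (∀ (b : AffineBasis (Fin (n + 1)) ℝ (EucN n)) (s : Fin (n + 1)) (j : FortinVariant)
        (τ : EucN n → EucN n), MemHDiv (openSimplex b) τ →
        fortinOp b s j τ ∈ fortinSpace b s j ∧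
        MemHDiv (openSimplex b) (fortinOp b s j τ) ∧
        (∀ u, IsContFacePoly b 1 u →
          HasNormalPairing (openSimplex b) (τ - fortinOp b s j τ) u 0) ∧
        (∀ σ ∈ polyVecSpace n 0,
          ∫ x in openSimplex b, inner ℝ (σ x) (τ x - fortinOp b s j τ x) = 0)) ∧
    -- boundedness, with a constant depending only on the dimension and the shape regularity
    (∀ κ : ℝ, 0 < κ → ∃ C : ℝ, 0 < C ∧
      ∀ (b : AffineBasis (Fin (n + 1)) ℝ (EucN n)), ShapeRegular κ b →
      ∀ (s : Fin (n + 1)) (j : FortinVariant) (τ : EucN n → EucN n),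
        MemHDiv (openSimplex b) τ →
        l2Norm (openSimplex b) (fortinOp b s j τ) ≤
          C * (l2Norm (openSimplex b) τ +
            Metric.diam (openSimplex b) *
              l2Norm (openSimplex b) (weakDiv (openSimplex b) τ)) ∧
        l2Norm (openSimplex b) (weakDiv (openSimplex b) (fortinOp b s j τ)) ≤
          C * l2Norm (openSimplex b) (weakDiv (openSimplex b) τ)) ∧
    -- commutativity and idempotency
    (∀ (b : AffineBasis (Fin (n + 1)) ℝ (EucN n)) (s : Fin (n + 1)),
      (∀ τ : EucN n → EucN n, MemHDiv (openSimplex b) τ →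
        weakDiv (openSimplex b) (fortinOp b s .rt τ)
          =ᵐ[volume.restrict (openSimplex b)]
            l2Proj (openSimplex b) (polySpace n 1) (weakDiv (openSimplex b) τ)) ∧
      (∀ τ ∈ rtSpace n, fortinOp b s .rt τ = τ) ∧
      (∀ τ ∈ polyVecSpace n 0, fortinOp b s .br τ = τ)) := by
  refine ⟨fun b s j τ hτ => ⟨fortinOp_mem_fortinSpace b s j hτ.1, memHDiv_fortinOp b s j hτ.1,
    fun u hu => hasNormalPairing_sub_fortinOp b hn s j hτ hu, fun σ hσ => ?_⟩, fun κ hκ => ?_,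
    fun b s => ⟨fun τ hτ => weakDiv_fortinOp_rt b hn s hτ, fun τ hτ =>
      fortinOp_eq_self_of_preFortin_eq_self b s .rt (preFortin_rt_eq_self b hn hτ), fun τ hτ =>
      fortinOp_eq_self_of_preFortin_eq_self b s .br (preFortin_br_eq_self b hτ)⟩⟩
  · obtain ⟨c, rfl⟩ := mem_polyVecSpace_zero.1 hσ
    exact integral_inner_const_sub_fortinOp b s j hτ c
  · obtain ⟨C₁, hC₁, h₁⟩ := exists_l2Norm_fortinOp_le hn hκ
    obtain ⟨C₂, hC₂, h₂⟩ := exists_l2Norm_weakDiv_fortinOp_br_le hn hκ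
    -- The summand 1 covers the divergence bound of the Raviart–Thomas variant, where the constant
    -- is 1 by the projection property.
    refine ⟨C₁ + C₂ + 1, by positivity, fun b hb s j τ hτ => ⟨?_, ?_⟩⟩
    · refine (h₁ b hb s j τ hτ).trans (mul_le_mul_of_nonneg_right (by linarith) ?_)
      exact add_nonneg (l2Norm_nonneg _ _) (mul_nonneg Metric.diam_nonneg (l2Norm_nonneg _ _))
    · have hD := l2Norm_nonneg (openSimplex b) (weakDiv (openSimplex b) τ)
      cases j
      · refine (l2Norm_weakDiv_fortinOp_rt_le b hn s hτ).trans (le_mul_of_one_le_left hD ?_)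
        linarith
      · exact (h₂ b hb s τ hτ).trans (mul_le_mul_of_nonneg_right (by linarith) hD)
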